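/- **Setting.** A *discrete measurable groupoid* $\mathcal H$ is a groupoid (small category with all morphisms invertible), identified with its set of morphisms, with unit space $\mathcal H^0\subset\mathcal H$, source and range maps $\mathfrak s,\mathfrak r$, such that $\mathcal H$ is a standard Borel space, the structure maps are Borel and all fibres of $\mathfrak s,\mathfrak r$ are countable. For a Borel probability measure $\nu$ on $\mathcal H^0$, $(\mathcal H,\nu)$ is *pmp* if $\nu_{\mathfrak s}=\nu_{\mathfrak r}$, where $\nu_{\mathfrak s}(B)=\int|\mathfrak s^{-1}(x)\cap B|\,d\nu(x)$, $\nu_{\mathfrak r}(B)=\int|\mathfrak r^{-1}(x)\cap B|\,d\nu(x)$ for Borel $B\subset\mathcal H$; this common measure on $\mathcal H$ is again called $\nu$. $\mathcal H$ is *topological* if it has a topology for which the structure maps are continuous (the Borel structure being that of the topology). A *bisection* is an open $U\subset\mathcal H$ on which $\mathfrak s$ and $\mathfrak r$ are homeomorphisms onto open subsets of $\mathcal H^0$; $\mathcal H$ is *étale* if bisections cover it. $[\mathcal H]_{top}$ is the set of bisections $U$ with $\mathfrak s(U)=\mathfrak r(U)=\mathcal H^0$. $[[\mathcal H]]$ is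 the set of Borel $f\subset\mathcal H$ on which $\mathfrak s$ and $\mathfrak r$ are Borel isomorphisms onto their images, with product $fg=\{f'g':f'\in f,\ g'\in g\}$. $[[\mathcal H]]_{top}$ is the set of $f\in[[\mathcal H]]$ that are finite unions $f=\bigcup_{i=1}^n f_i$ such that for each $i$ there is a bisection $U_i$ with $\overline{f_i}\subset U_i$, $\overline{\mathfrak s(f_i)}\subset\mathfrak s(U_i)$, $\overline{\mathfrak r(f_i)}\subset\mathfrak r(U_i)$, the sets $\mathfrak s(f_i)$ are pairwise disjoint Borel sets with $\nu$-null boundary, and so are the sets $\mathfrak r(f_i)$. $[[d]]$ is the set of $\tau\subset\{1,\dots,d\}^2$ on which both projections are injective, with product $\tau\theta=\{(i,k):\exists j,\ (i,j)\in\tau,\ (j,k)\in\theta\}$ and $\tau\cdot j=i$ if $(i,j)\in\tau$; $|\cdot|_d=|\cdot|/d$ and $\mathrm{tr}_d(\tau)=|\{i:(i,i)\in\tau\}|_d$. For finite $F\subset[[\mathcal H]]$ and $\delta>0$, a map $\sigma:[[\mathcal H]]\to[[d]]$ is $(F,\delta)$-*multiplicative* if $|\sigma(st)\triangle\sigma(s)\sigma(t)|_d<\delta$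 for $s,t\in F$; $(F,\delta)$-*trace-preserving* if $|\mathrm{tr}_d(\sigma(s))-\nu(\mathcal H^0\cap s)|<\delta$ for $s\in F$; $(F,\delta)$-*continuous* if $|\sigma(s)\triangle\sigma(t)|_d<\delta+\nu(s\triangle t)$ for $s,t\in F$. A *sofic approximation* $\mathbb P$ to $(\mathcal H,\nu)$ consists of a nonempty directed set $J$, integers $d_j$ and probability measures $\mathbb P_j$ on $\mathrm{Map}([[\mathcal H]],[[d_j]])$ (with the product $\sigma$-algebra) such that, for all finite $F\subset[[\mathcal H]]$ and $\delta>0$: (1) $\mathbb P_j(\sigma\text{ is }(F,\delta)\text{-trace-preserving})\to1$; (2) for all large $j$, $\mathbb P_j$-a.e. $\sigma$ is $(F,\delta)$-multiplicative; (3) $d_j\to\infty$; (4) if $\nu(f\triangle f')=0$ then $\sigma(f)=\sigma(f')$ for $\mathbb P_j$-a.e. $\sigma$, for every $j$. It is *asymptotically continuous* if for all finite $F$ and $\delta>0$, for all large $j$, $\mathbb P_j$-a.e. $\sigma$ is $(F,\delta)$-continuous. A *bias* $\beta$ is $-$, $+$, or an ultrafilter on $J$ containing all sets $\{j':j'\ge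 j\}$; $\lim_{j\to\beta}$ is $\liminf_j$, $\limsup_j$ or the ultralimit respectively, in $[-\infty,\infty]$. $\|\cdot\|_{p,\mathbb P_j}$ is the $L^p(\mathbb P_j)$-norm in the variable $\sigma$, and $\log0=-\infty$. A continuous groupoid morphism $\pi:\mathcal G\to\mathcal H$ is a *class-bijective factor* if it is surjective and maps $\mathfrak s^{-1}(a)$ bijectively onto $\mathfrak s^{-1}(\pi(a))$ and $\mathfrak r^{-1}(a)$ bijectively onto $\mathfrak r^{-1}(\pi(a))$ for every $a\in\mathcal G^0$. For $f\subset\mathcal H$, $A\subset\mathcal G^0$ put $f\cdot A=\mathfrak r(\pi^{-1}(f)\cap\mathfrak s^{-1}(A))$; for $f\in[[\mathcal H]]$ and $x\in\mathcal G^0$, $f\cdot x\in\mathcal G^0$ is the element of $f\cdot\{x\}$ if $\pi(x)\in\mathfrak s(f)$, and $f\cdot x=*$ otherwise. A continuous pseudo-metric $\rho$ on $\mathcal G^0$ is *dynamically generating* if for all $x\ne y$ in $\mathcal G^0$ there is $f\in[\mathcal H]_{top}$ with $\rho(f\cdot x,f\cdot y)>0$. Extend $\rho$ by $\rho(*,*)=0$,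 $\rho(*,x)=\rho(x,*)=\max\rho$, and on $d$-tuples put $\rho_2(x,x')=(\frac1d\sum_i\rho(x_i,x_i')^2)^{1/2}$, $\rho_\infty(x,x')=\max_i\rho(x_i,x'_i)$. $N_\epsilon(A,\rho')$ is the maximal cardinality of a set $S\subset A$ with $\rho'(y_1,y_2)>\epsilon$ for all distinct $y_1,y_2\in S$. **Pseudo-metric entropy.** For finite $F\subset[[\mathcal H]]_{top}$, finite $K\subset C(\mathcal G^0)$ (continuous complex functions) and $\delta>0$, $\mathrm{Orb}_\mu(\pi,\sigma,F,K,\delta,\rho)$ is the set of $x\in(\mathcal G^0)^d$ with $\rho_2\big((f\cdot x_i)_i,(x_{\sigma(f)\cdot i})_i\big)<\delta$ for $f\in F$ (with $x_{\sigma(f)\cdot i}=*$ if $\sigma(f)\cdot i$ is undefined) and $|\frac1d\sum_ik(x_i)-\int k\,d\mu|<\delta$ for $k\in K$. For $q\in\{2,\infty\}$, $$h_{\mathbb P,\mu}(\pi,\rho,q)=\sup_{\epsilon>0}\inf_{\delta>0}\inf_{F\subset[[\mathcal H]]_{top}}\inf_{K}\lim_{j\to\beta}\tfrac1{d_j}\log\|N_\epsilon(\mathrm{Orb}_\mu(\pi,\cdot,F,K,\delta,\rho),\rho_q)\|_{p,\mathbb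 P_j}.$$ **Partition entropy.** For a finite Borel partition $\mathcal P$ of $\mathcal G^0$ and finite $F\subset[[\mathcal H]]$ with $\mathcal H^0\in F$, $\mathcal P^F$ is the coarsest partition such that each $f\cdot P$ ($f\in F$, $P\in\mathcal P$) is a union of atoms, and $\Sigma(\cdot)$ is the generated $\sigma$-algebra. $\mathrm{Hom}(\pi,\sigma,\mathcal P,F,\delta)$ is the set of maps $\phi:\Sigma(\mathcal P^F)\to2^{\{1,\dots,d\}}$ preserving $\cup$, $\cap$, $\emptyset$ and the full set, with $\sum_{P\in\mathcal P}|\sigma(f)\cdot\phi(P)\triangle\phi(f\cdot P)|_d<\delta$ for $f\in F$ and $\sum_{P\in\mathcal P^F}\big||\phi(P)|_d-\mu(P)\big|<\delta$. If $\mathcal P$ refines $\mathcal Q$, $|\mathrm{Hom}(\pi,\sigma,\mathcal P,F,\delta)|_{\mathcal Q}$ is the number of restrictions of its elements to $\Sigma(\mathcal Q)$. With $\mathcal Q,\mathcal P$ ranging over finite Borel partitions, $$h_{\mathbb P,\mu}(\pi)=\sup_{\mathcal Q}\ \inf_{\mathcal P\text{ refining }\mathcal Q}\ \inf_{F\ni\mathcal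 H^0}\ \inf_{\delta>0}\ \lim_{j\to\beta}\tfrac1{d_j}\log\big\||\mathrm{Hom}(\pi,\cdot,\mathcal P,F,\delta)|_{\mathcal Q}\big\|_{p,\mathbb P_j}.$$ **Theorem 9.5.** Let $(\mathcal G,\mu)$, $(\mathcal H,\nu)$ be discrete pmp topological groupoids with $\mathcal G^0,\mathcal H^0$ compact and metrizable and $\mathcal H$ Hausdorff, $\pi:\mathcal G\to\mathcal H$ a continuous class-bijective factor with $\pi_*\mu=\nu$, $\mathbb P$ a sofic approximation to $(\mathcal H,\nu)$, $\beta$ a bias and $p\in[1,\infty]$. Assume that $\rho$ is a dynamically generating continuous pseudo-metric on $\mathcal G^0$, that $\mathcal H$ and $\mathcal G$ are étale, that the measure $\nu$ on $\mathcal H$ is regular and that $\mathbb P$ is asymptotically continuous. Then $$h_{\mathbb P,\mu}(\pi,\rho,2)=h_{\mathbb P,\mu}(\pi,\rho,\infty)=h_{\mathbb P,\mu}(\pi).$$ -/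

import Mathlib

open MeasureTheory Filter Topology Set
open scoped ENNReal symmDiff

noncomputable section

namespace SoficGroupoid

/-! ### Groupoids -/

/-- A groupoid, i.e. a small category all of whose morphisms are invertible, presented by its set
`X` of objects, its set `H` of morphisms (arrows), the source map `s`, the range map `r`, the
inclusion `unit` of objects as identity arrows, and the composition `comp f g = fg`, which is
defined exactly for the pairs with `s f = r g`. -/
structure Gpd (X H : Type*) where
  s : H → X
  r : H → X
  unit : X → H
  inv : H → H
  comp : (f g : H) → s f = r g → H
  s_unit : ∀ x, s (unit x) = x
  r_unit : ∀ x, r (unit x) = x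
  s_comp : ∀ f g h, s (comp f g h) = s g
  r_comp : ∀ f g h, r (comp f g h) = r f
  unit_comp : ∀ f, comp (unit (r f)) f (s_unit _) = f
  comp_unit : ∀ f, comp f (unit (s f)) (r_unit _).symm = f
  assoc : ∀ f g k (h₁ : s f = r g) (h₂ : s g = r k),
    comp (comp f g h₁) k ((s_comp f g h₁).trans h₂)
      = comp f (comp g k h₂) (h₁.trans (r_comp g k h₂).symm)
  s_inv : ∀ f, s (inv f) = r f
  r_inv : ∀ f, r (inv f) = s f
  inv_comp : ∀ f, comp (inv f) f (s_inv f) = unit (s f)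
  comp_inv : ∀ f, comp f (inv f) (r_inv f).symm = unit (r f)

/-- A discrete measurable groupoid: the arrows form a standard Borel space, the structure maps are
Borel (the set of composable pairs carries the σ-algebra induced by the product), and the fibres of
the source and range maps are countable. The objects are identified with a Borel set of arrows:
`unit` and `s` are Borel and `s ∘ unit = id`. -/
structure MGpd (X H : Type*) [MeasurableSpace X] [MeasurableSpace H] [StandardBorelSpace H]
    extends Gpd X H where
  measurable_s : Measurable s
  measurable_r : Measurable r
  measurable_unit : Measurable unit
  measurable_inv : Measurable inv
  measurable_comp : Measurable fun p : {p : H × H // s p.1 = r p.2} => comp p.1.1 p.1.2 p.2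
  countable_s : ∀ x, (s ⁻¹' {x}).Countable
  countable_r : ∀ x, (r ⁻¹' {x}).Countable

/-- The structure maps are continuous. (The topology of the object space is then the one induced
from the arrows, since `s` is a continuous left inverse of `unit`.) -/
structure Gpd.IsTopological {X H : Type*} [TopologicalSpace X] [TopologicalSpace H]
    (𝓗 : Gpd X H) : Prop where
  continuous_s : Continuous 𝓗.s
  continuous_r : Continuous 𝓗.r
  continuous_unit : Continuous 𝓗.unit
  continuous_inv : Continuous 𝓗.inv
  continuous_comp :
    Continuous fun p : {p : H × H // 𝓗.s p.1 = 𝓗.r p.2} => 𝓗.comp p.1.1 p.1.2 p.2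

namespace Gpd

variable {X H : Type*}

/-- The product `fg = {f'g' : f' ∈ f, g' ∈ g}` of two sets of arrows. -/
def setMul (𝓗 : Gpd X H) (f g : Set H) : Set H :=
  {h | ∃ a ∈ f, ∃ b ∈ g, ∃ hab : 𝓗.s a = 𝓗.r b, 𝓗.comp a b hab = h}

section topological

variable [TopologicalSpace X] [TopologicalSpace H]

/-- An open set of arrows on which source and range restrict to homeomorphisms onto open sets of
objects. -/
def IsBisection (𝓗 : Gpd X H) (U : Set H) : Prop :=
  IsOpen U ∧ IsOpenEmbedding (U.domRestrict 𝓗.s) ∧ IsOpenEmbedding (U.domRestrict 𝓗.r)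

/-- Every arrow lies in a bisection. -/
def IsEtale (𝓗 : Gpd X H) : Prop :=
  ∀ g : H, ∃ U, 𝓗.IsBisection U ∧ g ∈ U

/-- The topological full group: the bisections whose source and range are all of the object
space. -/
def topFullGroup (𝓗 : Gpd X H) : Set (Set H) :=
  {U | 𝓗.IsBisection U ∧ 𝓗.s '' U = univ ∧ 𝓗.r '' U = univ}

end topological

section measure

variable [MeasurableSpace X]

/-- `ν_s(B) = ∫ |s⁻¹(x) ∩ B| dν(x)`. -/
def sourceMass (𝓗 : Gpd X H) (ν : Measure X) (B : Set H) : ℝ≥0∞ :=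
  ∫⁻ x, ((𝓗.s ⁻¹' {x} ∩ B).encard : ℝ≥0∞) ∂ν

/-- `ν_r(B) = ∫ |r⁻¹(x) ∩ B| dν(x)`. -/
def rangeMass (𝓗 : Gpd X H) (ν : Measure X) (B : Set H) : ℝ≥0∞ :=
  ∫⁻ x, ((𝓗.r ⁻¹' {x} ∩ B).encard : ℝ≥0∞) ∂ν

/-- Probability-measure-preserving: `ν` is a probability measure and `ν_s = ν_r`. -/
def IsPMP [MeasurableSpace H] (𝓗 : Gpd X H) (ν : Measure X) : Prop :=
  IsProbabilityMeasure ν ∧ ∀ B, MeasurableSet B → 𝓗.sourceMass ν B = 𝓗.rangeMass ν B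

/-- The measure `ν_s` on the space of arrows is regular. -/
def IsRegularMeasure [MeasurableSpace H] [TopologicalSpace H] (𝓗 : Gpd X H) (ν : Measure X) :
    Prop :=
  ∃ νH : Measure H, (∀ B, MeasurableSet B → νH B = 𝓗.sourceMass ν B) ∧ νH.Regular

end measure

end Gpd

/-! ### The semigroup of partial automorphisms -/

section partialAut

variable {X H : Type*} [MeasurableSpace X] [MeasurableSpace H] [StandardBorelSpace H]

/-- `f` is Borel and source and range restricted to `f` are Borel isomorphisms onto their
images. -/
def MGpd.IsPartialAut (𝓗 : MGpd X H) (f : Set H) : Prop :=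
  MeasurableSet f ∧ MeasurableEmbedding (f.domRestrict 𝓗.s) ∧ MeasurableEmbedding (f.domRestrict 𝓗.r)

/-- The semigroup `⟦𝓗⟧` of partial automorphisms. -/
def PartialAut (𝓗 : MGpd X H) : Type _ := {f : Set H // 𝓗.IsPartialAut f}

theorem MGpd.measurableEmbedding_of_injOn (𝓗 : MGpd X H) {t : H → X} (ht : Measurable t)
    {f : Set H} (hf : MeasurableSet f) (hinj : InjOn t f) :
    MeasurableEmbedding (f.domRestrict t) := by
  have hu : Function.Injective 𝓗.unit := fun x y h => by
    rw [← 𝓗.s_unit x, ← 𝓗.s_unit y, h]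
  refine ⟨injOn_iff_injective.1 hinj, ht.comp measurable_subtype_coe, fun A hA => ?_⟩
  have hA' : MeasurableSet ((↑) '' A : Set H) := hf.subtype_image hA
  have h1 : MeasurableSet ((𝓗.unit ∘ t) '' ((↑) '' A : Set H)) := by
    refine hA'.image_of_measurable_injOn (𝓗.measurable_unit.comp ht) ?_
    rintro _ ⟨a, -, rfl⟩ _ ⟨b, -, rfl⟩ hab
    exact hinj a.2 b.2 (hu hab)
  have h2 : f.domRestrict t '' A = 𝓗.unit ⁻¹' ((𝓗.unit ∘ t) '' ((↑) '' A : Set H)) := by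
    ext x
    constructor
    · rintro ⟨a, ha, rfl⟩
      exact ⟨a, ⟨a, ha, rfl⟩, rfl⟩
    · rintro ⟨_, ⟨a, ha, rfl⟩, h⟩
      exact ⟨a, ha, hu h⟩
  rw [h2]
  exact 𝓗.measurable_unit h1

theorem MGpd.isPartialAut_iff (𝓗 : MGpd X H) (f : Set H) :
    𝓗.IsPartialAut f ↔ MeasurableSet f ∧ InjOn 𝓗.s f ∧ InjOn 𝓗.r f :=
  ⟨fun h => ⟨h.1, injOn_iff_injective.2 h.2.1.injective, injOn_iff_injective.2 h.2.2.injective⟩,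
    fun h => ⟨h.1, 𝓗.measurableEmbedding_of_injOn 𝓗.measurable_s h.1 h.2.1,
      𝓗.measurableEmbedding_of_injOn 𝓗.measurable_r h.1 h.2.2⟩⟩

theorem MGpd.isPartialAut_setMul (𝓗 : MGpd X H) {f g : Set H} (hf : 𝓗.IsPartialAut f)
    (hg : 𝓗.IsPartialAut g) : 𝓗.IsPartialAut (𝓗.setMul f g) := by
  rw [MGpd.isPartialAut_iff] at *
  obtain ⟨hfm, hfs, hfr⟩ := hf
  obtain ⟨hgm, hgs, hgr⟩ := hg
  have hu : Function.Injective 𝓗.unit := fun x y h => by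
    rw [← 𝓗.s_unit x, ← 𝓗.s_unit y, h]
  have hs : InjOn 𝓗.s (𝓗.setMul f g) := by
    rintro _ ⟨a, ha, b, hb, hab, rfl⟩ _ ⟨a', ha', b', hb', hab', rfl⟩ h
    rw [𝓗.s_comp, 𝓗.s_comp] at h
    obtain rfl := hgs hb hb' h
    obtain rfl := hfs ha ha' (hab.trans hab'.symm)
    rfl
  have hr : InjOn 𝓗.r (𝓗.setMul f g) := by
    rintro _ ⟨a, ha, b, hb, hab, rfl⟩ _ ⟨a', ha', b', hb', hab', rfl⟩ h
    rw [𝓗.r_comp, 𝓗.r_comp] at h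
    obtain rfl := hfr ha ha' h
    obtain rfl := hgr hb hb' (hab.symm.trans hab')
    rfl
  refine ⟨?_, hs, hr⟩
  have hC : MeasurableSet {p : H × H | 𝓗.s p.1 = 𝓗.r p.2} := by
    have : {p : H × H | 𝓗.s p.1 = 𝓗.r p.2}
        = {p : H × H | 𝓗.unit (𝓗.s p.1) = 𝓗.unit (𝓗.r p.2)} := by
      ext p
      exact ⟨fun h => congrArg 𝓗.unit h, fun h => hu h⟩
    rw [this]
    let _ := upgradeStandardBorel H
    exact measurableSet_eq_fun
      (𝓗.measurable_unit.comp (𝓗.measurable_s.comp measurable_fst))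
      (𝓗.measurable_unit.comp (𝓗.measurable_r.comp measurable_snd))
  have : StandardBorelSpace {p : H × H // 𝓗.s p.1 = 𝓗.r p.2} := hC.standardBorel
  have hD : MeasurableSet {p : {p : H × H // 𝓗.s p.1 = 𝓗.r p.2} | p.1.1 ∈ f ∧ p.1.2 ∈ g} :=
    (measurable_subtype_coe.fst hfm).inter (measurable_subtype_coe.snd hgm)
  have himg : 𝓗.setMul f g
      = (fun p : {p : H × H // 𝓗.s p.1 = 𝓗.r p.2} => 𝓗.comp p.1.1 p.1.2 p.2) ''
        {p | p.1.1 ∈ f ∧ p.1.2 ∈ g} := by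
    ext h
    constructor
    · rintro ⟨a, ha, b, hb, hab, rfl⟩
      exact ⟨⟨(a, b), hab⟩, ⟨ha, hb⟩, rfl⟩
    · rintro ⟨⟨⟨a, b⟩, hab⟩, ⟨ha, hb⟩, rfl⟩
      exact ⟨a, ha, b, hb, hab, rfl⟩
  rw [himg]
  refine hD.image_of_measurable_injOn 𝓗.measurable_comp ?_
  rintro ⟨⟨a, b⟩, hab⟩ ⟨ha, hb⟩ ⟨⟨a', b'⟩, hab'⟩ ⟨ha', hb'⟩ h
  have h1 := congrArg 𝓗.s h
  have h2 := congrArg 𝓗.r h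
  simp only [𝓗.s_comp, 𝓗.r_comp] at h1 h2
  obtain rfl := hgs hb hb' h1
  obtain rfl := hfr ha ha' h2
  rfl

theorem MGpd.isPartialAut_units (𝓗 : MGpd X H) : 𝓗.IsPartialAut (range 𝓗.unit) := by
  rw [MGpd.isPartialAut_iff]
  refine ⟨?_, ?_, ?_⟩
  · have : range 𝓗.unit = {h | 𝓗.unit (𝓗.s h) = h} := by
      ext h
      constructor
      · rintro ⟨x, rfl⟩
        exact congrArg 𝓗.unit (𝓗.s_unit x)
      · intro hh
        exact ⟨_, hh⟩
    rw [this]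
    let _ := upgradeStandardBorel H
    exact measurableSet_eq_fun (𝓗.measurable_unit.comp 𝓗.measurable_s) measurable_id
  · rintro _ ⟨x, rfl⟩ _ ⟨y, rfl⟩ h
    rw [𝓗.s_unit, 𝓗.s_unit] at h
    rw [h]
  · rintro _ ⟨x, rfl⟩ _ ⟨y, rfl⟩ h
    rw [𝓗.r_unit, 𝓗.r_unit] at h
    rw [h]

/-- Composition in `⟦𝓗⟧`. -/
instance (𝓗 : MGpd X H) : Mul (PartialAut 𝓗) :=
  ⟨fun f g => ⟨𝓗.setMul f.1 g.1, 𝓗.isPartialAut_setMul f.2 g.2⟩⟩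

/-- The unit of `⟦𝓗⟧` is the object space, seen as a set of arrows. -/
instance (𝓗 : MGpd X H) : One (PartialAut 𝓗) :=
  ⟨⟨range 𝓗.unit, 𝓗.isPartialAut_units⟩⟩

/-- The trace `ν(𝓗⁰ ∩ f)`. -/
def trace (𝓗 : MGpd X H) (ν : Measure X) (f : PartialAut 𝓗) : ℝ :=
  (ν {x | 𝓗.unit x ∈ f.1}).toReal

/-- `ν(f ∆ g)`. -/
def massDiff (𝓗 : MGpd X H) (ν : Measure X) (f g : PartialAut 𝓗) : ℝ :=
  (𝓗.sourceMass ν (f.1 ∆ g.1)).toReal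

/-- The algebra of Borel sets whose boundary has measure zero. -/
def nullBoundary (Z : Type*) [TopologicalSpace Z] [MeasurableSpace Z] (lam : Measure Z) :
    Set (Set Z) :=
  {A | MeasurableSet A ∧ lam (frontier A) = 0}

/-- The set `⟦𝓗⟧_top`. -/
def topPartialAut [TopologicalSpace X] [TopologicalSpace H] (𝓗 : MGpd X H) (ν : Measure X) :
    Set (PartialAut 𝓗) :=
  {f | ∃ (n : ℕ) (fi : Fin n → Set H), f.1 = ⋃ i, fi i ∧
    (∀ i, ∃ U, 𝓗.IsBisection U ∧ closure (fi i) ⊆ U ∧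
      closure (𝓗.s '' fi i) ⊆ 𝓗.s '' U ∧ closure (𝓗.r '' fi i) ⊆ 𝓗.r '' U) ∧
    (∀ i, 𝓗.s '' fi i ∈ nullBoundary X ν) ∧
    (Pairwise fun i j => Disjoint (𝓗.s '' fi i) (𝓗.s '' fi j)) ∧
    (∀ i, 𝓗.r '' fi i ∈ nullBoundary X ν) ∧
    (Pairwise fun i j => Disjoint (𝓗.r '' fi i) (𝓗.r '' fi j))}

end partialAut

/-! ### The full groupoid on `d` points -/

/-- The semigroup `⟦d⟧` of partial automorphisms of the full groupoid `{1, …, d}²`, in which the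
arrow `(i, j)` has range `i` and source `j`: sets of pairs on which both projections are
injective. -/
def PartialPerm (d : ℕ) : Type :=
  {τ : Set (Fin d × Fin d) // InjOn Prod.fst τ ∧ InjOn Prod.snd τ}

namespace PartialPerm

variable {d : ℕ}

/-- `⟦d⟧` is a finite set and carries the σ-algebra of all its subsets. -/
instance : MeasurableSpace (PartialPerm d) := ⊤

/-- Composition, from `(i, j)(j, k) = (i, k)`. -/
instance : Mul (PartialPerm d) :=
  ⟨fun τ θ => ⟨{p | ∃ j, (p.1, j) ∈ τ.1 ∧ (j, p.2) ∈ θ.1}, by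
    constructor
    · rintro ⟨i, k⟩ ⟨j, h1, h2⟩ ⟨i', k'⟩ ⟨j', h1', h2'⟩ (rfl : i = i')
      obtain rfl : j = j' := congrArg Prod.snd (τ.2.1 h1 h1' rfl)
      exact Prod.ext rfl (congrArg Prod.snd (θ.2.1 h2 h2' rfl) :)
    · rintro ⟨i, k⟩ ⟨j, h1, h2⟩ ⟨i', k'⟩ ⟨j', h1', h2'⟩ (rfl : k = k')
      obtain rfl : j = j' := congrArg Prod.fst (θ.2.2 h2 h2' rfl)
      exact Prod.ext (congrArg Prod.fst (τ.2.2 h1 h1' rfl) :) rfl⟩⟩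

/-- `τ · A` for a set `A` of points. -/
def act (τ : PartialPerm d) (A : Set (Fin d)) : Set (Fin d) := {i | ∃ j ∈ A, (i, j) ∈ τ.1}

open Classical in
/-- `τ · j`, or `none` if `j` is not in the source of `τ`. -/
def actPt (τ : PartialPerm d) (j : Fin d) : Option (Fin d) :=
  if h : ∃ i, (i, j) ∈ τ.1 then some h.choose else none

end PartialPerm

/-- The normalised cardinality `|A|_d = |A| / d`. -/
def normCard (d : ℕ) {α : Type*} (A : Set α) : ℝ := (A.ncard : ℝ) / d

/-- The trace `|τ ∩ Δ_d⁰| / d`. -/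
def PartialPerm.trace {d : ℕ} (τ : PartialPerm d) : ℝ := normCard d {i : Fin d | (i, i) ∈ τ.1}

/-! ### Sofic approximations -/

section sofic

variable {X H : Type*} [MeasurableSpace X] [MeasurableSpace H] [StandardBorelSpace H]

/-- `Map(⟦𝓗⟧, ⟦d⟧)`, with the σ-algebra generated by the sets of maps with prescribed values at
finitely many elements of `⟦𝓗⟧`, i.e. the product σ-algebra. -/
abbrev SoficMap (𝓗 : MGpd X H) (d : ℕ) : Type _ := PartialAut 𝓗 → PartialPerm d

/-- `(F, δ)`-multiplicative. -/
def IsMultiplicative {𝓗 : MGpd X H} {d : ℕ} (F : Finset (PartialAut 𝓗)) (δ : ℝ)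
    (σ : SoficMap 𝓗 d) : Prop :=
  ∀ a ∈ F, ∀ b ∈ F, normCard d ((σ (a * b)).1 ∆ (σ a * σ b).1) < δ

/-- `(F, δ)`-trace-preserving. -/
def IsTracePreserving {𝓗 : MGpd X H} (ν : Measure X) {d : ℕ} (F : Finset (PartialAut 𝓗)) (δ : ℝ)
    (σ : SoficMap 𝓗 d) : Prop :=
  ∀ a ∈ F, |(σ a).trace - trace 𝓗 ν a| < δ

/-- `(F, δ)`-continuous. -/
def IsContinuousMap {𝓗 : MGpd X H} (ν : Measure X) {d : ℕ} (F : Finset (PartialAut 𝓗)) (δ : ℝ)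
    (σ : SoficMap 𝓗 d) : Prop :=
  ∀ a ∈ F, ∀ b ∈ F, normCard d ((σ a).1 ∆ (σ b).1) < δ + massDiff 𝓗 ν a b

variable {J : Type*} [Preorder J]

/-- A sofic approximation to `(𝓗, ν)` indexed by a directed set `J`. -/
structure IsSoficApprox (𝓗 : MGpd X H) (ν : Measure X) (d : J → ℕ)
    (P : ∀ j, Measure (SoficMap 𝓗 (d j))) : Prop where
  prob : ∀ j, IsProbabilityMeasure (P j)
  tracePreserving : ∀ (F : Finset (PartialAut 𝓗)) (δ : ℝ), 0 < δ →
    Tendsto (fun j => P j {σ | IsTracePreserving ν F δ σ}) atTop (𝓝 1)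
  multiplicative : ∀ (F : Finset (PartialAut 𝓗)) (δ : ℝ), 0 < δ →
    ∃ j, ∀ j', j ≤ j' → ∀ᵐ σ ∂(P j'), IsMultiplicative F δ σ
  tendsto_d : Tendsto d atTop atTop
  ae_eq : ∀ f f' : PartialAut 𝓗, 𝓗.sourceMass ν (f.1 ∆ f'.1) = 0 →
    ∀ j, ∀ᵐ σ ∂(P j), σ f = σ f'

/-- Asymptotic continuity of a sofic approximation. -/
def IsAsymptoticallyContinuous (𝓗 : MGpd X H) (ν : Measure X) (d : J → ℕ)
    (P : ∀ j, Measure (SoficMap 𝓗 (d j))) : Prop :=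
  ∀ (F : Finset (PartialAut 𝓗)) (δ : ℝ), 0 < δ →
    ∃ j, ∀ j', j ≤ j' → ∀ᵐ σ ∂(P j'), IsContinuousMap ν F δ σ

/-- A bias for `J`: the symbol `-`, the symbol `+`, or an ultrafilter on `J` that contains every
set `{j' | j ≤ j'}`. -/
inductive Bias (J : Type*) [Preorder J]
  | minus : Bias J
  | plus : Bias J
  | ultra (U : Ultrafilter J) (hU : ∀ j, Ici j ∈ U) : Bias J

/-- `lim_{j → β} Φ(j)`: lower limit, upper limit, or ultralimit (which always exists in the compact
space `[-∞, ∞]`). -/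
def Bias.lim : Bias J → (J → EReal) → EReal
  | .minus, Φ => liminf Φ atTop
  | .plus, Φ => limsup Φ atTop
  | .ultra U _, Φ => limUnder (U : Filter J) Φ

/-- `lim_{j → β} (1 / d_j) log ‖N_j‖_{p, P_j}`, with `log 0 = -∞`. -/
def growthRate {𝓗 : MGpd X H} (d : J → ℕ) (P : ∀ j, Measure (SoficMap 𝓗 (d j))) (β : Bias J)
    (p : ℝ≥0∞) (N : ∀ j, SoficMap 𝓗 (d j) → ℝ≥0∞) : EReal :=
  β.lim fun j => (((d j : ℝ)⁻¹ : ℝ) : EReal) * ENNReal.log (eLpNorm (N j) p (P j))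

end sofic

/-! ### Extensions -/

section extension

variable {Y G X H : Type*}

/-- A groupoid morphism, with its maps on arrows and on objects. -/
structure GpdHom (𝓖 : Gpd Y G) (𝓗 : Gpd X H) where
  arr : G → H
  obj : Y → X
  s_arr : ∀ g, 𝓗.s (arr g) = obj (𝓖.s g)
  r_arr : ∀ g, 𝓗.r (arr g) = obj (𝓖.r g)
  arr_unit : ∀ y, arr (𝓖.unit y) = 𝓗.unit (obj y)
  arr_inv : ∀ g, arr (𝓖.inv g) = 𝓗.inv (arr g)
  arr_comp : ∀ f g (h : 𝓖.s f = 𝓖.r g),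
    arr (𝓖.comp f g h) = 𝓗.comp (arr f) (arr g) ((s_arr f).trans ((congrArg obj h).trans
      (r_arr g).symm))

namespace GpdHom

variable {𝓖 : Gpd Y G} {𝓗 : Gpd X H}

/-- A class-bijective factor map: surjective, and bijective from each source fibre, and from each
range fibre, onto the corresponding fibre downstairs. -/
structure IsClassBijective (π : GpdHom 𝓖 𝓗) : Prop where
  surjective : Function.Surjective π.arr
  bijOn_s : ∀ a, BijOn π.arr (𝓖.s ⁻¹' {a}) (𝓗.s ⁻¹' {π.obj a})
  bijOn_r : ∀ a, BijOn π.arr (𝓖.r ⁻¹' {a}) (𝓗.r ⁻¹' {π.obj a})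

/-- `f · A = r(π⁻¹(f) A)` for a set `f` of arrows of `𝓗` and a set `A` of objects of `𝓖`. -/
def act (π : GpdHom 𝓖 𝓗) (f : Set H) (A : Set Y) : Set Y :=
  {y | ∃ g, π.arr g ∈ f ∧ 𝓖.s g ∈ A ∧ 𝓖.r g = y}

open Classical in
/-- `f · y = r(π⁻¹(f) y)`, or `none` (the symbol `*`) if `π(y)` is not in the source of `f`. The
arrow of `π⁻¹(f)` with source `y` is unique when `π` is class-bijective and the source map is
injective on `f`. -/
def actPt (π : GpdHom 𝓖 𝓗) (f : Set H) (y : Y) : Option Y :=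
  if h : ∃ g, π.arr g ∈ f ∧ 𝓖.s g = y then some (𝓖.r h.choose) else none

end GpdHom

end extension

/-! ### Measure entropy via pseudo-metrics -/

section pseudometric

variable {Y : Type*}

/-- Extension of `ρ` to `Y ∪ {*}`: `ρ(*, *) = 0` and `ρ(*, x)` is the diameter of `ρ`. -/
def extDist (ρ : Y → Y → ℝ) : Option Y → Option Y → ℝ
  | some x, some y => ρ x y
  | none, none => 0
  | none, some _ => ⨆ q : Y × Y, ρ q.1 q.2
  | some _, none => ⨆ q : Y × Y, ρ q.1 q.2

/-- `ρ₂` on `d`-tuples. -/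
def dist₂ {Z : Type*} (ρ : Z → Z → ℝ) {d : ℕ} (x x' : Fin d → Z) : ℝ :=
  Real.sqrt ((1 / (d : ℝ)) * ∑ i, ρ (x i) (x' i) ^ 2)

/-- `ρ_∞` on `d`-tuples. -/
def distSup {Z : Type*} (ρ : Z → Z → ℝ) {d : ℕ} (x x' : Fin d → Z) : ℝ :=
  ⨆ i, ρ (x i) (x' i)

/-- `N_ε(A, D)`: the maximal cardinality of a `(D, ε)`-separated subset of `A`. -/
def sepNumber {Z : Type*} (D : Z → Z → ℝ) (ε : ℝ) (A : Set Z) : ℕ∞ :=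
  ⨆ (S : Set Z) (_ : S ⊆ A ∧ ∀ y₁ ∈ S, ∀ y₂ ∈ S, y₁ ≠ y₂ → ε < D y₁ y₂), S.encard

variable {G X H : Type*} [MeasurableSpace Y] [MeasurableSpace G] [StandardBorelSpace G]
  [MeasurableSpace X] [MeasurableSpace H] [StandardBorelSpace H]
  [TopologicalSpace Y] [TopologicalSpace X] [TopologicalSpace H]
  {𝓖 : MGpd Y G} {𝓗 : MGpd X H}

/-- `ρ` is dynamically generating: distinct points are `ρ`-separated by an element of the
topological full group of `𝓗`. -/
def IsDynamicallyGenerating (π : GpdHom 𝓖.toGpd 𝓗.toGpd) (ρ : Y → Y → ℝ) : Prop :=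
  ∀ x y, x ≠ y → ∃ f ∈ 𝓗.topFullGroup, 0 < extDist ρ (π.actPt f x) (π.actPt f y)

/-- The approximate partial orbits `Orb_μ(π, σ, F, K, δ, ρ)`. -/
def orb (μ : Measure Y) (π : GpdHom 𝓖.toGpd 𝓗.toGpd) (ρ : Y → Y → ℝ) {d : ℕ}
    (F : Finset (PartialAut 𝓗)) (K : Finset C(Y, ℂ)) (δ : ℝ) (σ : SoficMap 𝓗 d) :
    Set (Fin d → Y) :=
  {x | (∀ f ∈ F, dist₂ (extDist ρ) (fun i => π.actPt f.1 (x i))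
          (fun i => ((σ f).actPt i).map x) < δ) ∧
    ∀ k ∈ K, ‖(1 / (d : ℂ)) * ∑ i, k (x i) - ∫ y, k y ∂μ‖ < δ}

variable {J : Type*} [Preorder J]

/-- `h_{P,μ}(π, ρ, 2)`. -/
def pseudometricEntropy₂ (ν : Measure X) (μ : Measure Y) (π : GpdHom 𝓖.toGpd 𝓗.toGpd)
    (d : J → ℕ) (P : ∀ j, Measure (SoficMap 𝓗 (d j))) (β : Bias J) (p : ℝ≥0∞)
    (ρ : Y → Y → ℝ) : EReal :=
  ⨆ (ε : ℝ) (_ : 0 < ε), ⨅ (δ : ℝ) (_ : 0 < δ),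
    ⨅ (F : Finset (PartialAut 𝓗)) (_ : (F : Set (PartialAut 𝓗)) ⊆ topPartialAut 𝓗 ν),
      ⨅ K : Finset C(Y, ℂ),
        growthRate d P β p fun _ σ => (sepNumber (dist₂ ρ) ε (orb μ π ρ F K δ σ) : ℝ≥0∞)

/-- `h_{P,μ}(π, ρ, ∞)`. -/
def pseudometricEntropySup (ν : Measure X) (μ : Measure Y) (π : GpdHom 𝓖.toGpd 𝓗.toGpd)
    (d : J → ℕ) (P : ∀ j, Measure (SoficMap 𝓗 (d j))) (β : Bias J) (p : ℝ≥0∞)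
    (ρ : Y → Y → ℝ) : EReal :=
  ⨆ (ε : ℝ) (_ : 0 < ε), ⨅ (δ : ℝ) (_ : 0 < δ),
    ⨅ (F : Finset (PartialAut 𝓗)) (_ : (F : Set (PartialAut 𝓗)) ⊆ topPartialAut 𝓗 ν),
      ⨅ K : Finset C(Y, ℂ),
        growthRate d P β p fun _ σ => (sepNumber (distSup ρ) ε (orb μ π ρ F K δ σ) : ℝ≥0∞)

end pseudometric

/-! ### Measure entropy via partitions

A finite partition of `Y` is a `Finpartition (univ : Set Y)`; in Mathlib's order `P ≤ Q` says that
`P` refines `Q`. -/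

section partition

variable {Y : Type*}

/-- The σ-algebra `Σ(P)` generated by a partition. -/
abbrev sigmaAlg (P : Finpartition (univ : Set Y)) : MeasurableSpace Y :=
  MeasurableSpace.generateFrom (P.parts : Set (Set Y))

/-- All atoms of the partition are Borel. -/
def IsBorelPartition [MeasurableSpace Y] (P : Finpartition (univ : Set Y)) : Prop :=
  ∀ A ∈ P.parts, MeasurableSet A

/-- The maps from `Σ(P)` to the subsets of `{1, …, d}`. -/
abbrev SetMap (P : Finpartition (univ : Set Y)) (d : ℕ) : Type _ :=
  {A : Set Y // MeasurableSet[sigmaAlg P] A} → Set (Fin d)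

/-- Homomorphisms from `Σ(P)` to the subsets of `{1, …, d}`. -/
structure IsSetHom {P : Finpartition (univ : Set Y)} {d : ℕ} (φ : SetMap P d) : Prop where
  map_union : ∀ A B (hA : MeasurableSet[sigmaAlg P] A) (hB : MeasurableSet[sigmaAlg P] B),
    φ ⟨A ∪ B, hA.union hB⟩ = φ ⟨A, hA⟩ ∪ φ ⟨B, hB⟩
  map_inter : ∀ A B (hA : MeasurableSet[sigmaAlg P] A) (hB : MeasurableSet[sigmaAlg P] B),
    φ ⟨A ∩ B, hA.inter hB⟩ = φ ⟨A, hA⟩ ∩ φ ⟨B, hB⟩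
  map_empty : φ ⟨∅, @MeasurableSet.empty _ (sigmaAlg P)⟩ = ∅
  map_univ : φ ⟨univ, @MeasurableSet.univ _ (sigmaAlg P)⟩ = univ

open Classical in
/-- The value `φ(A)`, for `A ∈ Σ(P)` (and the empty set for other `A`, which never matters). -/
def evalOn {P : Finpartition (univ : Set Y)} {d : ℕ} (φ : SetMap P d) (A : Set Y) :
    Set (Fin d) :=
  if h : MeasurableSet[sigmaAlg P] A then φ ⟨A, h⟩ else ∅

variable {G X H : Type*} [MeasurableSpace Y] [MeasurableSpace G] [StandardBorelSpace G]
  [MeasurableSpace X] [MeasurableSpace H] [StandardBorelSpace H]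
  {𝓖 : MGpd Y G} {𝓗 : MGpd X H}

/-- The partition `P^F`, the coarsest one such that every `f · A` with `f ∈ F`, `A ∈ P` is a union
of atoms: two points are in the same atom iff they belong to the same sets `f · A`. -/
def refinePartition (π : GpdHom 𝓖.toGpd 𝓗.toGpd) (P : Finpartition (univ : Set Y))
    (F : Finset (PartialAut 𝓗)) : Finpartition (univ : Set Y) :=
  Setoid.IsPartition.finpartition
    (c := (Setoid.finite_classes_ker
      (fun (y : Y) (q : F × P.parts) => y ∈ π.act q.1.1.1 q.2.1)).toFinset)
    (by rw [Set.Finite.coe_toFinset]; exact Setoid.isPartition_classes _)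

/-- The good homomorphisms `Hom(π, σ, P, F, δ)`. It is used when `F` contains the unit; then
`A` and `f · A` are in `Σ(P^F)` for all `A ∈ P`, `f ∈ F`. -/
def goodHom (μ : Measure Y) (π : GpdHom 𝓖.toGpd 𝓗.toGpd) {d : ℕ} (σ : SoficMap 𝓗 d)
    (P : Finpartition (univ : Set Y)) (F : Finset (PartialAut 𝓗)) (δ : ℝ) :
    Set (SetMap (refinePartition π P F) d) :=
  {φ | IsSetHom φ ∧
    (∀ f ∈ F, ∑ A ∈ P.parts,
      normCard d ((σ f).act (evalOn φ A) ∆ evalOn φ (π.act f.1 A)) < δ) ∧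
    ∑ A ∈ (refinePartition π P F).parts, |normCard d (evalOn φ A) - (μ A).toReal| < δ}

/-- `|Hom(π, σ, P, F, δ)|_Q`: the number of homomorphisms on `Σ(Q)` that are restrictions of
elements of `Hom(π, σ, P, F, δ)`. -/
def goodHomCount (μ : Measure Y) (π : GpdHom 𝓖.toGpd 𝓗.toGpd)
    (Q P : Finpartition (univ : Set Y)) (F : Finset (PartialAut 𝓗)) (δ : ℝ) {d : ℕ}
    (σ : SoficMap 𝓗 d) : ℕ∞ :=
  Set.encard {ψ : SetMap Q d | IsSetHom ψ ∧ ∃ φ ∈ goodHom μ π σ P F δ,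
    ∀ A (hA : MeasurableSet[sigmaAlg Q] A),
      ∃ hA' : MeasurableSet[sigmaAlg (refinePartition π P F)] A, ψ ⟨A, hA⟩ = φ ⟨A, hA'⟩}

variable {J : Type*} [Preorder J]

/-- `h_{P,μ}(π)`: the supremum over the finite Borel partitions `Q`, of the infimum over the finite
Borel partitions `R` refining `Q`, of the infimum over the finite sets `F` containing the unit and
over `δ > 0`, of the exponential growth rate of `|Hom(π, ·, R, F, δ)|_Q`. -/
def partitionEntropy (μ : Measure Y) (π : GpdHom 𝓖.toGpd 𝓗.toGpd)
    (d : J → ℕ) (P : ∀ j, Measure (SoficMap 𝓗 (d j))) (β : Bias J) (p : ℝ≥0∞) : EReal :=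
  ⨆ (Q : Finpartition (univ : Set Y)) (_ : IsBorelPartition Q),
    ⨅ (R : Finpartition (univ : Set Y)) (_ : R ≤ Q ∧ IsBorelPartition R),
      ⨅ (F : Finset (PartialAut 𝓗)) (_ : (1 : PartialAut 𝓗) ∈ F),
        ⨅ (δ : ℝ) (_ : 0 < δ),
          growthRate d P β p fun _ σ => (goodHomCount μ π Q R F δ σ : ℝ≥0∞)

end partition

end SoficGroupoid

end

open SoficGroupoid

namespace SoficGroupoid

/-! ### Limits along a bias and growth rates -/

section bias

/-! The three quantities are compared in a cycle: partition entropy ≤ the `ρ₂` entropy ≤ the `ρ_∞`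
entropy ≤ partition entropy. The middle inequality is `ρ₂ ≤ ρ_∞`. What makes the outer two
comparable is that a homomorphism from a finite algebra `Σ(P)` to the subsets of `{1, …, d}` is the
same as a `d`-tuple of points, remembered only up to the atoms of `P` (`IsSetHom.exists_pointHom`).
Both sides thus count tuples of points: one up to `Q`-names, the other up to `ε`-separation
(`goodHomCount_eq`).

Partition entropy ≤ `ρ₂` entropy (`exists_goodHomCount_le`). If the partition is fine enough, every
good tuple is an approximate orbit: each atom lies in a small cell and each `f` maps it into a small
cell or is undefined on it. Dynamical generation and compactness give finitely many global
bisections that tell the atoms of `Q` apart on a set of almost full measure. Hence two good tuples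
that are `ρ₂`-close to the same approximate orbit have `Q`-names that differ at few indices. A
Hamming ball of small radius contains at most `exp(κd)` names, so the number of names is at most
`exp(κd)` times the separation number, and `κ` is arbitrary.

`ρ_∞` entropy ≤ partition entropy (`exists_orb_label_mem_goodTuples`). Take `Q` with null boundaries
and atoms of `ρ`-diameter at most `ε`. Given `R`, `F`, `δ`, replace each `f ∈ F` by an open `f'` in
`⟦𝓗⟧_top` close to it in measure, which regularity and étaleness provide; asymptotic continuity
keeps `σ(f)` close to `σ(f')`. Replace each atom of `R^F` by a compact part with open
neighbourhoods, and relabel an approximate orbit `x` by a map `L` that sends these neighbourhoods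
into their atoms and preserves every atom of `Q`. Approximate equivariance under `f'`, under the
separating bisections `h` and under the products `hf'` shows that `x` at `σ(f')i` lies in the right
neighbourhood. Weak closeness to `μ` bounds visits to open sets from below, and conservation of
total mass turns these lower bounds into two-sided ones. So `L ∘ x` is a good tuple, and
`ρ_∞`-separated orbits keep different `Q`-names.

This last argument needs `ρ` to have positive diameter, since otherwise `*` cannot be told from a
point. Diameter zero forces the object space to be a single point. Then the `ρ_∞` entropy is at most
`0` and the partition entropy is at least `0`, the latter by trace preservation and
multiplicativity. -/

theorem tendsto_limUnder_ereal {J : Type*} (U : Ultrafilter J) (Φ : J → EReal) :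
    Tendsto Φ U (𝓝 (limUnder (U : Filter J) Φ)) := by
  obtain ⟨a, -, ha⟩ := isCompact_univ.ultrafilter_le_nhds (U.map Φ) (by simp)
  exact tendsto_nhds_limUnder ⟨a, ha⟩

variable {J : Type*} [Preorder J]

theorem ultrafilter_le_atTop {U : Ultrafilter J} (hU : ∀ j, Ici j ∈ U) :
    (U : Filter J) ≤ atTop := by
  rw [atTop]
  exact le_iInf fun j => le_principal_iff.2 (hU j)

theorem Bias.lim_mono [IsDirectedOrder J] [Nonempty J] (β : Bias J) {Φ Ψ : J → EReal}
    (h : ∀ᶠ j in atTop, Φ j ≤ Ψ j) : β.lim Φ ≤ β.lim Ψ := by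
  cases β with
  | minus => exact liminf_le_liminf h
  | plus => exact limsup_le_limsup h
  | ultra U hU =>
    exact le_of_tendsto_of_tendsto (tendsto_limUnder_ereal U Φ) (tendsto_limUnder_ereal U Ψ)
      (ultrafilter_le_atTop hU h)

theorem Bias.lim_eq [IsDirectedOrder J] [Nonempty J] (β : Bias J) {Φ : J → EReal} {a : EReal}
    (h : Tendsto Φ atTop (𝓝 a)) : β.lim Φ = a := by
  cases β with
  | minus => exact h.liminf_eq
  | plus => exact h.limsup_eq
  | ultra U hU => exact (h.mono_left (ultrafilter_le_atTop hU)).limUnder_eq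

/-- The constant is real, so the additions in `EReal` never meet `∞ - ∞`, and both subadditivity of
`liminf`/`limsup` and continuity of addition apply. -/
theorem Bias.lim_add_const_le [IsDirectedOrder J] [Nonempty J] (β : Bias J) (Φ : J → EReal)
    (κ : ℝ) : β.lim (fun j => (κ : EReal) + Φ j) ≤ κ + β.lim Φ := by
  cases β with
  | minus =>
    have h := EReal.liminf_add_le (f := (atTop : Filter J)) (u := fun _ => (κ : EReal)) (v := Φ)
      (by simp) (by simp)
    simpa [Bias.lim, Pi.add_def] using h
  | plus =>
    have h := EReal.limsup_add_le (f := (atTop : Filter J)) (u := fun _ => (κ : EReal)) (v := Φ)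
      (by simp) (by simp)
    simpa [Bias.lim, Pi.add_def] using h
  | ultra U hU =>
    refine le_of_eq (Tendsto.limUnder_eq ?_)
    exact ((EReal.continuousAt_add (p := ((κ : EReal), limUnder (U : Filter J) Φ))
      (by simp) (by simp)).tendsto).comp
      (tendsto_const_nhds.prodMk_nhds (tendsto_limUnder_ereal U Φ))

variable {X H : Type*} [MeasurableSpace X] [MeasurableSpace H] [StandardBorelSpace H]
  {𝓗 : MGpd X H} {d : J → ℕ} {P : ∀ j, Measure (SoficMap 𝓗 (d j))}

/-- A factor `exp(κ d)` passes through the `L^p` norm and contributes exactly `κ` after taking the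
logarithm and dividing by `d`. It suffices to compare the counts for large `j` and almost every `σ`.
-/
theorem growthRate_le_add [IsDirectedOrder J] [Nonempty J] (hd : Tendsto d atTop atTop)
    (β : Bias J) (p : ℝ≥0∞) {N N' : ∀ j, SoficMap 𝓗 (d j) → ℝ≥0∞} {κ : ℝ}
    (h : ∀ᶠ j in atTop, ∀ᵐ σ ∂(P j), N j σ ≤ ENNReal.ofReal (Real.exp (κ * d j)) * N' j σ) :
    growthRate d P β p N ≤ κ + growthRate d P β p N' := by
  refine (β.lim_mono ?_).trans (β.lim_add_const_le _ κ)
  filter_upwards [h, hd.eventually_ge_atTop 1] with j hj hd1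
  have h1 : eLpNorm (N j) p (P j)
      ≤ ENNReal.ofReal (Real.exp (κ * d j)) * eLpNorm (N' j) p (P j) := by
    have := eLpNorm_le_nnreal_smul_eLpNorm_of_ae_le_mul' (μ := P j) (f := N j) (g := N' j)
      (c := (Real.exp (κ * d j)).toNNReal) (by simpa [ENNReal.ofReal] using hj) p
    simpa [ENNReal.smul_def, ENNReal.ofReal] using this
  have hd0 : (0 : ℝ) < d j := by exact_mod_cast hd1
  have h2 := ENNReal.log_monotone h1
  rw [ENNReal.log_mul_add, ENNReal.log_ofReal_of_pos (Real.exp_pos _), Real.log_exp] at h2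
  have hc : (0 : EReal) ≤ (((d j : ℝ)⁻¹ : ℝ) : EReal) := by
    exact_mod_cast (inv_nonneg.2 hd0.le)
  refine (mul_le_mul_of_nonneg_left h2 hc).trans (le_of_eq ?_)
  rw [EReal.left_distrib_of_nonneg_of_ne_top hc (EReal.coe_ne_top _), ← EReal.coe_mul]
  congr 2
  field_simp

theorem growthRate_mono [IsDirectedOrder J] [Nonempty J]
    (β : Bias J) (p : ℝ≥0∞) {N N' : ∀ j, SoficMap 𝓗 (d j) → ℝ≥0∞}
    (h : ∀ᶠ j in atTop, ∀ᵐ σ ∂(P j), N j σ ≤ N' j σ) :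
    growthRate d P β p N ≤ growthRate d P β p N' := by
  refine β.lim_mono ?_
  filter_upwards [h] with j hj
  have hc : (0 : EReal) ≤ (((d j : ℝ)⁻¹ : ℝ) : EReal) := by
    exact_mod_cast (inv_nonneg.2 (Nat.cast_nonneg _))
  exact mul_le_mul_of_nonneg_left (ENNReal.log_monotone (eLpNorm_mono_enorm_ae hj)) hc

theorem growthRate_nonpos [IsDirectedOrder J] [Nonempty J] (hP : ∀ j, IsProbabilityMeasure (P j))
    (β : Bias J) (p : ℝ≥0∞) {N : ∀ j, SoficMap 𝓗 (d j) → ℝ≥0∞} (h : ∀ j σ, N j σ ≤ 1) :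
    growthRate d P β p N ≤ 0 := by
  have h0 : β.lim (fun _ => (0 : EReal)) = 0 := β.lim_eq tendsto_const_nhds
  refine (β.lim_mono (Eventually.of_forall fun j => ?_)).trans h0.le
  have hc : (0 : EReal) ≤ (((d j : ℝ)⁻¹ : ℝ) : EReal) := by
    exact_mod_cast (inv_nonneg.2 (Nat.cast_nonneg _))
  have h1 : eLpNorm (N j) p (P j) ≤ 1 := by
    have : eLpNorm (N j) p (P j) ≤ eLpNorm (fun _ => (1 : ℝ≥0∞)) p (P j) :=
      eLpNorm_mono_enorm_ae (Eventually.of_forall fun σ => h j σ)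
    refine this.trans ?_
    by_cases hp : p = 0
    · simp [hp]
    · rw [eLpNorm_const _ hp (hP j).ne_zero]
      simp
  exact mul_nonpos_of_nonneg_of_nonpos hc (ENNReal.log_le_zero_iff.2 h1)

/-- The norm is at least `P(E)^{1/p} ≥ e⁻¹`, whose logarithm `-1` disappears after division by `d →
∞`. An event of probability bounded below is enough, which suits trace preservation, assumed only in
probability. -/
theorem growthRate_nonneg [IsDirectedOrder J] [Nonempty J] (hd : Tendsto d atTop atTop)
    (β : Bias J) {p : ℝ≥0∞} (hp : 1 ≤ p) {N : ∀ j, SoficMap 𝓗 (d j) → ℝ≥0∞}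
    {E : ∀ j, Set (SoficMap 𝓗 (d j))} (hEm : ∀ j, MeasurableSet (E j))
    (hE : ∀ᶠ j in atTop, ENNReal.ofReal (Real.exp (-1)) ≤ P j (E j))
    (h : ∀ᶠ j in atTop, ∀ᵐ σ ∂(P j), σ ∈ E j → 1 ≤ N j σ) :
    0 ≤ growthRate d P β p N := by
  have h0 : β.lim (fun j => (((d j : ℝ)⁻¹ * (-1) : ℝ) : EReal)) = 0 := by
    refine β.lim_eq ?_
    have : Tendsto (fun j => (d j : ℝ)⁻¹ * (-1)) atTop (𝓝 0) := by
      simpa using ((tendsto_inv_atTop_zero.comp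
        (tendsto_natCast_atTop_atTop.comp hd)).mul_const (-1 : ℝ))
    exact (continuous_coe_real_ereal.tendsto 0).comp this
  refine h0.ge.trans (β.lim_mono ?_)
  filter_upwards [hE, h] with j hj hN
  have hc : (0 : EReal) ≤ (((d j : ℝ)⁻¹ : ℝ) : EReal) := by
    exact_mod_cast (inv_nonneg.2 (Nat.cast_nonneg _))
  rw [EReal.coe_mul]
  refine mul_le_mul_of_nonneg_left ?_ hc
  have hexp : ENNReal.ofReal (Real.exp (-1)) ≤ 1 := by
    rw [← ENNReal.ofReal_one]
    exact ENNReal.ofReal_le_ofReal (by simp)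
  have h1 : ENNReal.ofReal (Real.exp (-1)) ≤ eLpNorm (N j) p (P j) := by
    have hle : eLpNorm ((E j).indicator fun _ => (1 : ℝ≥0∞)) p (P j) ≤ eLpNorm (N j) p (P j) := by
      refine eLpNorm_mono_enorm_ae (hN.mono fun σ hσ => ?_)
      by_cases hm : σ ∈ E j
      · simpa [hm] using hσ hm
      · simp [hm]
    refine le_trans ?_ hle
    have hp0 : p ≠ 0 := (zero_lt_one.trans_le hp).ne'
    have hpos : P j (E j) ≠ 0 := fun h0 => by
      rw [h0] at hj
      simp at hj
      exact absurd hj (not_le.2 (Real.exp_pos _))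
    rw [eLpNorm_indicator_const' (hEm j) hpos hp0]
    simp only [enorm_eq_self, one_mul]
    -- For `p = ∞`, `toReal` is `0` and the exponent `1 / 0` is `0`. In every case the exponent is
    -- at most `1`, so raising a number of `[0, 1]` to it does not decrease the number.
    have h1p : 1 / p.toReal ≤ 1 := by
      by_cases hpt : p = ∞
      · simp [hpt]
      · have : 1 ≤ p.toReal := by
          simpa using ENNReal.toReal_mono hpt hp
        exact (div_le_one (by linarith)).2 this
    calc ENNReal.ofReal (Real.exp (-1)) = ENNReal.ofReal (Real.exp (-1)) ^ (1 : ℝ) := by simp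
      _ ≤ ENNReal.ofReal (Real.exp (-1)) ^ (1 / p.toReal) :=
        ENNReal.rpow_le_rpow_of_exponent_ge hexp h1p
      _ ≤ _ := ENNReal.rpow_le_rpow hj (by positivity)
  have h2 := ENNReal.log_monotone h1
  rwa [ENNReal.log_ofReal_of_pos (Real.exp_pos _), Real.log_exp] at h2

theorem ereal_le_of_forall_pos_le_add {a b : EReal}
    (h : ∀ κ : ℝ, 0 < κ → a ≤ κ + b) : a ≤ b := by
  induction b with
  | bot => simpa using h 1 one_pos
  | top => exact le_top
  | coe b =>
    induction a with
    | bot => exact bot_le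
    | top =>
      have := h 1 one_pos
      rw [← EReal.coe_add] at this
      exact absurd this (not_le.2 (EReal.coe_lt_top _))
    | coe a =>
      refine EReal.coe_le_coe_iff.2 (le_of_forall_pos_le_add fun κ hκ => ?_)
      have := h κ hκ
      rw [← EReal.coe_add, EReal.coe_le_coe_iff] at this
      linarith

end bias

/-! ### Groupoids: measure and topology of sets of arrows -/

theorem Gpd.inv_inv {X H : Type*} (𝓗 : Gpd X H) (f : H) : 𝓗.inv (𝓗.inv f) = f := by
  have h1 : 𝓗.s (𝓗.inv (𝓗.inv f)) = 𝓗.r (𝓗.inv f) := 𝓗.s_inv _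
  have key := 𝓗.assoc (𝓗.inv (𝓗.inv f)) (𝓗.inv f) f h1 (𝓗.s_inv f)
  -- Stated for an arrow that is only equal to a unit, since the composability proof carried by
  -- `comp` blocks direct rewriting.
  have e1 : ∀ (a : H) (h : 𝓗.s a = 𝓗.r f), a = 𝓗.unit (𝓗.r f) → 𝓗.comp a f h = f := by
    rintro a h rfl
    exact 𝓗.unit_comp f
  have e2 : ∀ (b k : H) (h : 𝓗.s k = 𝓗.r b), b = 𝓗.unit (𝓗.s k) → 𝓗.comp k b h = k := by
    rintro b k h rfl
    exact 𝓗.comp_unit k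
  rw [e1 _ _ ((𝓗.inv_comp _).trans (by rw [𝓗.s_inv])),
    e2 _ _ _ ((𝓗.inv_comp _).trans (by rw [𝓗.s_inv, 𝓗.r_inv]))] at key
  exact key.symm

section measure

theorem sourceMass_mono {X H : Type*} [MeasurableSpace X] (𝓗 : Gpd X H) (ν : Measure X) {A B : Set H} (h : A ⊆ B) :
    𝓗.sourceMass ν A ≤ 𝓗.sourceMass ν B := by
  refine lintegral_mono fun x => ?_
  have : (𝓗.s ⁻¹' {x} ∩ A).encard ≤ (𝓗.s ⁻¹' {x} ∩ B).encard :=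
    encard_mono (inter_subset_inter_right _ h)
  exact ENat.toENNReal_le.2 this

variable {X H : Type*} [MeasurableSpace X] [MeasurableSpace H] [StandardBorelSpace H]

theorem MGpd.measurableSet_image (𝓗 : MGpd X H) {t : H → X} (ht : Measurable t) {B : Set H}
    (hB : MeasurableSet B) (hinj : InjOn t B) : MeasurableSet (t '' B) := by
  have := (𝓗.measurableEmbedding_of_injOn ht hB hinj).measurableSet_range
  rwa [range_domRestrict] at this

theorem lintegral_encard_fiber {X H : Type*} [MeasurableSpace X] {t : H → X} {ν : Measure X}
    {B : Set H} (hm : MeasurableSet (t '' B)) (hinj : InjOn t B) :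
    ∫⁻ x, ((t ⁻¹' {x} ∩ B).encard : ℝ≥0∞) ∂ν = ν (t '' B) := by
  rw [← lintegral_indicator_one hm]
  refine lintegral_congr fun x => ?_
  by_cases hx : x ∈ t '' B
  · obtain ⟨b, hb, rfl⟩ := hx
    have : t ⁻¹' {t b} ∩ B = {b} := by
      ext c
      simp only [mem_inter_iff, mem_preimage, mem_singleton_iff]
      exact ⟨fun h => hinj h.2 hb h.1, fun h => by subst h; exact ⟨rfl, hb⟩⟩
    rw [this, indicator_of_mem (mem_image_of_mem t hb)]
    simp
  · have : t ⁻¹' {x} ∩ B = ∅ := by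
      ext c
      simp only [mem_inter_iff, mem_preimage, mem_singleton_iff, mem_empty_iff_false, iff_false]
      exact fun h => hx ⟨c, h.2, h.1⟩
    rw [this, indicator_of_notMem hx]
    simp

theorem MGpd.sourceMass_eq (𝓗 : MGpd X H) (ν : Measure X) {B : Set H} (hB : MeasurableSet B)
    (hs : InjOn 𝓗.s B) : 𝓗.sourceMass ν B = ν (𝓗.s '' B) :=
  lintegral_encard_fiber (𝓗.measurableSet_image 𝓗.measurable_s hB hs) hs

theorem MGpd.rangeMass_eq (𝓗 : MGpd X H) (ν : Measure X) {B : Set H} (hB : MeasurableSet B)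
    (hr : InjOn 𝓗.r B) : 𝓗.rangeMass ν B = ν (𝓗.r '' B) :=
  lintegral_encard_fiber (𝓗.measurableSet_image 𝓗.measurable_r hB hr) hr

/-- Where source and range are injective, fibre counts are indicators of images, so `ν_s = ν_r`
becomes preservation of `ν`. Invariance is only ever used in this form. -/
theorem MGpd.measure_image_eq (𝓗 : MGpd X H) {ν : Measure X} (hν : 𝓗.IsPMP ν) {B : Set H}
    (hB : MeasurableSet B) (hs : InjOn 𝓗.s B) (hr : InjOn 𝓗.r B) :
    ν (𝓗.s '' B) = ν (𝓗.r '' B) := by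
  rw [← 𝓗.sourceMass_eq ν hB hs, ← 𝓗.rangeMass_eq ν hB hr, hν.2 B hB]

theorem PartialAut.measurableSet {𝓗 : MGpd X H} (f : PartialAut 𝓗) : MeasurableSet f.1 := f.2.1

theorem PartialAut.injOn_s {𝓗 : MGpd X H} (f : PartialAut 𝓗) : InjOn 𝓗.s f.1 :=
  ((𝓗.isPartialAut_iff _).1 f.2).2.1

theorem PartialAut.injOn_r {𝓗 : MGpd X H} (f : PartialAut 𝓗) : InjOn 𝓗.r f.1 :=
  ((𝓗.isPartialAut_iff _).1 f.2).2.2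

end measure

/-! ### Action of sets of arrows on the objects of a class-bijective extension -/

section act

variable {Y G X H : Type*} {𝓖 : Gpd Y G} {𝓗 : Gpd X H} {π : GpdHom 𝓖 𝓗}

namespace GpdHom

theorem IsClassBijective.injOn_s (hπ : π.IsClassBijective) {f : Set H} (hf : InjOn 𝓗.s f) :
    InjOn 𝓖.s (π.arr ⁻¹' f) := by
  intro a ha b hb hab
  have h1 : π.arr a = π.arr b := hf ha hb (by rw [π.s_arr, π.s_arr, hab])
  exact (hπ.bijOn_s (𝓖.s b)).injOn hab rfl h1

theorem IsClassBijective.injOn_r (hπ : π.IsClassBijective) {f : Set H} (hf : InjOn 𝓗.r f) :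
    InjOn 𝓖.r (π.arr ⁻¹' f) := by
  intro a ha b hb hab
  have h1 : π.arr a = π.arr b := hf ha hb (by rw [π.r_arr, π.r_arr, hab])
  exact (hπ.bijOn_r (𝓖.r b)).injOn hab rfl h1

theorem IsClassBijective.s_image_preimage (hπ : π.IsClassBijective) (f : Set H) :
    𝓖.s '' (π.arr ⁻¹' f) = π.obj ⁻¹' (𝓗.s '' f) := by
  ext y
  constructor
  · rintro ⟨g, hg, rfl⟩
    exact ⟨_, hg, π.s_arr g⟩
  · rintro ⟨h, hh, hy⟩
    obtain ⟨g, hg, rfl⟩ := (hπ.bijOn_s y).surjOn hy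
    exact ⟨g, hh, hg⟩

theorem actPt_eq_some (hπ : π.IsClassBijective) {f : Set H} (hf : InjOn 𝓗.s f) {y z : Y} :
    π.actPt f y = some z ↔ ∃ g, π.arr g ∈ f ∧ 𝓖.s g = y ∧ 𝓖.r g = z := by
  unfold actPt
  split_ifs with h
  · simp only [Option.some.injEq]
    constructor
    · intro hz
      exact ⟨h.choose, h.choose_spec.1, h.choose_spec.2, hz⟩
    · rintro ⟨g, h1, h2, h3⟩
      rw [← h3]
      exact congrArg 𝓖.r (hπ.injOn_s hf h.choose_spec.1 h1 (h.choose_spec.2.trans h2.symm))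
  · simp only [false_iff]
    rintro ⟨g, h1, h2, -⟩
    exact h ⟨g, h1, h2⟩

theorem actPt_eq_none (hπ : π.IsClassBijective) {f : Set H} {y : Y} :
    π.actPt f y = none ↔ π.obj y ∉ 𝓗.s '' f := by
  rw [← mem_preimage (s := 𝓗.s '' f), ← hπ.s_image_preimage]
  unfold actPt
  split_ifs with h
  · obtain ⟨g, hg⟩ := h
    simpa using ⟨g, hg⟩
  · simp only [true_iff]
    rintro ⟨g, hg⟩
    exact h ⟨g, hg⟩

theorem act_eq (f : Set H) (A : Set Y) :
    π.act f A = 𝓖.r '' (π.arr ⁻¹' f ∩ 𝓖.s ⁻¹' A) := by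
  ext y
  exact ⟨fun ⟨g, h1, h2, h3⟩ => ⟨g, ⟨h1, h2⟩, h3⟩, fun ⟨g, ⟨h1, h2⟩, h3⟩ => ⟨g, h1, h2, h3⟩⟩

theorem mem_act_iff (hπ : π.IsClassBijective) {f : Set H} (hf : InjOn 𝓗.s f) {A : Set Y} {z : Y} :
    z ∈ π.act f A ↔ ∃ y ∈ A, π.actPt f y = some z := by
  constructor
  · rintro ⟨g, h1, h2, h3⟩
    exact ⟨_, h2, (actPt_eq_some hπ hf).2 ⟨g, h1, rfl, h3⟩⟩
  · rintro ⟨y, hy, h⟩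
    obtain ⟨g, h1, rfl, h3⟩ := (actPt_eq_some hπ hf).1 h
    exact ⟨g, h1, hy, h3⟩

/-- The set of points moved by `f` into `O`. -/
def preAct (π : GpdHom 𝓖 𝓗) (f : Set H) (O : Set Y) : Set Y :=
  𝓖.s '' (π.arr ⁻¹' f ∩ 𝓖.r ⁻¹' O)

theorem mem_preAct (hπ : π.IsClassBijective) {f : Set H} (hf : InjOn 𝓗.s f) {O : Set Y} {y : Y} :
    y ∈ π.preAct f O ↔ ∃ z ∈ O, π.actPt f y = some z := by
  constructor
  · rintro ⟨g, ⟨h1, h2⟩, rfl⟩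
    exact ⟨_, h2, (actPt_eq_some hπ hf).2 ⟨g, h1, rfl, rfl⟩⟩
  · rintro ⟨z, hz, h⟩
    obtain ⟨g, h1, h2, rfl⟩ := (actPt_eq_some hπ hf).1 h
    exact ⟨g, ⟨h1, hz⟩, h2⟩

/-- An arrow lying over a unit has the same source and the same image as the unit at its source, so
injectivity on the source fibre identifies the two. -/
theorem act_unit (hπ : π.IsClassBijective) (A : Set Y) : π.act (range 𝓗.unit) A = A := by
  ext y
  constructor
  · rintro ⟨g, ⟨x, hx⟩, h2, h3⟩
    have hg : g = 𝓖.unit (𝓖.s g) := by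
      refine (hπ.bijOn_s (𝓖.s g)).injOn rfl (𝓖.s_unit _) ?_
      have := congrArg 𝓗.s hx
      rw [𝓗.s_unit, π.s_arr] at this
      rw [π.arr_unit, ← hx, this]
    rw [← h3, hg, 𝓖.r_unit]
    exact h2
  · intro hy
    exact ⟨𝓖.unit y, ⟨π.obj y, (π.arr_unit y).symm⟩, by rwa [𝓖.s_unit], 𝓖.r_unit y⟩

end GpdHom

end act

/-! ### Étale groupoids and bisections -/

section topological

variable {X H : Type*} [TopologicalSpace X] [TopologicalSpace H]

theorem Gpd.IsEtale.isOpenMap_s {𝓗 : Gpd X H} (h : 𝓗.IsEtale) : IsOpenMap 𝓗.s := by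
  intro W hW
  rw [isOpen_iff_mem_nhds]
  rintro _ ⟨g, hg, rfl⟩
  obtain ⟨U, ⟨hU, hs, -⟩, hgU⟩ := h g
  have h1 := hs.isOpenMap _ (hW.preimage (continuous_subtype_val (p := (· ∈ U))))
  refine mem_of_superset (h1.mem_nhds ⟨⟨g, hgU⟩, hg, rfl⟩) ?_
  rintro _ ⟨⟨k, hk⟩, hkW, rfl⟩
  exact ⟨k, hkW, rfl⟩

theorem Gpd.IsBisection.injOn_s {𝓗 : Gpd X H} {U : Set H} (h : 𝓗.IsBisection U) :
    InjOn 𝓗.s U := injOn_iff_injective.2 h.2.1.injective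

theorem Gpd.IsBisection.injOn_r {𝓗 : Gpd X H} {U : Set H} (h : 𝓗.IsBisection U) :
    InjOn 𝓗.r U := injOn_iff_injective.2 h.2.2.injective

theorem isOpen_image_of_isOpenEmbedding_restrict {t : H → X} {U V : Set H}
    (ht : IsOpenEmbedding (U.domRestrict t)) (hV : IsOpen V) (hVU : V ⊆ U) : IsOpen (t '' V) := by
  have h1 := ht.isOpenMap _ (hV.preimage (continuous_subtype_val (p := (· ∈ U))))
  convert h1 using 1
  ext x
  constructor
  · rintro ⟨g, hg, rfl⟩
    exact ⟨⟨g, hVU hg⟩, hg, rfl⟩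
  · rintro ⟨⟨k, hk⟩, hkW, rfl⟩
    exact ⟨k, hkW, rfl⟩

theorem isOpenEmbedding_restrict_mono {t : H → X} {U V : Set H}
    (ht : IsOpenEmbedding (U.domRestrict t)) (hV : IsOpen V) (hVU : V ⊆ U) :
    IsOpenEmbedding (V.domRestrict t) := by
  refine ⟨ht.toIsEmbedding.comp (IsEmbedding.inclusion hVU), ?_⟩
  rw [range_domRestrict]
  exact isOpen_image_of_isOpenEmbedding_restrict ht hV hVU

theorem Gpd.IsBisection.mono {𝓗 : Gpd X H} {U V : Set H} (h : 𝓗.IsBisection U) (hV : IsOpen V)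
    (hVU : V ⊆ U) : 𝓗.IsBisection V :=
  ⟨hV, isOpenEmbedding_restrict_mono h.2.1 hV hVU, isOpenEmbedding_restrict_mono h.2.2 hV hVU⟩

/-- The continuous section of the source map over a bisection meeting every source fibre. -/
theorem exists_section {t : H → X} {U : Set H}
    (ht : IsOpenEmbedding (U.domRestrict t)) (hsurj : t '' U = univ) :
    ∃ c : X → H, Continuous c ∧ (∀ x, c x ∈ U) ∧ ∀ x, t (c x) = x := by
  have hs : Function.Surjective (U.domRestrict t) := by
    rw [← range_eq_univ, range_domRestrict, hsurj]
  let e := ht.toIsEmbedding.toHomeomorphOfSurjective hs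
  refine ⟨fun x => (e.symm x).1, continuous_subtype_val.comp e.symm.continuous,
    fun x => (e.symm x).2, fun x => ?_⟩
  exact e.apply_symm_apply x

end topological

/-! ### The topological full group -/

section translation

/-- `U` is the image of the compact object space under the continuous section of the source map.
When the arrows are Hausdorff this makes `U` closed, so `U` is its own enclosing bisection in
`⟦𝓗⟧_top`. -/
theorem isCompact_of_mem_topFullGroup {X H : Type*} [TopologicalSpace X] [CompactSpace X]
    [TopologicalSpace H] {𝓗 : Gpd X H} {U : Set H} (hU : U ∈ 𝓗.topFullGroup) :
    IsCompact U := by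
  obtain ⟨hUb, hUs, hUr⟩ := hU
  obtain ⟨c, hc, hcU, hcs⟩ := exists_section hUb.2.1 hUs
  have : U = c '' univ := by
    ext a
    constructor
    · exact fun ha => ⟨𝓗.s a, trivial, hUb.injOn_s (hcU _) ha (hcs _)⟩
    · rintro ⟨x, -, rfl⟩
      exact hcU x
  rw [this]
  exact isCompact_univ.image hc

variable {X H : Type*}

theorem Gpd.comp_congr (𝓗 : Gpd X H) {a a' b b' : H} (ha : a = a') (hb : b = b')
    (h : 𝓗.s a = 𝓗.r b) : 𝓗.comp a b h = 𝓗.comp a' b' (by rw [← ha, ← hb, h]) := by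
  subst ha hb
  rfl

variable [TopologicalSpace X] [CompactSpace X] [T2Space X] [TopologicalSpace H]

/-- Left translation by a global bisection, as a homeomorphism of the space of arrows covering a
homeomorphism of the space of objects. -/
theorem exists_translation {𝓗 : Gpd X H} (h𝓗 : 𝓗.IsTopological) {U : Set H}
    (hU : U ∈ 𝓗.topFullGroup) :
    ∃ (l : H ≃ₜ H) (T : X ≃ₜ X), (∀ f : Set H, 𝓗.setMul U f = l '' f) ∧
      (∀ k, 𝓗.s (l k) = 𝓗.s k) ∧ (∀ k, 𝓗.r (l k) = T (𝓗.r k)) ∧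
      ∀ A, T '' A = 𝓗.r '' (U ∩ 𝓗.s ⁻¹' A) := by
  obtain ⟨hUb, hUs, hUr⟩ := hU
  obtain ⟨c, hc, hcU, hcs⟩ := exists_section hUb.2.1 hUs
  have hcr : ∀ a ∈ U, c (𝓗.s a) = a := fun a ha => hUb.injOn_s (hcU _) ha (hcs _)
  -- `U` meets every range fibre in exactly one arrow; a continuous bijection of a compact Hausdorff
  -- space is then a homeomorphism.
  have hbij : Function.Bijective (𝓗.r ∘ c) := by
    constructor
    · intro x y hxy
      have := hUb.injOn_r (hcU x) (hcU y) hxy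
      rw [← hcs x, ← hcs y, this]
    · intro x
      obtain ⟨a, ha, rfl⟩ : x ∈ 𝓗.r '' U := hUr ▸ mem_univ x
      exact ⟨𝓗.s a, congrArg 𝓗.r (hcr a ha)⟩
  let T : X ≃ₜ X := Continuous.homeoOfEquivCompactToT2 (f := Equiv.ofBijective _ hbij)
    (h𝓗.continuous_r.comp hc)
  have hT : ∀ x, T x = 𝓗.r (c x) := fun x => rfl
  have h1 : ∀ k, 𝓗.s (c (𝓗.r k)) = 𝓗.r k := fun k => hcs _
  have h2 : ∀ k, 𝓗.s (𝓗.inv (c (T.symm (𝓗.r k)))) = 𝓗.r k := fun k => by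
    rw [𝓗.s_inv, ← hT, T.apply_symm_apply]
  -- `l₁` multiplies on the left by the arrow of `U` with source `r k`, and `l₂` by the inverse of
  -- the arrow of `U` with range `r k`.
  let l₁ : H → H := fun k => 𝓗.comp (c (𝓗.r k)) k (h1 k)
  let l₂ : H → H := fun k => 𝓗.comp (𝓗.inv (c (T.symm (𝓗.r k)))) k (h2 k)
  have hl₁ : Continuous l₁ := by
    have : Continuous fun k : H =>
        (⟨(c (𝓗.r k), k), h1 k⟩ : {p : H × H // 𝓗.s p.1 = 𝓗.r p.2}) :=
      Continuous.subtype_mk ((hc.comp h𝓗.continuous_r).prodMk continuous_id) _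
    exact h𝓗.continuous_comp.comp this
  have hl₂ : Continuous l₂ := by
    have : Continuous fun k : H =>
        (⟨(𝓗.inv (c (T.symm (𝓗.r k))), k), h2 k⟩ : {p : H × H // 𝓗.s p.1 = 𝓗.r p.2}) :=
      Continuous.subtype_mk ((h𝓗.continuous_inv.comp (hc.comp (T.symm.continuous.comp
        h𝓗.continuous_r))).prodMk continuous_id) _
    exact h𝓗.continuous_comp.comp this
  have e1 : ∀ (a f : H) (h : 𝓗.s a = 𝓗.r f), a = 𝓗.unit (𝓗.r f) → 𝓗.comp a f h = f := by
    rintro a f h rfl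
    exact 𝓗.unit_comp f
  have h12 : ∀ k, l₂ (l₁ k) = k := fun k => by
    have hx : T.symm (𝓗.r (l₁ k)) = 𝓗.r k := by
      rw [𝓗.r_comp, ← hT, T.symm_apply_apply]
    have := 𝓗.comp_congr (a := 𝓗.inv (c (T.symm (𝓗.r (l₁ k)))))
      (congrArg (fun x => 𝓗.inv (c x)) hx) (rfl : l₁ k = l₁ k) (h2 _)
    refine this.trans ?_
    rw [← 𝓗.assoc (𝓗.inv (c (𝓗.r k))) (c (𝓗.r k)) k (𝓗.s_inv _) (h1 k)]
    exact e1 _ _ _ ((𝓗.inv_comp _).trans (by rw [hcs]))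
  have h21 : ∀ k, l₁ (l₂ k) = k := fun k => by
    have hx : 𝓗.r (l₂ k) = T.symm (𝓗.r k) := by
      rw [𝓗.r_comp, 𝓗.r_inv, hcs]
    have := 𝓗.comp_congr (a := c (𝓗.r (l₂ k)))
      (congrArg c hx) (rfl : l₂ k = l₂ k) (h1 _)
    refine this.trans ?_
    rw [← 𝓗.assoc _ (𝓗.inv (c (T.symm (𝓗.r k)))) k (𝓗.r_inv _).symm (h2 k)]
    exact e1 _ _ _ ((𝓗.comp_inv _).trans (by rw [← hT, T.apply_symm_apply]))
  refine ⟨⟨⟨l₁, l₂, h12, h21⟩, hl₁, hl₂⟩, T, fun f => ?_, fun k => 𝓗.s_comp _ _ _,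
    fun k => 𝓗.r_comp _ _ _, fun A => ?_⟩
  · ext k
    constructor
    · rintro ⟨a, ha, b, hb, hab, rfl⟩
      refine ⟨b, hb, 𝓗.comp_congr ?_ rfl _⟩
      rw [← hab, hcr a ha]
    · rintro ⟨b, hb, rfl⟩
      exact ⟨_, hcU _, b, hb, h1 b, rfl⟩
  · ext x
    constructor
    · rintro ⟨y, hy, rfl⟩
      exact ⟨c y, ⟨hcU y, by simpa [hcs] using hy⟩, rfl⟩
    · rintro ⟨a, ⟨ha, hs⟩, rfl⟩
      exact ⟨_, hs, by rw [hT, hcr a ha]⟩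

end translation

section full

theorem isPartialAut_of_mem_topFullGroup {X H : Type*} [MeasurableSpace X] [MeasurableSpace H]
    [StandardBorelSpace H] [TopologicalSpace X] [TopologicalSpace H] [BorelSpace H]
    {𝓗 : MGpd X H} {U : Set H} (hU : U ∈ 𝓗.topFullGroup) :
    𝓗.IsPartialAut U :=
  (𝓗.isPartialAut_iff U).2 ⟨hU.1.1.measurableSet, hU.1.injOn_s, hU.1.injOn_r⟩

variable {X H : Type*} [MeasurableSpace X] [MeasurableSpace H] [StandardBorelSpace H]
  [TopologicalSpace X] [CompactSpace X] [TopologicalSpace H]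

theorem mem_topPartialAut_of_mem_topFullGroup [T2Space H] {𝓗 : MGpd X H} {ν : Measure X}
    {f : PartialAut 𝓗} (hf : f.1 ∈ 𝓗.topFullGroup) : f ∈ topPartialAut 𝓗 ν := by
  have huniv : (univ : Set X) ∈ nullBoundary X ν := ⟨MeasurableSet.univ, by simp⟩
  refine ⟨1, fun _ => f.1, (iUnion_const _).symm, fun _ => ⟨f.1, hf.1, ?_, ?_, ?_⟩, ?_, ?_, ?_, ?_⟩
  · exact (isCompact_of_mem_topFullGroup hf).isClosed.closure_subset
  · simp [hf.2.1]
  · simp [hf.2.2]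
  · simp [hf.2.1, huniv]
  · exact fun i j hij => absurd (Subsingleton.elim i j) hij
  · simp [hf.2.2, huniv]
  · exact fun i j hij => absurd (Subsingleton.elim i j) hij

/-- Left translation by `h` is a homeomorphism of the arrows that keeps sources and moves ranges by
a homeomorphism `T`, so it carries over bisections, closures and disjointness. Invariance makes `T`
preserve `ν`, hence null boundaries as well. The products are needed to test `f` followed by a
separating translation. -/
theorem mul_mem_topPartialAut [T2Space X] [BorelSpace X] {𝓗 : MGpd X H} {ν : Measure X}
    (h𝓗 : 𝓗.IsTopological) (hν : 𝓗.IsPMP ν) {h f : PartialAut 𝓗} (hh : h.1 ∈ 𝓗.topFullGroup)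
    (hf : f ∈ topPartialAut 𝓗 ν) : h * f ∈ topPartialAut 𝓗 ν := by
  obtain ⟨l, T, hmul, hls, hlr, hT⟩ := exists_translation h𝓗 hh
  obtain ⟨n, fi, hfi, hU, hs, hsd, hr, hrd⟩ := hf
  have hTν : ∀ A, MeasurableSet A → ν (T '' A) = ν A := fun A hA => by
    rw [hT A, ← 𝓗.measure_image_eq hν (h.measurableSet.inter (𝓗.measurable_s hA))
      (h.injOn_s.mono inter_subset_left) (h.injOn_r.mono inter_subset_left),
      image_inter_preimage, hh.2.1, univ_inter]
  have e_s : ∀ A : Set H, 𝓗.s '' (l '' A) = 𝓗.s '' A := fun A => by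
    rw [image_image]
    exact image_congr fun k _ => hls k
  have e_r : ∀ A : Set H, 𝓗.r '' (l '' A) = T '' (𝓗.r '' A) := fun A => by
    rw [image_image, image_image]
    exact image_congr fun k _ => hlr k
  refine ⟨n, fun i => l '' fi i, ?_, fun i => ?_, fun i => ?_, ?_, fun i => ?_, ?_⟩
  · change 𝓗.setMul h.1 f.1 = _
    rw [hmul, hfi, image_iUnion]
  · obtain ⟨U, hUb, h1, h2, h3⟩ := hU i
    refine ⟨l '' U, ⟨l.isOpenMap _ hUb.1, ?_, ?_⟩, ?_, ?_, ?_⟩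
    · have : (l '' U).domRestrict 𝓗.s = U.domRestrict 𝓗.s ∘ (l.image U).symm := by
        ext ⟨_, k, hk, rfl⟩
        have : (l.image U).symm ⟨l k, k, hk, rfl⟩ = ⟨k, hk⟩ := by
          rw [Homeomorph.symm_apply_eq]; rfl
        simp only [Function.comp_apply, this]
        exact hls k
      rw [this]
      exact hUb.2.1.comp (l.image U).symm.isOpenEmbedding
    · have : (l '' U).domRestrict 𝓗.r = T ∘ U.domRestrict 𝓗.r ∘ (l.image U).symm := by
        ext ⟨_, k, hk, rfl⟩
        have : (l.image U).symm ⟨l k, k, hk, rfl⟩ = ⟨k, hk⟩ := by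
          rw [Homeomorph.symm_apply_eq]; rfl
        simp only [Function.comp_apply, this]
        exact hlr k
      rw [this]
      exact T.isOpenEmbedding.comp (hUb.2.2.comp (l.image U).symm.isOpenEmbedding)
    · rw [← l.image_closure]
      exact image_mono h1
    · rwa [e_s, e_s]
    · rw [e_r, e_r, ← T.image_closure]
      exact image_mono h3
  · rw [e_s]
    exact hs i
  · intro i j hij
    simp only [e_s]
    exact hsd hij
  · rw [e_r]
    refine ⟨T.measurableEmbedding.measurableSet_image.2 (hr i).1, ?_⟩
    rw [← T.image_frontier, hTν _ isClosed_frontier.measurableSet]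
    exact (hr i).2
  · intro i j hij
    simp only [e_r]
    exact (disjoint_image_iff T.injective).2 (hrd hij)

end full

/-! ### Continuity of the lifted action and uniform separation -/

section extension

variable {Y G X H : Type*}

theorem isOpen_preAct [TopologicalSpace Y] [TopologicalSpace G] [TopologicalSpace H]
    {𝓖 : Gpd Y G} {𝓗 : Gpd X H} (h𝓖 : 𝓖.IsTopological) (he : 𝓖.IsEtale) {π : GpdHom 𝓖 𝓗}
    (hπ : Continuous π.arr) {f : Set H} (hf : IsOpen f) {O : Set Y} (hO : IsOpen O) :
    IsOpen (π.preAct f O) :=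
  he.isOpenMap_s _ ((hf.preimage hπ).inter (hO.preimage h𝓖.continuous_r))

theorem continuous_obj [TopologicalSpace Y] [TopologicalSpace G] [TopologicalSpace X]
    [TopologicalSpace H] {𝓖 : Gpd Y G} {𝓗 : Gpd X H} (h𝓖 : 𝓖.IsTopological)
    (h𝓗 : 𝓗.IsTopological) {π : GpdHom 𝓖 𝓗} (hπ : Continuous π.arr) : Continuous π.obj := by
  have : π.obj = 𝓗.s ∘ π.arr ∘ 𝓖.unit := by
    ext y
    simp [π.arr_unit, 𝓗.s_unit]
  rw [this]
  exact h𝓗.continuous_s.comp (hπ.comp h𝓖.continuous_unit)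

/-- A global bisection acts on the object space of an extension by a continuous map. -/
theorem exists_continuous_act [TopologicalSpace Y] [TopologicalSpace G] [TopologicalSpace X]
    [TopologicalSpace H] {𝓖 : Gpd Y G} {𝓗 : Gpd X H} (h𝓖 : 𝓖.IsTopological) (he : 𝓖.IsEtale)
    {π : GpdHom 𝓖 𝓗} (hπ : Continuous π.arr) (hbij : π.IsClassBijective) {f : Set H}
    (hf : f ∈ 𝓗.topFullGroup) :
    ∃ T : Y → Y, Continuous T ∧ ∀ y, π.actPt f y = some (T y) := by
  have h1 : ∀ y, ∃ z, π.actPt f y = some z := fun y => by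
    refine Option.ne_none_iff_exists'.1 fun h => ?_
    rw [GpdHom.actPt_eq_none hbij, hf.2.1] at h
    exact h trivial
  choose T hT using h1
  refine ⟨T, ⟨fun O hO => ?_⟩, hT⟩
  convert isOpen_preAct h𝓖 he hπ hf.1.1 hO using 1
  ext y
  rw [GpdHom.mem_preAct hbij hf.1.injOn_s, mem_preimage]
  constructor
  · exact fun h => ⟨_, h, hT y⟩
  · rintro ⟨z, hz, h⟩
    rw [hT y, Option.some_inj] at h
    rwa [h]

variable [MeasurableSpace Y] [MeasurableSpace G] [StandardBorelSpace G]
  [MeasurableSpace X] [MeasurableSpace H] [StandardBorelSpace H]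
  [TopologicalSpace Y] [TopologicalSpace G] [TopologicalSpace X] [TopologicalSpace H]
  [BorelSpace H]
  {𝓖 : MGpd Y G} {𝓗 : MGpd X H}

/-- Compact sets are separated from the complements of their neighbourhoods by finitely many
elements of the topological full group, uniformly. -/
theorem IsDynamicallyGenerating.exists_finset [CompactSpace Y] (h𝓖 : 𝓖.IsTopological)
    (he : 𝓖.IsEtale) {π : GpdHom 𝓖.toGpd 𝓗.toGpd} (hπ : Continuous π.arr)
    (hbij : π.IsClassBijective) {ρ : Y → Y → ℝ} (hρ : Continuous fun q : Y × Y => ρ q.1 q.2)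
    (hgen : IsDynamicallyGenerating π ρ) {C U : Set Y} (hC : IsCompact C) (hU : IsOpen U)
    (hCU : C ⊆ U) :
    ∃ (F : Finset (PartialAut 𝓗)) (η : ℝ), (∀ f ∈ F, f.1 ∈ 𝓗.topFullGroup) ∧ 0 < η ∧
      ∀ y ∈ C, ∀ z, (∀ f ∈ F, extDist ρ (π.actPt f.1 y) (π.actPt f.1 z) < η) → z ∈ U := by
  classical
  let ι := {f : PartialAut 𝓗 // f.1 ∈ 𝓗.topFullGroup} × ℕ
  let D : PartialAut 𝓗 → Y → Y → ℝ := fun f y z => extDist ρ (π.actPt f.1 y) (π.actPt f.1 z)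
  -- The sets `W (f, n)`, of pairs that `f` moves more than `1/(n+1)` apart, are open because `f`
  -- acts continuously; by dynamical generation they cover the compact set `C × Uᶜ`.
  let W : ι → Set (Y × Y) := fun i => {q | (1 : ℝ) / (i.2 + 1) < D i.1.1 q.1 q.2}
  have hW : ∀ i, IsOpen (W i) := fun i => by
    obtain ⟨T, hT, hT'⟩ := exists_continuous_act h𝓖 he hπ hbij i.1.2
    have : W i = {q : Y × Y | (1 : ℝ) / (i.2 + 1) < ρ (T q.1) (T q.2)} := by
      ext q
      simp only [W, D, mem_ofPred_eq, hT', extDist]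
    rw [this]
    exact isOpen_lt continuous_const (hρ.comp (hT.prodMap hT))
  obtain ⟨t, ht⟩ := (hC.prod hU.isClosed_compl.isCompact).elim_finite_subcover W hW (by
    rintro ⟨y, z⟩ ⟨hy, hz⟩
    obtain ⟨f, hf, hpos⟩ := hgen y z (fun h => hz (h ▸ hCU hy))
    obtain ⟨n, hn⟩ := exists_nat_one_div_lt hpos
    exact mem_iUnion.2 ⟨⟨⟨⟨f, isPartialAut_of_mem_topFullGroup hf⟩, hf⟩, n⟩, hn⟩)
  -- The largest `n` of the finite subcover gives the smallest threshold.
  refine ⟨t.image fun i => i.1.1, 1 / ((t.sup fun i => i.2 : ℕ) + 1), ?_, by positivity, ?_⟩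
  · intro f hf
    obtain ⟨i, -, rfl⟩ := Finset.mem_image.1 hf
    exact i.1.2
  · intro y hy z hz
    by_contra hzU
    obtain ⟨i, hi, hlt⟩ := mem_iUnion₂.1 (ht (show (y, z) ∈ C ×ˢ Uᶜ from ⟨hy, hzU⟩))
    have h1 := hz i.1.1 (Finset.mem_image_of_mem _ hi)
    have h2 : (i.2 : ℝ) ≤ (t.sup fun i => i.2 : ℕ) := by
      exact_mod_cast Finset.le_sup (f := fun i : ι => i.2) hi
    have h3 : (1 : ℝ) / ((t.sup fun i => i.2 : ℕ) + 1) ≤ 1 / (i.2 + 1) := by gcongr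
    exact absurd (h1.trans_le h3) (not_lt.2 (le_of_lt hlt))

end extension

/-! ### Approximation of partial automorphisms by open ones -/

/-- Voronoi cells: `O i` consists of the points strictly nearer to `K i` than to every other `K j`.
-/
theorem exists_disjoint_open_nhds {Z ι : Type*} [TopologicalSpace Z]
    [TopologicalSpace.MetrizableSpace Z] [Finite ι] {K : ι → Set Z} (hK : ∀ i, IsClosed (K i))
    (hd : Pairwise fun i j => Disjoint (K i) (K j)) :
    ∃ O : ι → Set Z, (∀ i, IsOpen (O i)) ∧ (∀ i, K i ⊆ O i) ∧
      Pairwise fun i j => Disjoint (O i) (O j) := by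
  let _ := TopologicalSpace.metrizableSpaceMetric Z
  refine ⟨fun i => ⋂ j ∈ {j | j ≠ i}, {x | Metric.infEDist x (K i) < Metric.infEDist x (K j)},
    fun i => ?_, fun i x hx => ?_, fun i j hij => ?_⟩
  · exact (Set.toFinite _).isOpen_biInter fun j _ =>
      isOpen_lt Metric.continuous_infEDist Metric.continuous_infEDist
  · refine mem_iInter₂.2 fun j hj => ?_
    have h1 : x ∉ closure (K j) := by
      rw [(hK j).closure_eq]
      exact fun h => (hd hj).le_bot ⟨h, hx⟩
    rw [Metric.mem_closure_iff_infEDist_zero] at h1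
    change Metric.infEDist x (K i) < Metric.infEDist x (K j)
    rw [Metric.infEDist_zero_of_mem hx]
    exact pos_iff_ne_zero.2 h1
  · refine disjoint_left.2 fun x hx hx' => ?_
    have h1 : Metric.infEDist x (K i) < Metric.infEDist x (K j) :=
      mem_iInter₂.1 hx j (Ne.symm hij)
    have h2 : Metric.infEDist x (K j) < Metric.infEDist x (K i) := mem_iInter₂.1 hx' i hij
    exact lt_asymm h1 h2

theorem disjoint_image_of_injOn {α β : Type*} {t : α → β} {f A B : Set α} (ht : InjOn t f)
    (hA : A ⊆ f) (hB : B ⊆ f) (h : Disjoint A B) : Disjoint (t '' A) (t '' B) := by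
  rw [disjoint_left]
  rintro _ ⟨a, ha, rfl⟩ ⟨b, hb, hab⟩
  exact h.le_bot ⟨ha, ht (hB hb) (hA ha) hab ▸ hb⟩

variable {X H : Type*} [TopologicalSpace X] [CompactSpace X]
  [TopologicalSpace.MetrizableSpace X] [MeasurableSpace X] [BorelSpace X]
  [TopologicalSpace H] [T2Space H] [MeasurableSpace H] [BorelSpace H] [StandardBorelSpace H]

/-- Thicken the compact set `s(κ)` in the object space by a small radius with null frontier and pull
back to `U` along the source. The range side needs no separate choice: the boundary of the range
image comes from arrows of `U` over the frontier of the thickening, and these have null range by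
invariance. -/
theorem Gpd.IsBisection.exists_nullBoundary_nhd {𝓗 : MGpd X H} {ν : Measure X}
    (h𝓗 : 𝓗.IsTopological) (hν : 𝓗.IsPMP ν) {U κ : Set H} (hU : 𝓗.IsBisection U)
    (hκ : IsCompact κ) (hκU : κ ⊆ U) {ε : ℝ≥0∞} (hε : 0 < ε) :
    ∃ V : Set H, IsOpen V ∧ κ ⊆ V ∧ closure V ⊆ U ∧ closure (𝓗.s '' V) ⊆ 𝓗.s '' U ∧
      closure (𝓗.r '' V) ⊆ 𝓗.r '' U ∧ 𝓗.s '' V ∈ nullBoundary X ν ∧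
      𝓗.r '' V ∈ nullBoundary X ν ∧ ν (𝓗.s '' V \ 𝓗.s '' κ) < ε := by
  let _ := TopologicalSpace.metrizableSpaceMetric X
  have := hν.1
  have hsκ : IsCompact (𝓗.s '' κ) := hκ.image h𝓗.continuous_s
  have hsU : IsOpen (𝓗.s '' U) := isOpen_image_of_isOpenEmbedding_restrict hU.2.1 hU.1 subset_rfl
  obtain ⟨t₀, ht₀, hsub⟩ := hsκ.exists_cthickening_subset_open hsU (image_mono hκU)
  have hlim := tendsto_measure_cthickening_of_isCompact (μ := ν) hsκ
  have hev : ∀ᶠ t in 𝓝 (0 : ℝ), ν (Metric.cthickening t (𝓗.s '' κ)) < ν (𝓗.s '' κ) + ε :=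
    hlim.eventually_lt_const (ENNReal.lt_add_right (measure_ne_top _ _) hε.ne')
  obtain ⟨t₁, ht₁, hball⟩ := Metric.eventually_nhds_iff.1 hev
  obtain ⟨t, ⟨h0t, htt⟩, hfr⟩ := exists_null_frontier_thickening ν (𝓗.s '' κ)
    (lt_min ht₀ ht₁)
  set W := Metric.thickening t (𝓗.s '' κ) with hW
  have hWo : IsOpen W := Metric.isOpen_thickening
  have hWc : closure W ⊆ 𝓗.s '' U :=
    (Metric.closure_thickening_subset_cthickening _ _).trans
      ((Metric.cthickening_mono (htt.le.trans (min_le_left _ _)) _).trans hsub)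
  have hsV : ∀ A ⊆ 𝓗.s '' U, 𝓗.s '' (U ∩ 𝓗.s ⁻¹' A) = A := fun A hA => by
    rw [image_inter_preimage, inter_eq_right.2 hA]
  -- The source map is a homeomorphism of `U` onto `s(U)`, which contains the compact set `closure
  -- W`.
  have hVhat : IsCompact (U ∩ 𝓗.s ⁻¹' closure W) := by
    have h1 : IsCompact (U.domRestrict 𝓗.s ⁻¹' closure W) :=
      hU.2.1.toIsEmbedding.isInducing.isCompact_preimage' isClosed_closure.isCompact (by
        rwa [range_domRestrict])
    have h2 := h1.image continuous_subtype_val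
    convert h2 using 1
    ext k
    simp [and_comm]
  have hVo : IsOpen (U ∩ 𝓗.s ⁻¹' W) := hU.1.inter (hWo.preimage h𝓗.continuous_s)
  have hVV : U ∩ 𝓗.s ⁻¹' W ⊆ U ∩ 𝓗.s ⁻¹' closure W :=
    inter_subset_inter_right _ (preimage_mono subset_closure)
  have hrcl : closure (𝓗.r '' (U ∩ 𝓗.s ⁻¹' W)) ⊆ 𝓗.r '' (U ∩ 𝓗.s ⁻¹' closure W) :=
    closure_minimal (image_mono hVV) (hVhat.image h𝓗.continuous_r).isClosed
  have hro : IsOpen (𝓗.r '' (U ∩ 𝓗.s ⁻¹' W)) :=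
    isOpen_image_of_isOpenEmbedding_restrict hU.2.2 hVo inter_subset_left
  refine ⟨U ∩ 𝓗.s ⁻¹' W, hVo, fun k hk => ⟨hκU hk, ?_⟩, ?_, ?_, ?_, ?_, ?_, ?_⟩
  · exact Metric.self_subset_thickening h0t _ (mem_image_of_mem _ hk)
  · exact (closure_minimal hVV hVhat.isClosed).trans inter_subset_left
  · rw [hsV W (subset_closure.trans hWc)]
    exact hWc
  · exact hrcl.trans (image_mono inter_subset_left)
  · rw [hsV W (subset_closure.trans hWc)]
    exact ⟨hWo.measurableSet, hfr⟩
  · refine ⟨hro.measurableSet, le_antisymm ?_ zero_le⟩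
    -- `E` is the part of `U` over the frontier of `W`.
    set E := (U ∩ 𝓗.s ⁻¹' closure W) \ (U ∩ 𝓗.s ⁻¹' W)
    have hE : MeasurableSet E := hVhat.isClosed.measurableSet.diff hVo.measurableSet
    have hEU : E ⊆ U := sdiff_subset.trans inter_subset_left
    have h1 : frontier (𝓗.r '' (U ∩ 𝓗.s ⁻¹' W)) ⊆ 𝓗.r '' E := by
      rw [hro.frontier_eq]
      refine (sdiff_subset_sdiff_left hrcl).trans ?_
      rintro _ ⟨⟨k, hk, rfl⟩, hk'⟩
      exact ⟨k, ⟨hk, fun h => hk' (mem_image_of_mem _ h)⟩, rfl⟩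
    have h2 : 𝓗.s '' E ⊆ frontier W := by
      rw [hWo.frontier_eq]
      rintro _ ⟨k, ⟨⟨hkU, hk⟩, hk'⟩, rfl⟩
      exact ⟨hk, fun h => hk' ⟨hkU, h⟩⟩
    calc ν (frontier (𝓗.r '' (U ∩ 𝓗.s ⁻¹' W))) ≤ ν (𝓗.r '' E) := measure_mono h1
      _ = ν (𝓗.s '' E) :=
        (𝓗.measure_image_eq hν hE (hU.injOn_s.mono hEU) (hU.injOn_r.mono hEU)).symm
      _ ≤ ν (frontier W) := measure_mono h2
      _ = 0 := hfr
  · rw [hsV W (subset_closure.trans hWc), measure_sdiff (Metric.self_subset_thickening h0t _)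
      hsκ.isClosed.measurableSet.nullMeasurableSet (measure_ne_top _ _)]
    refine ENNReal.sub_lt_of_lt_add (measure_mono (Metric.self_subset_thickening h0t _)) ?_
    rw [add_comm]
    refine (measure_mono (Metric.thickening_subset_cthickening _ _)).trans_lt (hball ?_)
    rw [Real.dist_eq, sub_zero, abs_of_pos h0t]
    exact htt.trans_le (min_le_right _ _)

/-- Inner regularity replaces `f` by a compact subset, which étaleness covers by finitely many
bisections. Cutting it into disjoint compact pieces `K i`, one per bisection, makes their sources
disjoint and their ranges disjoint, since both maps are injective on `f`. Separated null-boundary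
neighbourhoods of the pieces then unite to an open element of `⟦𝓗⟧_top`. Openness is needed later so
that sets of points moved into open sets are open. -/
theorem exists_open_topPartialAut_sourceMass_lt {𝓗 : MGpd X H} {ν : Measure X}
    (h𝓗 : 𝓗.IsTopological) (he : 𝓗.IsEtale) (hν : 𝓗.IsPMP ν) (hreg : 𝓗.IsRegularMeasure ν)
    (f : PartialAut 𝓗) {ε : ℝ≥0∞} (hε : 0 < ε) :
    ∃ f' ∈ topPartialAut 𝓗 ν, IsOpen f'.1 ∧ 𝓗.sourceMass ν (f.1 ∆ f'.1) < ε := by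
  classical
  have := hν.1
  obtain ⟨νH, hνH, hreg⟩ := hreg
  have hε3 : ε / 3 ≠ 0 := by simp [hε.ne']
  have hfin : ∀ A ⊆ f.1, MeasurableSet A → νH A ≠ ∞ := fun A hA hm => by
    rw [hνH A hm, 𝓗.sourceMass_eq ν hm (f.injOn_s.mono hA)]
    exact measure_ne_top _ _
  obtain ⟨κ, hκf, hκ, hκε⟩ := f.measurableSet.exists_isCompact_sdiff_lt (μ := νH)
    (hfin _ subset_rfl f.measurableSet) hε3
  obtain ⟨t, ht⟩ := hκ.elim_finite_subcover (fun U : {U : Set H // 𝓗.IsBisection U} => U.1)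
    (fun U => U.2.1) fun k _ => by
      obtain ⟨U, hU, hk⟩ := he k
      exact mem_iUnion.2 ⟨⟨U, hU⟩, hk⟩
  let U : Fin t.card → Set H := fun i => (t.equivFin.symm i).1.1
  have hU : ∀ i, 𝓗.IsBisection (U i) := fun i => (t.equivFin.symm i).1.2
  have hκU : κ ⊆ ⋃ i, U i := fun k hk => by
    obtain ⟨V, hV, hkV⟩ := mem_iUnion₂.1 (ht hk)
    exact mem_iUnion.2 ⟨t.equivFin ⟨V, hV⟩, by simpa [U] using hkV⟩
  -- Each arrow of `κ` is assigned to the first bisection that contains it.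
  let B : Fin t.card → Set H := fun i => (κ ∩ U i) \ ⋃ j ∈ {j | j < i}, U j
  have hBm : ∀ i, MeasurableSet (B i) := fun i =>
    (hκ.isClosed.measurableSet.inter (hU i).1.measurableSet).diff
      (MeasurableSet.biUnion (Set.toFinite _).countable fun j _ => (hU j).1.measurableSet)
  have hBκ : ∀ i, B i ⊆ κ := fun i => sdiff_subset.trans inter_subset_left
  have hBd : ∀ i j, i < j → Disjoint (B i) (B j) := fun i j hij => by
    rw [disjoint_left]
    exact fun k hk hk' => hk'.2 (mem_iUnion₂.2 ⟨i, hij, hk.1.2⟩)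
  have hBcov : κ ⊆ ⋃ i, B i := fun k hk => by
    obtain ⟨i, hi, hmin⟩ := wellFounded_lt.has_min {i | k ∈ U i} (mem_iUnion.1 (hκU hk))
    refine mem_iUnion.2 ⟨i, ⟨hk, hi⟩, fun h => ?_⟩
    obtain ⟨j, hj, hkj⟩ := mem_iUnion₂.1 h
    exact hmin j hkj hj
  obtain ⟨e, he0, hesum⟩ := ENNReal.exists_pos_sum_of_countable' hε3 (Fin t.card)
  rw [tsum_fintype] at hesum
  have hκi : ∀ i, ∃ K ⊆ B i, IsCompact K ∧ νH (B i \ K) < e i := fun i =>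
    (hBm i).exists_isCompact_sdiff_lt (hfin _ ((hBκ i).trans hκf) (hBm i)) (he0 i).ne'
  choose K hKB hK hKe using hκi
  have hKd : Pairwise fun i j => Disjoint (K i) (K j) := fun i j hij => by
    rcases lt_or_gt_of_ne hij with h | h
    · exact (hBd i j h).mono (hKB i) (hKB j)
    · exact ((hBd j i h).mono (hKB j) (hKB i)).symm
  have hKf : ∀ i, K i ⊆ f.1 := fun i => ((hKB i).trans (hBκ i)).trans hκf
  obtain ⟨O, hO, hKO, hOd⟩ := exists_disjoint_open_nhds (K := fun i => 𝓗.s '' K i)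
    (fun i => ((hK i).image h𝓗.continuous_s).isClosed) fun i j hij =>
      disjoint_image_of_injOn f.injOn_s (hKf i) (hKf j) (hKd hij)
  obtain ⟨O', hO', hKO', hOd'⟩ := exists_disjoint_open_nhds (K := fun i => 𝓗.r '' K i)
    (fun i => ((hK i).image h𝓗.continuous_r).isClosed) fun i j hij =>
      disjoint_image_of_injOn f.injOn_r (hKf i) (hKf j) (hKd hij)
  -- Restricting the bisections to separated open sets of sources and of ranges keeps the enlarged
  -- pieces disjoint on both sides.
  let U' : Fin t.card → Set H := fun i => U i ∩ (𝓗.s ⁻¹' O i ∩ 𝓗.r ⁻¹' O' i)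
  have hU' : ∀ i, 𝓗.IsBisection (U' i) := fun i => (hU i).mono
    ((hU i).1.inter (((hO i).preimage h𝓗.continuous_s).inter ((hO' i).preimage h𝓗.continuous_r)))
    inter_subset_left
  have hKU' : ∀ i, K i ⊆ U' i := fun i k hk =>
    ⟨(hKB i hk).1.2, hKO i (mem_image_of_mem _ hk), hKO' i (mem_image_of_mem _ hk)⟩
  have hV := fun i => (hU' i).exists_nullBoundary_nhd h𝓗 hν (hK i) (hKU' i) (he0 i)
  choose V hVo hKV hVU hsVU hrVU hsV hrV hVe using hV
  have hVU₀ : ∀ i, V i ⊆ U' i := fun i => subset_closure.trans (hVU i)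
  have hsd : Pairwise fun i j => Disjoint (𝓗.s '' V i) (𝓗.s '' V j) := fun i j hij =>
    (hOd hij).mono (image_subset_iff.2 fun k hk => (hVU₀ i hk).2.1)
      (image_subset_iff.2 fun k hk => (hVU₀ j hk).2.1)
  have hrd : Pairwise fun i j => Disjoint (𝓗.r '' V i) (𝓗.r '' V j) := fun i j hij =>
    (hOd' hij).mono (image_subset_iff.2 fun k hk => (hVU₀ i hk).2.2)
      (image_subset_iff.2 fun k hk => (hVU₀ j hk).2.2)
  have hinj : ∀ {t : H → X}, (∀ i, InjOn t (V i)) →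
      (Pairwise fun i j => Disjoint (t '' V i) (t '' V j)) → InjOn t (⋃ i, V i) := by
    intro t h1 h2 a ha b hb hab
    obtain ⟨i, hi⟩ := mem_iUnion.1 ha
    obtain ⟨j, hj⟩ := mem_iUnion.1 hb
    obtain rfl : i = j := by
      by_contra hij
      exact (h2 hij).le_bot ⟨mem_image_of_mem t hi, hab ▸ mem_image_of_mem t hj⟩
    exact h1 i hi hj hab
  have hf'o : IsOpen (⋃ i, V i) := isOpen_iUnion hVo
  refine ⟨⟨⋃ i, V i, (𝓗.isPartialAut_iff _).2 ⟨hf'o.measurableSet,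
    hinj (fun i => (hU' i).injOn_s.mono (hVU₀ i)) hsd,
    hinj (fun i => (hU' i).injOn_r.mono (hVU₀ i)) hrd⟩⟩,
    ⟨_, V, rfl, fun i => ⟨U' i, hU' i, hVU i, hsVU i, hrVU i⟩, hsV, hsd, hrV, hrd⟩, hf'o, ?_⟩
  rw [← hνH _ (f.measurableSet.symmDiff hf'o.measurableSet)]
  -- Three errors of at most `ε/3` each: passing to `κ`, passing to the compact pieces `K i`, and
  -- enlarging these to `V i`.
  have hsub : f.1 ∆ (⋃ i, V i) ⊆ (f.1 \ κ) ∪ ((⋃ i, B i \ K i) ∪ ⋃ i, V i \ K i) := by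
    rintro k (⟨hk, hk'⟩ | ⟨hk, hk'⟩)
    · by_cases hkκ : k ∈ κ
      · obtain ⟨i, hi⟩ := mem_iUnion.1 (hBcov hkκ)
        exact Or.inr (Or.inl (mem_iUnion.2 ⟨i, hi, fun h => hk' (mem_iUnion.2 ⟨i, hKV i h⟩)⟩))
      · exact Or.inl ⟨hk, hkκ⟩
    · obtain ⟨i, hi⟩ := mem_iUnion.1 hk
      exact Or.inr (Or.inr (mem_iUnion.2 ⟨i, hi, fun h => hk' (hKf i h)⟩))
  have hVK : ∀ i, νH (V i \ K i) ≤ e i := fun i => by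
    have hi : InjOn 𝓗.s (V i) := (hU' i).injOn_s.mono (hVU₀ i)
    rw [hνH _ ((hVo i).measurableSet.diff (hK i).isClosed.measurableSet),
      𝓗.sourceMass_eq ν ((hVo i).measurableSet.diff (hK i).isClosed.measurableSet)
        (hi.mono sdiff_subset)]
    refine (measure_mono ?_).trans (hVe i).le
    rintro _ ⟨k, ⟨hk, hk'⟩, rfl⟩
    refine ⟨mem_image_of_mem _ hk, ?_⟩
    rintro ⟨k', hk'', h⟩
    exact hk' (hi (hKV i hk'') hk h ▸ hk'')
  calc νH (f.1 ∆ ⋃ i, V i)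
      ≤ νH (f.1 \ κ) + (∑ i, νH (B i \ K i) + ∑ i, νH (V i \ K i)) :=
        (measure_mono hsub).trans ((measure_union_le _ _).trans (add_le_add le_rfl
          ((measure_union_le _ _).trans (add_le_add (measure_iUnion_fintype_le _ _)
            (measure_iUnion_fintype_le _ _)))))
    _ ≤ νH (f.1 \ κ) + (∑ i, e i + ∑ i, e i) := by
        gcongr with i _ i _
        · exact (hKe i).le
        · exact hVK i
    _ < ε / 3 + (ε / 3 + ε / 3) := by
        exact ENNReal.add_lt_add hκε (ENNReal.add_lt_add hesum hesum)
    _ = ε := by rw [← add_assoc, ENNReal.add_thirds]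

/-! ### Finite partitions and their homomorphisms -/

section finpartition

variable {Y : Type*}

theorem exists_mem_parts (P : Finpartition (univ : Set Y)) (y : Y) : ∃ A ∈ P.parts, y ∈ A := by
  have h : y ∈ P.parts.sup id := by
    rw [P.sup_parts]
    trivial
  simpa using h

theorem eq_of_mem_parts (P : Finpartition (univ : Set Y)) {A B : Set Y} (hA : A ∈ P.parts)
    (hB : B ∈ P.parts) {y : Y} (hyA : y ∈ A) (hyB : y ∈ B) : A = B := by
  by_contra h
  exact (P.disjoint hA hB h).le_bot ⟨hyA, hyB⟩

theorem nonempty_of_mem_parts (P : Finpartition (univ : Set Y)) {A : Set Y} (hA : A ∈ P.parts) :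
    A.Nonempty := by
  rw [nonempty_iff_ne_empty]
  exact P.ne_bot hA

theorem measurableSet_sigmaAlg_of_mem {P : Finpartition (univ : Set Y)} {A : Set Y}
    (hA : A ∈ P.parts) : MeasurableSet[sigmaAlg P] A :=
  MeasurableSpace.measurableSet_generateFrom hA

/-- Being a union of atoms is stable under complements and countable unions, so it holds throughout
the generated σ-algebra. -/
theorem measurableSet_sigmaAlg_iff {P : Finpartition (univ : Set Y)} {B : Set Y} :
    MeasurableSet[sigmaAlg P] B ↔ ∀ A ∈ P.parts, A ⊆ B ∨ Disjoint A B := by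
  constructor
  · intro hB A hA
    refine MeasurableSpace.generateFrom_induction (P.parts : Set (Set Y))
      (fun B _ => A ⊆ B ∨ Disjoint A B) (fun C hC _ => ?_) (Or.inr disjoint_bot_right)
      (fun C _ ih => ?_) (fun s _ ih => ?_) B hB
    · by_cases h : A = C
      · exact Or.inl h.subset
      · exact Or.inr (P.disjoint hA hC h)
    · rcases ih with h | h
      · exact Or.inr (disjoint_compl_right_iff_subset.2 h)
      · exact Or.inl h.subset_compl_right
    · by_cases h : ∃ n, A ⊆ s n
      · obtain ⟨n, hn⟩ := h
        exact Or.inl (hn.trans (subset_iUnion s n))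
      · push Not at h
        exact Or.inr (disjoint_iUnion_right.2 fun n => (ih n).resolve_left (h n))
  · intro h
    have : B = ⋃ A ∈ {A ∈ (P.parts : Set (Set Y)) | A ⊆ B}, A := by
      ext y
      simp only [mem_iUnion]
      constructor
      · intro hy
        obtain ⟨A, hA, hyA⟩ := exists_mem_parts P y
        exact ⟨A, ⟨hA, (h A hA).resolve_right fun hd => hd.le_bot ⟨hyA, hy⟩⟩, hyA⟩
      · rintro ⟨A, ⟨-, hAB⟩, hy⟩
        exact hAB hy
    rw [this]
    exact MeasurableSet.biUnion (P.parts.finite_toSet.subset (sep_subset _ _)).countable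
      fun A hA => measurableSet_sigmaAlg_of_mem hA.1

theorem sigmaAlg_mono {P Q : Finpartition (univ : Set Y)} (h : P ≤ Q) :
    sigmaAlg Q ≤ sigmaAlg P := by
  refine MeasurableSpace.generateFrom_le fun B hB => measurableSet_sigmaAlg_iff.2 fun A hA => ?_
  obtain ⟨C, hC, hAC⟩ := h hA
  by_cases hCB : C = B
  · exact Or.inl (hCB ▸ hAC)
  · exact Or.inr ((Q.disjoint hC hB hCB).mono_left hAC)

theorem IsBorelPartition.measurableSet [MeasurableSpace Y] {P : Finpartition (univ : Set Y)}
    (hP : IsBorelPartition P) {B : Set Y} (hB : MeasurableSet[sigmaAlg P] B) : MeasurableSet B :=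
  (MeasurableSpace.generateFrom_le (m := ‹MeasurableSpace Y›) fun A hA => hP A hA) B hB

/-- The partition into the sets of points that belong to the same members of a finite family. -/
noncomputable def familyPartition {ι : Type*} [Finite ι] (S : ι → Set Y) : Finpartition (univ : Set Y) :=
  Setoid.IsPartition.finpartition
    (c := (Setoid.finite_classes_ker (fun (y : Y) (i : ι) => y ∈ S i)).toFinset)
    (by rw [Set.Finite.coe_toFinset]; exact Setoid.isPartition_classes _)

theorem mem_familyPartition_parts {ι : Type*} [Finite ι] {S : ι → Set Y} {A : Set Y} :
    A ∈ (familyPartition S).parts ↔ ∃ y, A = {z | ∀ i, z ∈ S i ↔ y ∈ S i} := by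
  have : A ∈ (familyPartition S).parts ↔
      A ∈ (Setoid.ker (fun (y : Y) (i : ι) => y ∈ S i)).classes := by
    simp [familyPartition, Setoid.IsPartition.finpartition]
  rw [this]
  have h : ∀ y : Y, {z | (Setoid.ker (fun (y : Y) (i : ι) => y ∈ S i)) z y}
      = {z | ∀ i, z ∈ S i ↔ y ∈ S i} := fun y => by
    ext z
    simp [Setoid.ker_def, funext_iff]
  constructor
  · rintro ⟨y, rfl⟩
    exact ⟨y, h y⟩
  · rintro ⟨y, rfl⟩
    exact ⟨y, (h y).symm⟩

theorem subset_or_disjoint_of_familyPartition {ι : Type*} [Finite ι] {S : ι → Set Y} {A : Set Y}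
    (hA : A ∈ (familyPartition S).parts) (i : ι) : A ⊆ S i ∨ Disjoint A (S i) := by
  obtain ⟨y, rfl⟩ := mem_familyPartition_parts.1 hA
  by_cases hy : y ∈ S i
  · exact Or.inl fun z hz => (hz i).2 hy
  · exact Or.inr (disjoint_left.2 fun z hz hzi => hy ((hz i).1 hzi))

theorem isBorelPartition_familyPartition [MeasurableSpace Y] {ι : Type*} [Finite ι]
    {S : ι → Set Y} (hS : ∀ i, MeasurableSet (S i)) : IsBorelPartition (familyPartition S) := by
  intro A hA
  obtain ⟨y, rfl⟩ := mem_familyPartition_parts.1 hA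
  have : {z | ∀ i, z ∈ S i ↔ y ∈ S i} = ⋂ i, {z | z ∈ S i ↔ y ∈ S i} := by
    ext z
    simp
  rw [this]
  refine MeasurableSet.iInter fun i => ?_
  by_cases hy : y ∈ S i
  · simpa [hy] using hS i
  · simp only [hy, iff_false]
    exact (hS i).compl

/-- Every finite partition refined by a finite family of sets. -/
theorem exists_refinement [MeasurableSpace Y] {Q : Finpartition (univ : Set Y)}
    (hQ : IsBorelPartition Q) {ι : Type*} [Finite ι] {S : ι → Set Y}
    (hS : ∀ i, MeasurableSet (S i)) :
    ∃ R ≤ Q, IsBorelPartition R ∧ ∀ A ∈ R.parts, ∀ i, A ⊆ S i ∨ Disjoint A (S i) := by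
  let S' : Q.parts ⊕ ι → Set Y := Sum.elim (fun A => A.1) S
  have h := fun {A : Set Y} (hA : A ∈ (familyPartition S').parts) =>
    subset_or_disjoint_of_familyPartition hA
  refine ⟨familyPartition S', fun A hA => ?_, isBorelPartition_familyPartition ?_,
    fun A hA i => h hA (Sum.inr i)⟩
  · obtain ⟨y, hy⟩ := nonempty_of_mem_parts _ hA
    obtain ⟨B, hB, hyB⟩ := exists_mem_parts Q y
    exact ⟨B, hB, (h hA (Sum.inl ⟨B, hB⟩)).resolve_right fun hd => hd.le_bot ⟨hy, hyB⟩⟩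
  · rintro (A | i)
    · exact hQ A A.2
    · exact hS i

theorem sum_parts_measureReal [MeasurableSpace Y] {μ : Measure Y} [IsFiniteMeasure μ]
    {P : Finpartition (univ : Set Y)} (hP : IsBorelPartition P) {B : Set Y}
    (hB : MeasurableSet B) :
    ∑ A ∈ P.parts, μ.real (A ∩ B) = μ.real B := by
  rw [← measureReal_biUnion_finset (f := fun A => A ∩ B) (fun A hA C hC hAC =>
    (P.disjoint hA hC hAC).mono inter_subset_left inter_subset_left)
    fun A hA => (hP A hA).inter hB]
  congr 1
  ext y
  simp only [mem_iUnion, mem_inter_iff]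
  constructor
  · rintro ⟨A, -, -, h⟩
    exact h
  · intro hy
    obtain ⟨A, hA, hyA⟩ := exists_mem_parts P y
    exact ⟨A, hA, hyA, hy⟩

end finpartition

/-! ### The partition `P^F` and the measure of translated sets -/

section refine

variable {Y G X H : Type*} [MeasurableSpace Y] [MeasurableSpace G] [StandardBorelSpace G]
  [MeasurableSpace X] [MeasurableSpace H] [StandardBorelSpace H]
  {𝓖 : MGpd Y G} {𝓗 : MGpd X H} {π : GpdHom 𝓖.toGpd 𝓗.toGpd}

theorem measurableSet_act_sigmaAlg {R : Finpartition (univ : Set Y)} {F : Finset (PartialAut 𝓗)}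
    {f : PartialAut 𝓗} (hf : f ∈ F) {A : Set Y} (hA : A ∈ R.parts) :
    MeasurableSet[sigmaAlg (refinePartition π R F)] (π.act f.1 A) :=
  measurableSet_sigmaAlg_iff.2 fun _ hB =>
    -- `refinePartition` is definitionally the `familyPartition` of the sets `f · A`.
    subset_or_disjoint_of_familyPartition (S := fun q : F × R.parts => π.act q.1.1.1 q.2.1) hB
      (⟨f, hf⟩, ⟨A, hA⟩)

/-- This is the purpose of requiring `1 ∈ F`: the set `1 · A = A` is among those that `P^F`
resolves. -/
theorem sigmaAlg_le_refinePartition (hπ : π.IsClassBijective) {R : Finpartition (univ : Set Y)}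
    {F : Finset (PartialAut 𝓗)} (hF : 1 ∈ F) : sigmaAlg R ≤ sigmaAlg (refinePartition π R F) := by
  refine MeasurableSpace.generateFrom_le fun A hA => ?_
  have := measurableSet_act_sigmaAlg (π := π) hF hA
  rwa [show π.act (1 : PartialAut 𝓗).1 A = A from GpdHom.act_unit hπ A] at this

theorem measurableSet_act (hπ : π.IsClassBijective) (hm : Measurable π.arr) (f : PartialAut 𝓗)
    {A : Set Y} (hA : MeasurableSet A) : MeasurableSet (π.act f.1 A) := by
  rw [GpdHom.act_eq]
  exact 𝓖.measurableSet_image 𝓖.measurable_r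
    ((hm f.measurableSet).inter (𝓖.measurable_s hA))
    ((hπ.injOn_r f.injOn_r).mono inter_subset_left)

theorem measurableSet_preAct (hπ : π.IsClassBijective) (hm : Measurable π.arr) (f : PartialAut 𝓗)
    {A : Set Y} (hA : MeasurableSet A) : MeasurableSet (π.preAct f.1 A) :=
  𝓖.measurableSet_image 𝓖.measurable_s
    ((hm f.measurableSet).inter (𝓖.measurable_r hA))
    ((hπ.injOn_s f.injOn_s).mono inter_subset_left)

theorem measure_act {μ : Measure Y} (hμ : 𝓖.IsPMP μ) (hπ : π.IsClassBijective)
    (hm : Measurable π.arr) (f : PartialAut 𝓗) {A : Set Y} (hA : MeasurableSet A) :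
    μ (π.act f.1 A) = μ (A ∩ π.obj ⁻¹' (𝓗.s '' f.1)) := by
  rw [GpdHom.act_eq, ← 𝓖.measure_image_eq hμ ((hm f.measurableSet).inter (𝓖.measurable_s hA))
    ((hπ.injOn_s f.injOn_s).mono inter_subset_left)
    ((hπ.injOn_r f.injOn_r).mono inter_subset_left), image_inter_preimage,
    hπ.s_image_preimage, inter_comm]

theorem isBorelPartition_refinePartition (hπ : π.IsClassBijective) (hm : Measurable π.arr)
    {R : Finpartition (univ : Set Y)} (hR : IsBorelPartition R) (F : Finset (PartialAut 𝓗)) :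
    IsBorelPartition (refinePartition π R F) :=
  isBorelPartition_familyPartition fun q => measurableSet_act hπ hm q.1.1 (hR _ q.2.2)

end refine

/-! ### Homomorphisms as tuples of points -/

section pointHom

variable {Y : Type*}

/-- The homomorphism defined by a tuple of points. -/
def pointHom (P : Finpartition (univ : Set Y)) {d : ℕ} (z : Fin d → Y) : SetMap P d :=
  fun B => z ⁻¹' B.1

theorem isSetHom_pointHom (P : Finpartition (univ : Set Y)) {d : ℕ} (z : Fin d → Y) :
    IsSetHom (pointHom P z) :=
  ⟨fun _ _ _ _ => rfl, fun _ _ _ _ => rfl, rfl, rfl⟩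

theorem evalOn_pointHom {P : Finpartition (univ : Set Y)} {d : ℕ} (z : Fin d → Y) {B : Set Y}
    (hB : MeasurableSet[sigmaAlg P] B) : evalOn (pointHom P z) B = z ⁻¹' B := by
  rw [evalOn, dif_pos hB]
  rfl

/-- Each index `i` lies in `φ(A)` for some atom `A`, because the atoms cover and `φ(univ) = univ`.
Choosing a point `z i` in this atom recovers `φ`: an atom is inside `B` or disjoint from it, and
compatibility with unions and intersections decides whether `i ∈ φ(B)`. -/
theorem IsSetHom.exists_pointHom {P : Finpartition (univ : Set Y)} {d : ℕ} {φ : SetMap P d}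
    (hφ : IsSetHom φ) : ∃ z, φ = pointHom P z := by
  classical
  have h1 : ∀ i, ∃ A, ∃ hA : A ∈ P.parts, i ∈ φ ⟨A, measurableSet_sigmaAlg_of_mem hA⟩ := by
    intro i
    by_contra! hcon
    -- If `i` missed every `φ(A)`, it would miss `φ` of every finite union of atoms, in particular
    -- `φ(univ)`.
    have h2 : ∀ s : Finset (Set Y), s ⊆ P.parts → ∃ hs : MeasurableSet[sigmaAlg P] (s.sup id),
        i ∉ φ ⟨s.sup id, hs⟩ := by
      intro s
      induction s using Finset.induction_on with
      | empty =>
        intro _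
        refine ⟨@MeasurableSet.empty _ (sigmaAlg P), ?_⟩
        have := hφ.map_empty
        simp only [Finset.sup_empty, bot_eq_empty]
        rw [this]
        simp
      | insert A s _ ih =>
        intro hs
        obtain ⟨hs', hi⟩ := ih ((Finset.subset_insert _ _).trans hs)
        have hA := hs (Finset.mem_insert_self A s)
        have hAm := measurableSet_sigmaAlg_of_mem hA
        refine ⟨by rw [Finset.sup_insert]; exact hAm.union hs', ?_⟩
        have := hφ.map_union A (s.sup id) hAm hs'
        simp only [Finset.sup_insert, id, sup_eq_union]
        rw [this]
        rintro (h | h)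
        · exact hcon A hA h
        · exact hi h
    obtain ⟨hs, hi⟩ := h2 P.parts subset_rfl
    refine hi ?_
    have h3 : (⟨P.parts.sup id, hs⟩ : {A : Set Y // MeasurableSet[sigmaAlg P] A})
        = ⟨univ, @MeasurableSet.univ _ (sigmaAlg P)⟩ := Subtype.ext P.sup_parts
    rw [h3, hφ.map_univ]
    trivial
  choose A hA hiA using h1
  choose z hz using fun i => nonempty_of_mem_parts P (hA i)
  refine ⟨z, ?_⟩
  ext ⟨B, hB⟩ i
  change _ ↔ z i ∈ B
  have hAm := measurableSet_sigmaAlg_of_mem (hA i)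
  rcases measurableSet_sigmaAlg_iff.1 hB (A i) (hA i) with h | h
  · refine ⟨fun _ => h (hz i), fun _ => ?_⟩
    have h1 := hφ.map_union (A i) B hAm hB
    simp only [union_eq_self_of_subset_left h] at h1
    rw [h1]
    exact Or.inl (hiA i)
  · refine ⟨fun hi => ?_, fun hi => (h.le_bot ⟨hz i, hi⟩).elim⟩
    have h1 := hφ.map_inter (A i) B hAm hB
    simp only [disjoint_iff_inter_eq_empty.1 h] at h1
    have : i ∈ φ ⟨A i, hAm⟩ ∩ φ ⟨B, hB⟩ := ⟨hiA i, hi⟩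
    rw [← h1, hφ.map_empty] at this
    exact this.elim

theorem pointHom_eq_iff {Q : Finpartition (univ : Set Y)} {d : ℕ} {z z' : Fin d → Y} :
    pointHom Q z = pointHom Q z' ↔ ∀ i, ∀ A ∈ Q.parts, z i ∈ A ↔ z' i ∈ A := by
  constructor
  · intro h i A hA
    have := congrFun h ⟨A, measurableSet_sigmaAlg_of_mem hA⟩
    exact Set.ext_iff.1 this i
  · intro h
    ext ⟨B, hB⟩ i
    change z i ∈ B ↔ z' i ∈ B
    obtain ⟨A, hA, hz⟩ := exists_mem_parts Q (z i)
    have hz' := (h i A hA).1 hz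
    rcases measurableSet_sigmaAlg_iff.1 hB A hA with h | h
    · exact ⟨fun _ => h hz', fun _ => h hz⟩
    · exact ⟨fun hi => (h.le_bot ⟨hz, hi⟩).elim, fun hi => (h.le_bot ⟨hz', hi⟩).elim⟩

variable {G X H : Type*} [MeasurableSpace Y] [MeasurableSpace G] [StandardBorelSpace G]
  [MeasurableSpace X] [MeasurableSpace H] [StandardBorelSpace H]
  {𝓖 : MGpd Y G} {𝓗 : MGpd X H}

/-- The tuples of points that define elements of `goodHom`. -/
def goodTuples (μ : Measure Y) (π : GpdHom 𝓖.toGpd 𝓗.toGpd) {d : ℕ} (σ : SoficMap 𝓗 d)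
    (P : Finpartition (univ : Set Y)) (F : Finset (PartialAut 𝓗)) (δ : ℝ) : Set (Fin d → Y) :=
  {z | (∀ f ∈ F, ∑ A ∈ P.parts,
      normCard d ((σ f).act (z ⁻¹' A) ∆ (z ⁻¹' (π.act f.1 A))) < δ) ∧
    ∑ A ∈ (refinePartition π P F).parts, |normCard d (z ⁻¹' A) - μ.real A| < δ}

theorem pointHom_mem_goodHom_iff {μ : Measure Y} {π : GpdHom 𝓖.toGpd 𝓗.toGpd}
    (hπ : π.IsClassBijective) {d : ℕ} {σ : SoficMap 𝓗 d} {P : Finpartition (univ : Set Y)}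
    {F : Finset (PartialAut 𝓗)} (hF : 1 ∈ F) {δ : ℝ} {z : Fin d → Y} :
    pointHom (refinePartition π P F) z ∈ goodHom μ π σ P F δ ↔ z ∈ goodTuples μ π σ P F δ := by
  have h1 : ∀ f ∈ F, ∑ A ∈ P.parts,
      normCard d ((σ f).act (evalOn (pointHom (refinePartition π P F) z) A) ∆
        evalOn (pointHom (refinePartition π P F) z) (π.act f.1 A))
      = ∑ A ∈ P.parts, normCard d ((σ f).act (z ⁻¹' A) ∆ (z ⁻¹' (π.act f.1 A))) := by
    intro f hf
    refine Finset.sum_congr rfl fun A hA => ?_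
    rw [evalOn_pointHom z (measurableSet_act_sigmaAlg hf hA),
      evalOn_pointHom z (sigmaAlg_le_refinePartition hπ hF _ (measurableSet_sigmaAlg_of_mem hA))]
  have h2 : ∑ A ∈ (refinePartition π P F).parts,
      |normCard d (evalOn (pointHom (refinePartition π P F) z) A) - (μ A).toReal|
      = ∑ A ∈ (refinePartition π P F).parts, |normCard d (z ⁻¹' A) - μ.real A| := by
    refine Finset.sum_congr rfl fun A hA => ?_
    rw [evalOn_pointHom z (measurableSet_sigmaAlg_of_mem hA)]
    rfl
  constructor
  · rintro ⟨-, ha, hb⟩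
    exact ⟨fun f hf => by rw [← h1 f hf]; exact ha f hf, by rw [← h2]; exact hb⟩
  · rintro ⟨ha, hb⟩
    exact ⟨isSetHom_pointHom _ z, fun f hf => by rw [h1 f hf]; exact ha f hf,
      by rw [h2]; exact hb⟩

/-- Reduces the count to good tuples of points up to `Q`-names, which can be compared directly with
approximate orbits. -/
theorem goodHomCount_eq {μ : Measure Y} {π : GpdHom 𝓖.toGpd 𝓗.toGpd}
    (hπ : π.IsClassBijective) {d : ℕ} {σ : SoficMap 𝓗 d} {Q P : Finpartition (univ : Set Y)}
    (hPQ : P ≤ Q) {F : Finset (PartialAut 𝓗)} (hF : 1 ∈ F) {δ : ℝ} :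
    goodHomCount μ π Q P F δ σ = (pointHom Q '' goodTuples μ π σ P F δ).encard := by
  rw [goodHomCount]
  congr 1
  ext ψ
  constructor
  · rintro ⟨-, φ, hφ, h⟩
    obtain ⟨z, rfl⟩ := hφ.1.exists_pointHom
    refine ⟨z, (pointHom_mem_goodHom_iff hπ hF).1 hφ, ?_⟩
    ext1 ⟨A, hA⟩
    obtain ⟨hA', h'⟩ := h A hA
    rw [h']
    rfl
  · rintro ⟨z, hz, rfl⟩
    exact ⟨isSetHom_pointHom Q z, _, (pointHom_mem_goodHom_iff hπ hF).2 hz, fun A hA =>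
      ⟨sigmaAlg_le_refinePartition hπ hF _ (sigmaAlg_mono hPQ _ hA), rfl⟩⟩

end pointHom

/-! ### Normalised counting -/

section normCard

variable {α : Type*} [Finite α] {d : ℕ}

theorem normCard_nonneg {α : Type*} (d : ℕ) (A : Set α) : 0 ≤ normCard d A := by
  unfold normCard
  positivity

theorem normCard_mono {A B : Set α} (h : A ⊆ B) : normCard d A ≤ normCard d B := by
  unfold normCard
  gcongr
  exact B.toFinite

theorem normCard_empty {α : Type*} (d : ℕ) : normCard d (∅ : Set α) = 0 := by simp [normCard]

theorem normCard_union_le {α : Type*} (A B : Set α) :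
    normCard d (A ∪ B) ≤ normCard d A + normCard d B := by
  unfold normCard
  rw [← add_div]
  gcongr
  exact_mod_cast ncard_union_le A B

theorem normCard_union_of_disjoint {A B : Set α} (h : Disjoint A B) :
    normCard d (A ∪ B) = normCard d A + normCard d B := by
  unfold normCard
  rw [ncard_union_eq h, Nat.cast_add, add_div]

theorem normCard_diff_add_inter (A B : Set α) :
    normCard d (A \ B) + normCard d (A ∩ B) = normCard d A := by
  rw [← normCard_union_of_disjoint disjoint_sdiff_inter, sdiff_union_inter]

theorem normCard_symmDiff_eq (A B : Set α) :
    normCard d (A ∆ B) = normCard d A + normCard d B - 2 * normCard d (A ∩ B) := by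
  have h1 := normCard_diff_add_inter (d := d) A B
  have h2 := normCard_diff_add_inter (d := d) B A
  rw [inter_comm] at h2
  have h3 : normCard d (A ∆ B) = normCard d (A \ B) + normCard d (B \ A) :=
    normCard_union_of_disjoint disjoint_sdiff_sdiff
  linarith

theorem normCard_univ (hd : 0 < d) : normCard d (univ : Set (Fin d)) = 1 := by
  have : (d : ℝ) ≠ 0 := by positivity
  simp [normCard, ncard_univ, this]

theorem normCard_compl (hd : 0 < d) (A : Set (Fin d)) : normCard d Aᶜ = 1 - normCard d A := by
  have h := normCard_union_of_disjoint (d := d) (isCompl_compl (x := A)).disjoint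
  rw [union_compl_self, normCard_univ hd] at h
  linarith

theorem normCard_biUnion_le {α ι : Type*} (s : Finset ι) (A : ι → Set α) :
    normCard d (⋃ i ∈ s, A i) ≤ ∑ i ∈ s, normCard d (A i) := by
  classical
  induction s using Finset.induction_on with
  | empty => simp [normCard_empty]
  | insert i s hi ih =>
    rw [Finset.set_biUnion_insert, Finset.sum_insert hi]
    exact (normCard_union_le _ _).trans (add_le_add le_rfl ih)

theorem normCard_biUnion {ι : Type*} (s : Finset ι) {A : ι → Set α}
    (h : (s : Set ι).PairwiseDisjoint A) :
    normCard d (⋃ i ∈ s, A i) = ∑ i ∈ s, normCard d (A i) := by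
  classical
  induction s using Finset.induction_on with
  | empty => simp [normCard_empty]
  | insert i s hi ih =>
    rw [Finset.set_biUnion_insert, Finset.sum_insert hi, normCard_union_of_disjoint, ih]
    · exact h.subset (by simp)
    · rw [disjoint_iUnion₂_right]
      intro j hj
      exact h (by simp) (by simp [hj]) (fun hij => hi (hij ▸ hj))

theorem sum_parts_normCard {Y : Type*} (P : Finpartition (univ : Set Y)) (z : Fin d → Y)
    (B : Set (Fin d)) : ∑ A ∈ P.parts, normCard d (z ⁻¹' A ∩ B) = normCard d B := by
  rw [← normCard_biUnion]
  · congr 1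
    ext i
    simp only [mem_iUnion, mem_inter_iff]
    constructor
    · rintro ⟨A, -, -, h⟩
      exact h
    · intro hi
      obtain ⟨A, hA, h⟩ := exists_mem_parts P (z i)
      exact ⟨A, hA, h, hi⟩
  · intro A hA C hC hAC
    exact ((P.disjoint hA hC hAC).preimage z).mono inter_subset_left inter_subset_left

theorem normCard_image_of_injOn {α β : Type*} {g : α → β} {A : Set α} (hg : InjOn g A) :
    normCard d (g '' A) = normCard d A := by
  unfold normCard
  rw [hg.ncard_image]

end normCard

namespace PartialPerm

variable {d : ℕ} (τ : PartialPerm d)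

theorem actPt_eq_some {i j : Fin d} : τ.actPt j = some i ↔ (i, j) ∈ τ.1 := by
  unfold actPt
  split_ifs with h
  · rw [Option.some_inj]
    constructor
    · rintro rfl
      exact h.choose_spec
    · exact fun hi => congrArg Prod.fst (τ.2.2 h.choose_spec hi rfl)
  · simp only [false_iff]
    exact fun hi => h ⟨i, hi⟩

/-- Both sets are injective projections of the same part of the graph of `τ`. -/
theorem normCard_act_inter (A B : Set (Fin d)) :
    normCard d (τ.act A ∩ B) = normCard d {j ∈ A | ∃ i ∈ B, (i, j) ∈ τ.1} := by
  have h1 : τ.act A ∩ B = Prod.fst '' {p ∈ τ.1 | p.2 ∈ A ∧ p.1 ∈ B} := by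
    ext i
    constructor
    · rintro ⟨⟨j, hj, h⟩, hi⟩
      exact ⟨(i, j), ⟨h, hj, hi⟩, rfl⟩
    · rintro ⟨⟨i, j⟩, ⟨h, hj, hi⟩, rfl⟩
      exact ⟨⟨j, hj, h⟩, hi⟩
  have h2 : {j ∈ A | ∃ i ∈ B, (i, j) ∈ τ.1} = Prod.snd '' {p ∈ τ.1 | p.2 ∈ A ∧ p.1 ∈ B} := by
    ext j
    constructor
    · rintro ⟨hj, i, hi, h⟩
      exact ⟨(i, j), ⟨h, hj, hi⟩, rfl⟩
    · rintro ⟨⟨i, j⟩, ⟨h, hj, hi⟩, rfl⟩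
      exact ⟨hj, i, hi, h⟩
  rw [h1, h2, normCard_image_of_injOn (τ.2.1.mono (sep_subset _ _)),
    normCard_image_of_injOn (τ.2.2.mono (sep_subset _ _))]

theorem normCard_act (A : Set (Fin d)) :
    normCard d (τ.act A) = normCard d {j ∈ A | ∃ i, (i, j) ∈ τ.1} := by
  have := τ.normCard_act_inter A univ
  simpa using this

/-- Preimages under a partial permutation do not increase the size. -/
theorem normCard_preimage_le (B : Set (Fin d)) :
    normCard d {j | ∃ i ∈ B, (i, j) ∈ τ.1} ≤ normCard d B := by
  have := τ.normCard_act_inter univ B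
  simp only [mem_univ, true_and] at this
  rw [← this]
  exact normCard_mono inter_subset_right

theorem normCard_snd_le (C : Set (Fin d × Fin d)) :
    normCard d {j : Fin d | ∃ i, (i, j) ∈ C} ≤ normCard d C := by
  have : {j : Fin d | ∃ i, (i, j) ∈ C} = Prod.snd '' C := by
    ext j
    simp
  rw [this]
  unfold normCard
  gcongr
  exact ncard_image_le C.toFinite

theorem normCard_fst_le (C : Set (Fin d × Fin d)) :
    normCard d {i : Fin d | ∃ j, (i, j) ∈ C} ≤ normCard d C := by
  have : {i : Fin d | ∃ j, (i, j) ∈ C} = Prod.fst '' C := by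
    ext j
    simp
  rw [this]
  unfold normCard
  gcongr
  exact ncard_image_le C.toFinite

theorem normCard_act_symmDiff_le (τ θ : PartialPerm d) (A B : Set (Fin d)) :
    normCard d (τ.act A ∆ B) ≤ normCard d (θ.act A ∆ B) + normCard d (τ.1 ∆ θ.1) := by
  have h : τ.act A ∆ B ⊆ θ.act A ∆ B ∪ {i : Fin d | ∃ j, (i, j) ∈ τ.1 ∆ θ.1} := by
    have h1 : ∀ i, i ∈ τ.act A → i ∉ θ.act A → ∃ j, (i, j) ∈ τ.1 ∆ θ.1 := by
      rintro i ⟨j, hj, hτ⟩ hθ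
      exact ⟨j, Or.inl ⟨hτ, fun h => hθ ⟨j, hj, h⟩⟩⟩
    have h2 : ∀ i, i ∈ θ.act A → i ∉ τ.act A → ∃ j, (i, j) ∈ τ.1 ∆ θ.1 := by
      rintro i ⟨j, hj, hθ⟩ hτ
      exact ⟨j, Or.inr ⟨hθ, fun h => hτ ⟨j, hj, h⟩⟩⟩
    rintro i (⟨hi, hB⟩ | ⟨hB, hi⟩)
    · by_cases hθ : i ∈ θ.act A
      · exact Or.inl (Or.inl ⟨hθ, hB⟩)
      · exact Or.inr (h1 i hi hθ)
    · by_cases hθ : i ∈ θ.act A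
      · exact Or.inr (h2 i hθ hi)
      · exact Or.inl (Or.inr ⟨hB, hθ⟩)
  exact (normCard_mono h).trans ((normCard_union_le _ _).trans
    (add_le_add le_rfl (normCard_fst_le _)))

end PartialPerm

/-! ### Distances on tuples -/

section dist

variable {Z : Type*} {ρ : Z → Z → ℝ} {d : ℕ}

theorem normCard_setOf_eq (p : Fin d → Prop) [DecidablePred p] :
    normCard d {i | p i} = (1 / (d : ℝ)) * ∑ i, if p i then (1 : ℝ) else 0 := by
  rw [normCard, Finset.sum_boole, ncard_eq_toFinset_card']
  simp [div_eq_inv_mul]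

/-- Chebyshev's inequality. -/
theorem normCard_le_of_dist₂_le {x x' : Fin d → Z} {ε η : ℝ} (hη : 0 < η)
    (h : dist₂ ρ x x' ≤ ε) : normCard d {i | η ≤ ρ (x i) (x' i)} ≤ ε ^ 2 / η ^ 2 := by
  classical
  have hnn : 0 ≤ (1 / (d : ℝ)) * ∑ i, ρ (x i) (x' i) ^ 2 := by positivity
  have h1 : (1 / (d : ℝ)) * ∑ i, ρ (x i) (x' i) ^ 2 ≤ ε ^ 2 := by
    rw [← Real.sq_sqrt hnn]
    exact pow_le_pow_left₀ (Real.sqrt_nonneg _) h 2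
  rw [le_div_iff₀ (by positivity), normCard_setOf_eq, mul_assoc]
  refine le_trans ?_ h1
  gcongr
  rw [Finset.sum_mul]
  refine Finset.sum_le_sum fun i _ => ?_
  split_ifs with hi
  · rw [one_mul]
    exact pow_le_pow_left₀ hη.le hi 2
  · rw [zero_mul]
    positivity

/-- Coordinates below `η` contribute at most `η ^ 2` to the mean square, and the remaining fraction
`b` at most `b * M ^ 2`. -/
theorem dist₂_lt_of_normCard_le {x x' : Fin d → Z} {η b M δ : ℝ} (hρ : ∀ a a', 0 ≤ ρ a a')
    (hM : ∀ a a', ρ a a' ≤ M) (hδ : 0 < δ)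
    (hb : normCard d {i | η ≤ ρ (x i) (x' i)} ≤ b) (h : η ^ 2 + b * M ^ 2 < δ ^ 2) :
    dist₂ ρ x x' < δ := by
  classical
  rw [dist₂, Real.sqrt_lt' hδ]
  refine lt_of_le_of_lt ?_ h
  have h1 : ∀ i, ρ (x i) (x' i) ^ 2 ≤ η ^ 2 + (if η ≤ ρ (x i) (x' i) then 1 else 0) * M ^ 2 := by
    intro i
    split_ifs with hi
    · have := pow_le_pow_left₀ (hρ _ _) (hM (x i) (x' i)) 2
      nlinarith [sq_nonneg η]
    · have := pow_le_pow_left₀ (hρ _ _) (not_le.1 hi).le 2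
      nlinarith
  calc (1 / (d : ℝ)) * ∑ i, ρ (x i) (x' i) ^ 2
      ≤ (1 / (d : ℝ)) * ∑ i, (η ^ 2 + (if η ≤ ρ (x i) (x' i) then 1 else 0) * M ^ 2) := by
        gcongr with i _
        exact h1 i
    _ = (d : ℝ) / d * η ^ 2 + normCard d {i | η ≤ ρ (x i) (x' i)} * M ^ 2 := by
        rw [Finset.sum_add_distrib, ← Finset.sum_mul, normCard_setOf_eq]
        simp
        ring
    _ ≤ 1 * η ^ 2 + b * M ^ 2 := by
        gcongr
        exact div_self_le_one _
    _ = _ := by ring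

theorem dist₂_le_distSup {ρ : Z → Z → ℝ} (hρ : ∀ a a', 0 ≤ ρ a a') (x x' : Fin d → Z) :
    dist₂ ρ x x' ≤ distSup ρ x x' := by
  have hnn : 0 ≤ distSup ρ x x' := Real.iSup_nonneg fun i => hρ _ _
  rw [dist₂]
  refine Real.sqrt_le_iff.2 ⟨hnn, ?_⟩
  calc (1 / (d : ℝ)) * ∑ i, ρ (x i) (x' i) ^ 2
      ≤ (1 / (d : ℝ)) * ∑ _i : Fin d, distSup ρ x x' ^ 2 := by
        gcongr with i _
        · exact hρ _ _
        · exact le_ciSup (f := fun i => ρ (x i) (x' i)) (Set.finite_range _).bddAbove i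
    _ = (d : ℝ) / d * distSup ρ x x' ^ 2 := by
        simp
        ring
    _ ≤ 1 * distSup ρ x x' ^ 2 := by
        gcongr
        exact div_self_le_one _
    _ = _ := one_mul _

theorem sepNumber_mono {D D' : Z → Z → ℝ} (h : ∀ a a', D a a' ≤ D' a a') {ε : ℝ} {A A' : Set Z}
    (hA : A ⊆ A') : sepNumber D ε A ≤ sepNumber D' ε A' :=
  iSup₂_le fun S hS => le_iSup₂_of_le S ⟨hS.1.trans hA, fun a ha b hb hab =>
    (hS.2 a ha b hb hab).trans_le (h a b)⟩ le_rfl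

/-- Maximal separated sets are dense. -/
theorem exists_maximal_separated {D : Z → Z → ℝ} (hD : ∀ a b, D a b = D b a) (ε : ℝ) (A : Set Z) :
    ∃ S ⊆ A, S.encard ≤ sepNumber D ε A ∧ ∀ a ∈ A, a ∈ S ∨ ∃ b ∈ S, D a b ≤ ε := by
  obtain ⟨S, hS⟩ := zorn_subset
    {S : Set Z | S ⊆ A ∧ ∀ y₁ ∈ S, ∀ y₂ ∈ S, y₁ ≠ y₂ → ε < D y₁ y₂} (by
      intro c hc hchain
      refine ⟨⋃₀ c, ⟨sUnion_subset fun s hs => (hc hs).1, ?_⟩, fun s hs => subset_sUnion_of_mem hs⟩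
      rintro y₁ ⟨s₁, hs₁, h₁⟩ y₂ ⟨s₂, hs₂, h₂⟩ hne
      rcases hchain.total hs₁ hs₂ with h | h
      · exact (hc hs₂).2 y₁ (h h₁) y₂ h₂ hne
      · exact (hc hs₁).2 y₁ h₁ y₂ (h h₂) hne)
  refine ⟨S, hS.prop.1, le_iSup₂_of_le S hS.prop le_rfl, fun a ha => ?_⟩
  by_contra! hcon
  obtain ⟨haS, hfar⟩ := hcon
  have hins : insert a S ⊆ S := by
    refine hS.le_of_ge ⟨insert_subset ha hS.prop.1, ?_⟩ (subset_insert a S)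
    rintro y₁ (rfl | h₁) y₂ (rfl | h₂) hne
    · exact absurd rfl hne
    · exact hfar _ h₂
    · rw [hD]
      exact hfar _ h₁
    · exact hS.prop.2 _ h₁ _ h₂ hne
  exact haS (hins (mem_insert a S))

end dist

section extDist

variable {Y : Type*} (ρ : PseudoMetric Y ℝ)

theorem pseudoMetric_nonneg (x y : Y) : 0 ≤ ρ x y := by
  have h := ρ.triangle' x y x
  rw [ρ.refl' x, ρ.symm' y x] at h
  change 0 ≤ ρ.toFun x y
  linarith

/-- The diameter of a pseudo-metric. -/
noncomputable def pmDiam (ρ : PseudoMetric Y ℝ) : ℝ := ⨆ q : Y × Y, ρ q.1 q.2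

theorem pmDiam_nonneg : 0 ≤ pmDiam ρ := Real.iSup_nonneg fun _ => pseudoMetric_nonneg ρ _ _

theorem extDist_some_none (x : Y) : extDist ρ (some x) none = pmDiam ρ := rfl

theorem extDist_none_some (x : Y) : extDist ρ none (some x) = pmDiam ρ := rfl

theorem extDist_nonneg (x y : Option Y) : 0 ≤ extDist ρ x y := by
  rcases x with - | x <;> rcases y with - | y
  · exact le_rfl
  · exact pmDiam_nonneg ρ
  · exact pmDiam_nonneg ρ
  · exact pseudoMetric_nonneg ρ x y

theorem extDist_comm (x y : Option Y) : extDist ρ x y = extDist ρ y x := by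
  rcases x with - | x <;> rcases y with - | y
  · rfl
  · rfl
  · rfl
  · exact ρ.symm' x y

variable {ρ}

theorem le_pmDiam [TopologicalSpace Y] [CompactSpace Y]
    (hρ : Continuous fun q : Y × Y => ρ q.1 q.2) (x y : Y) : ρ x y ≤ pmDiam ρ :=
  le_ciSup (f := fun q : Y × Y => ρ q.1 q.2) (isCompact_range hρ).bddAbove (x, y)

theorem extDist_le [TopologicalSpace Y] [CompactSpace Y]
    (hρ : Continuous fun q : Y × Y => ρ q.1 q.2) (x y : Option Y) :
    extDist ρ x y ≤ pmDiam ρ := by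
  rcases x with - | x <;> rcases y with - | y
  · exact pmDiam_nonneg ρ
  · exact le_rfl
  · exact le_rfl
  · exact le_pmDiam hρ x y

/-- The symbol `*` lies at distance the diameter from every point; compactness makes the diameter a
true upper bound, so a detour through `*` is never shorter. -/
theorem extDist_triangle [TopologicalSpace Y] [CompactSpace Y]
    (hρ : Continuous fun q : Y × Y => ρ q.1 q.2) (x y z : Option Y) :
    extDist ρ x z ≤ extDist ρ x y + extDist ρ y z := by
  have hnn := fun a b => extDist_nonneg ρ a b
  rcases x with - | x <;> rcases y with - | y <;> rcases z with - | z
  · exact add_nonneg le_rfl le_rfl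
  · exact le_add_of_nonneg_left le_rfl
  · exact add_nonneg (hnn none (some y)) (hnn (some y) none)
  · exact le_add_of_nonneg_right (hnn (some y) (some z))
  · exact le_add_of_nonneg_right le_rfl
  · exact (le_pmDiam hρ x z).trans (le_add_of_nonneg_right (hnn none (some z)))
  · exact le_add_of_nonneg_left (hnn (some x) (some y))
  · exact ρ.triangle' x y z

end extDist

/-! ### Counting names -/

section hamming

/-- The size of a Hamming ball. -/
theorem card_hamming_ball_le {T : Type*} [Fintype T] [DecidableEq T] {d : ℕ} (n : Fin d → T)
    {t θ : ℝ} (ht : 0 ≤ t) (s : Finset (Fin d → T))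
    (hs : ∀ n' ∈ s, ((Finset.univ.filter fun i => n i ≠ n' i).card : ℝ) ≤ θ * d) :
    (s.card : ℝ) ≤ Real.exp ((t * θ + Fintype.card T * Real.exp (-t)) * d) := by
  -- Exponential weights: a coordinate counts `1` where it agrees with `n` and `e⁻ᵗ` where it does
  -- not. A word of the ball weighs at least `exp(-tθd)`, while the total weight factors over
  -- coordinates and is at most `exp(|T| e⁻ᵗ d)`.
  let w : Fin d → T → ℝ := fun i a => if n i = a then 1 else Real.exp (-t)
  have hw : ∀ i a, 0 ≤ w i a := fun i a => by
    simp only [w]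
    split_ifs <;> positivity
  have h1 : ∑ n' : Fin d → T, ∏ i, w i (n' i) = ∏ i, ∑ a, w i a := by
    rw [Finset.prod_univ_sum, Fintype.piFinset_univ]
  have h2 : ∀ i, ∑ a, w i a ≤ Real.exp (Fintype.card T * Real.exp (-t)) := fun i => by
    calc ∑ a, w i a ≤ ∑ a, ((if n i = a then 1 else 0) + Real.exp (-t)) := by
          refine Finset.sum_le_sum fun a _ => ?_
          simp only [w]
          split_ifs
          · linarith [Real.exp_pos (-t)]
          · linarith
      _ = Fintype.card T * Real.exp (-t) + 1 := by
          rw [Finset.sum_add_distrib]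
          simp
          ring
      _ ≤ _ := Real.add_one_le_exp _
  have h3 : ∑ n' : Fin d → T, ∏ i, w i (n' i)
      ≤ Real.exp (Fintype.card T * Real.exp (-t) * d) := by
    rw [h1]
    calc ∏ i, ∑ a, w i a ≤ ∏ _i : Fin d, Real.exp (Fintype.card T * Real.exp (-t)) :=
          Finset.prod_le_prod (fun i _ => Finset.sum_nonneg fun a _ => hw i a) fun i _ => h2 i
      _ = _ := by
          rw [Finset.prod_const, Finset.card_univ, Fintype.card_fin, ← Real.exp_nat_mul, mul_comm]
  have h4 : ∀ n' ∈ s, Real.exp (-(t * θ * d)) ≤ ∏ i, w i (n' i) := fun n' hn' => by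
    have : ∏ i, w i (n' i)
        = Real.exp (-t) ^ (Finset.univ.filter fun i => n i ≠ n' i).card := by
      simp only [w]
      rw [Finset.prod_ite]
      simp
    rw [this, ← Real.exp_nat_mul, Real.exp_le_exp]
    nlinarith [mul_le_mul_of_nonneg_left (hs n' hn') ht]
  have h5 : (s.card : ℝ) * Real.exp (-(t * θ * d))
      ≤ Real.exp (Fintype.card T * Real.exp (-t) * d) := by
    calc (s.card : ℝ) * Real.exp (-(t * θ * d)) = ∑ n' ∈ s, Real.exp (-(t * θ * d)) := by simp
      _ ≤ ∑ n' ∈ s, ∏ i, w i (n' i) := Finset.sum_le_sum h4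
      _ ≤ ∑ n' : Fin d → T, ∏ i, w i (n' i) :=
          Finset.sum_le_sum_of_subset_of_nonneg (Finset.subset_univ s)
            fun n' _ _ => Finset.prod_nonneg fun i _ => hw i _
      _ ≤ _ := h3
  calc (s.card : ℝ) = (s.card : ℝ) * Real.exp (-(t * θ * d)) * Real.exp (t * θ * d) := by
        rw [mul_assoc, ← Real.exp_add]
        simp
    _ ≤ Real.exp (Fintype.card T * Real.exp (-t) * d) * Real.exp (t * θ * d) := by gcongr
    _ = _ := by
        rw [← Real.exp_add]
        congr 1
        ring

/-- A set of words of Hamming diameter at most `θ` lies in a ball around any of its members. -/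
theorem exists_hamming_radius (T : Type*) [Finite T] {κ : ℝ} (hκ : 0 < κ) :
    ∃ θ : ℝ, 0 < θ ∧ ∀ (d : ℕ) (A : Set (Fin d → T)),
      (∀ n ∈ A, ∀ n' ∈ A, normCard d {i | n i ≠ n' i} ≤ θ) →
      (A.ncard : ℝ) ≤ Real.exp (κ * d) := by
  classical
  have := Fintype.ofFinite T
  have hlim : Tendsto (fun t : ℝ => Fintype.card T * Real.exp (-t)) atTop (𝓝 0) := by
    simpa using (Real.tendsto_exp_neg_atTop_nhds_zero.const_mul (Fintype.card T : ℝ))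
  obtain ⟨t, ht1, ht⟩ := ((eventually_gt_atTop (0 : ℝ)).and
    (hlim.eventually_lt_const (half_pos hκ))).exists
  -- With this radius `tθ = κ/2`, and `t` was chosen so that `|T| e⁻ᵗ < κ/2`.
  refine ⟨κ / (2 * t), by positivity, fun d A hA => ?_⟩
  rcases A.eq_empty_or_nonempty with rfl | ⟨n, hn⟩
  · simp [Real.exp_nonneg]
  rw [ncard_eq_toFinset_card' A]
  refine (card_hamming_ball_le n ht1.le A.toFinset (θ := κ / (2 * t)) fun n' hn' => ?_).trans ?_
  · have h := hA n hn n' (Set.mem_toFinset.1 hn')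
    rw [normCard, ncard_eq_toFinset_card'] at h
    simp only [toFinset_ofPred] at h
    rcases Nat.eq_zero_or_pos d with rfl | hd
    · simp
    · rwa [div_le_iff₀ (by positivity)] at h
  · rw [Real.exp_le_exp]
    gcongr
    have : t * (κ / (2 * t)) = κ / 2 := by field_simp
    linarith

/-- A maximal `ε`-separated subset of `O` is `ε`-dense in `A`, and the points of `A` within `ε` of
one of its members carry at most `exp(κ d)` names. If that subset is infinite, the bound is trivial.
-/
theorem encard_image_names_le {T Z : Type*} [Finite T] {d : ℕ} {κ θ : ℝ}
    (hθ : ∀ A : Set (Fin d → T), (∀ n ∈ A, ∀ n' ∈ A, normCard d {i | n i ≠ n' i} ≤ θ) →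
      (A.ncard : ℝ) ≤ Real.exp (κ * d)) {D : Z → Z → ℝ} (hD : ∀ a b, D a b = D b a)
    {ε : ℝ} (hD0 : ∀ a, D a a ≤ ε) {A O : Set Z} (hAO : A ⊆ O) {name : Z → Fin d → T}
    (hname : ∀ s ∈ O, ∀ z ∈ A, ∀ z' ∈ A, D z s ≤ ε → D z' s ≤ ε →
      normCard d {i | name z i ≠ name z' i} ≤ θ) :
    ((name '' A).encard : ℝ≥0∞) ≤ ENNReal.ofReal (Real.exp (κ * d)) * (sepNumber D ε O : ℝ≥0∞) := by
  obtain ⟨S, hSO, hS, hdense⟩ := exists_maximal_separated hD ε O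
  have hS' : (S.encard : ℝ≥0∞) ≤ (sepNumber D ε O : ℝ≥0∞) := ENat.toENNReal_le.2 hS
  refine le_trans ?_ (mul_le_mul_right hS' _)
  have hexp : ENNReal.ofReal (Real.exp (κ * d)) ≠ 0 := by simp [Real.exp_pos]
  by_cases hfin : S.Finite
  · have hcov : name '' A ⊆ ⋃ s ∈ hfin.toFinset, name '' {z ∈ A | D z s ≤ ε} := by
      rintro _ ⟨z, hz, rfl⟩
      simp only [Finite.mem_toFinset, mem_iUnion]
      rcases hdense z (hAO hz) with h | ⟨s, hs, h⟩
      · exact ⟨z, h, z, ⟨hz, hD0 z⟩, rfl⟩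
      · exact ⟨s, hs, z, ⟨hz, h⟩, rfl⟩
    have h1 : ∀ s ∈ hfin.toFinset,
        ((name '' {z ∈ A | D z s ≤ ε}).ncard : ℝ) ≤ Real.exp (κ * d) := by
      intro s hs
      refine hθ _ ?_
      rintro _ ⟨z, hz, rfl⟩ _ ⟨z', hz', rfl⟩
      exact hname s (hSO (hfin.mem_toFinset.1 hs)) z hz.1 z' hz'.1 hz.2 hz'.2
    have h2 : ((name '' A).ncard : ℝ) ≤ Real.exp (κ * d) * S.ncard := by
      calc ((name '' A).ncard : ℝ)
          ≤ ((⋃ s ∈ hfin.toFinset, name '' {z ∈ A | D z s ≤ ε}).ncard : ℝ) := by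
            exact_mod_cast ncard_le_ncard hcov (Set.toFinite _)
        _ ≤ ((∑ s ∈ hfin.toFinset, (name '' {z ∈ A | D z s ≤ ε}).ncard : ℕ) : ℝ) := by
            exact_mod_cast Finset.set_ncard_biUnion_le _ _
        _ ≤ ∑ s ∈ hfin.toFinset, Real.exp (κ * d) := by
            rw [Nat.cast_sum]
            exact Finset.sum_le_sum h1
        _ = _ := by
            rw [Finset.sum_const, nsmul_eq_mul, ncard_eq_toFinset_card S hfin, mul_comm]
    rw [← hfin.cast_ncard_eq, ← (Set.toFinite (name '' A)).cast_ncard_eq]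
    simp only [ENat.toENNReal_coe]
    rw [← ENNReal.ofReal_natCast, ← ENNReal.ofReal_natCast (S.ncard),
      ← ENNReal.ofReal_mul (Real.exp_nonneg _)]
    exact ENNReal.ofReal_le_ofReal h2
  · have : S.encard = ⊤ := Set.Infinite.encard_eq hfin
    rw [this]
    simp [ENNReal.mul_top hexp]

end hamming

/-! ### Partition names bounded by separated orbits -/

section average

variable {Y : Type*} [TopologicalSpace Y] [CompactSpace Y]

/-- Replace `k` by a function constant on the atoms. This changes the average and the integral by at
most `o` each, and for the step function the two differ only through the errors in the frequencies
of the atoms. -/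
theorem norm_average_sub_integral_le [MeasurableSpace Y] [BorelSpace Y] {μ : Measure Y} [IsProbabilityMeasure μ]
    {R : Finpartition (univ : Set Y)} (hR : IsBorelPartition R) (k : C(Y, ℂ)) {o : ℝ} (ho : 0 ≤ o)
    (hk : ∀ A ∈ R.parts, ∀ y ∈ A, ∀ y' ∈ A, ‖k y - k y'‖ ≤ o) {d : ℕ} (z : Fin d → Y) :
    ‖(1 / (d : ℂ)) * ∑ i, k (z i) - ∫ y, k y ∂μ‖
      ≤ 2 * o + ‖k‖ * ∑ A ∈ R.parts, |normCard d (z ⁻¹' A) - μ.real A| := by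
  classical
  have := nonempty_of_isProbabilityMeasure μ
  choose! pt hpt using fun A (hA : A ∈ R.parts) => nonempty_of_mem_parts R hA
  let k' : Y → ℂ := fun y => ∑ A ∈ R.parts, A.indicator (fun _ => k (pt A)) y
  have hk' : ∀ y, ‖k y - k' y‖ ≤ o := fun y => by
    obtain ⟨A, hA, hy⟩ := exists_mem_parts R y
    have : k' y = k (pt A) := by
      simp only [k']
      rw [Finset.sum_eq_single A]
      · rw [indicator_of_mem hy]
      · intro B hB hBA
        exact indicator_of_notMem (fun h => hBA (eq_of_mem_parts R hB hA h hy)) _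
      · exact fun h => absurd hA h
    rw [this]
    exact hk A hA y hy _ (hpt A hA)
  have hint : ∀ A ∈ R.parts, Integrable (A.indicator fun _ => k (pt A)) μ := fun A hA =>
    (integrable_const _).indicator (hR A hA)
  have hk'i : Integrable k' μ := integrable_finsetSum _ hint
  have hki : Integrable k μ :=
    (k.continuous.integrable_of_hasCompactSupport (HasCompactSupport.of_compactSpace k))
  have h1 : ∫ y, k' y ∂μ = ∑ A ∈ R.parts, (μ.real A : ℂ) * k (pt A) := by
    simp only [k']
    rw [integral_finsetSum _ hint]
    refine Finset.sum_congr rfl fun A hA => ?_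
    rw [integral_indicator_const _ (hR A hA), Complex.real_smul]
  have h2 : (1 / (d : ℂ)) * ∑ i, k' (z i)
      = ∑ A ∈ R.parts, (normCard d (z ⁻¹' A) : ℂ) * k (pt A) := by
    simp only [k']
    rw [Finset.sum_comm, Finset.mul_sum]
    refine Finset.sum_congr rfl fun A hA => ?_
    rw [show z ⁻¹' A = {i | z i ∈ A} from rfl, normCard_setOf_eq]
    push_cast
    rw [mul_assoc, Finset.sum_mul]
    congr 1
    refine Finset.sum_congr rfl fun i _ => ?_
    by_cases h : z i ∈ A <;> simp [h]
  have h3 : ‖(1 / (d : ℂ)) * ∑ i, k (z i) - (1 / (d : ℂ)) * ∑ i, k' (z i)‖ ≤ o := by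
    rw [← mul_sub, ← Finset.sum_sub_distrib, norm_mul]
    calc ‖(1 / (d : ℂ))‖ * ‖∑ i, (k (z i) - k' (z i))‖
        ≤ (1 / (d : ℝ)) * ∑ _i : Fin d, o := by
          rw [norm_div, norm_one, Complex.norm_natCast]
          gcongr
          exact (norm_sum_le _ _).trans (Finset.sum_le_sum fun i _ => hk' _)
      _ = (d : ℝ) / d * o := by
          simp
          ring
      _ ≤ 1 * o := by
          gcongr
          exact div_self_le_one _
      _ = o := one_mul o
  have h4 : ‖∫ y, k' y ∂μ - ∫ y, k y ∂μ‖ ≤ o := by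
    rw [← integral_sub hk'i hki]
    refine (norm_integral_le_of_norm_le_const (C := o) (ae_of_all _ fun y => ?_)).trans ?_
    · rw [norm_sub_rev]
      exact hk' y
    · simp
  have h5 : ‖(1 / (d : ℂ)) * ∑ i, k' (z i) - ∫ y, k' y ∂μ‖
      ≤ ‖k‖ * ∑ A ∈ R.parts, |normCard d (z ⁻¹' A) - μ.real A| := by
    rw [h1, h2, ← Finset.sum_sub_distrib, Finset.mul_sum]
    refine (norm_sum_le _ _).trans (Finset.sum_le_sum fun A _ => ?_)
    rw [← sub_mul, norm_mul, mul_comm, ← Complex.ofReal_sub, Complex.norm_real, Real.norm_eq_abs]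
    gcongr
    exact k.norm_coe_le_norm _
  calc ‖(1 / (d : ℂ)) * ∑ i, k (z i) - ∫ y, k y ∂μ‖
      = ‖((1 / (d : ℂ)) * ∑ i, k (z i) - (1 / (d : ℂ)) * ∑ i, k' (z i))
        + ((1 / (d : ℂ)) * ∑ i, k' (z i) - ∫ y, k' y ∂μ)
        + (∫ y, k' y ∂μ - ∫ y, k y ∂μ)‖ := by
        congr 1
        ring
    _ ≤ o + ‖k‖ * ∑ A ∈ R.parts, |normCard d (z ⁻¹' A) - μ.real A| + o :=
        (norm_add₃_le).trans (add_le_add (add_le_add h3 h5) h4)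
    _ = _ := by ring

theorem exists_small_cells {ρ : PseudoMetric Y ℝ} (hρ : Continuous fun q : Y × Y => ρ q.1 q.2)
    (K : Finset C(Y, ℂ)) {η : ℝ} (hη : 0 < η) :
    ∃ (t : Finset Y) (N : Y → Set Y), (∀ y, IsOpen (N y)) ∧ (∀ y, ∃ c ∈ t, y ∈ N c) ∧
      ∀ c, ∀ y ∈ N c, ∀ y' ∈ N c, ρ y y' < η ∧ ∀ k ∈ K, ‖k y - k y'‖ ≤ η := by
  let N : Y → Set Y := fun c => {y | ρ c y < η / 2} ∩ ⋂ k ∈ K, {y | ‖k c - k y‖ < η / 2}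
  have hN : ∀ c, IsOpen (N c) := fun c => by
    refine IsOpen.inter ?_ (isOpen_biInter_finset fun k _ => ?_)
    · exact isOpen_lt (hρ.comp (Continuous.prodMk_right c)) continuous_const
    · exact isOpen_lt ((continuous_const.sub k.continuous).norm) continuous_const
  have hself : ∀ c, c ∈ N c := fun c => by
    refine ⟨?_, mem_iInter₂.2 fun k _ => ?_⟩
    · change ρ.toFun c c < η / 2
      rw [ρ.refl' c]
      positivity
    · simp [hη]
  obtain ⟨t, ht⟩ := isCompact_univ.elim_finite_subcover N hN
    fun y _ => mem_iUnion.2 ⟨y, hself y⟩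
  refine ⟨t, N, hN, fun y => ?_, fun c y hy y' hy' => ⟨?_, fun k hk => ?_⟩⟩
  · obtain ⟨c, hc, h⟩ := mem_iUnion₂.1 (ht (mem_univ y))
    exact ⟨c, hc, h⟩
  · have h1 : ρ.toFun c y < η / 2 := hy.1
    have h2 : ρ.toFun c y' < η / 2 := hy'.1
    have h3 := ρ.triangle' y c y'
    rw [ρ.symm' y c] at h3
    change ρ.toFun y y' < η
    linarith
  · have h1 : ‖k c - k y‖ < η / 2 := mem_iInter₂.1 hy.2 k hk
    have h2 : ‖k c - k y'‖ < η / 2 := mem_iInter₂.1 hy'.2 k hk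
    calc ‖k y - k y'‖ = ‖(k c - k y') - (k c - k y)‖ := by congr 1; ring
      _ ≤ ‖k c - k y'‖ + ‖k c - k y‖ := norm_sub_le _ _
      _ ≤ η := by linarith

end average

/-! ### Good tuples are approximate orbits -/

section lower

variable {Y G X H : Type*} [MeasurableSpace Y] [MeasurableSpace G] [StandardBorelSpace G]
  [MeasurableSpace X] [MeasurableSpace H] [StandardBorelSpace H]
  {𝓖 : MGpd Y G} {𝓗 : MGpd X H} {π : GpdHom 𝓖.toGpd 𝓗.toGpd} {μ : Measure Y}

theorem sum_abs_normCard_sub_le [IsFiniteMeasure μ] {R : Finpartition (univ : Set Y)}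
    (hR : IsBorelPartition R) {d : ℕ} (z : Fin d → Y) {B : Set Y}
    (hB : MeasurableSet[sigmaAlg R] B) :
    |normCard d (z ⁻¹' B) - μ.real B| ≤ ∑ A ∈ R.parts, |normCard d (z ⁻¹' A) - μ.real A| := by
  rw [← sum_parts_measureReal (μ := μ) hR (hR.measurableSet hB),
    ← sum_parts_normCard R z (z ⁻¹' B), ← Finset.sum_sub_distrib]
  refine (Finset.abs_sum_le_sum_abs _ _).trans (Finset.sum_le_sum fun A hA => ?_)
  rw [← preimage_inter]
  rcases measurableSet_sigmaAlg_iff.1 hB A hA with h | h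
  · rw [inter_eq_left.2 h]
  · rw [disjoint_iff_inter_eq_empty.1 h]
    simp [normCard_empty]

theorem goodTuples_abs_sub_lt [IsFiniteMeasure μ] (hπ : π.IsClassBijective)
    (hm : Measurable π.arr) {R : Finpartition (univ : Set Y)} (hR : IsBorelPartition R)
    {F : Finset (PartialAut 𝓗)} {δ : ℝ} {d : ℕ} {σ : SoficMap 𝓗 d} {z : Fin d → Y}
    (hz : z ∈ goodTuples μ π σ R F δ) {B : Set Y}
    (hB : MeasurableSet[sigmaAlg (refinePartition π R F)] B) :
    |normCard d (z ⁻¹' B) - μ.real B| < δ :=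
  (sum_abs_normCard_sub_le (isBorelPartition_refinePartition hπ hm hR F) z hB).trans_lt hz.2

/-- In a cell of the partition, a good tuple follows `f` up to few errors. -/
theorem goodTuples_normCard_bad_le [IsFiniteMeasure μ] (hμ : 𝓖.IsPMP μ)
    (hπ : π.IsClassBijective) (hm : Measurable π.arr) {ρ : PseudoMetric Y ℝ} {η : ℝ} (hη : 0 < η)
    {R : Finpartition (univ : Set Y)} (hR : IsBorelPartition R) {F : Finset (PartialAut 𝓗)}
    (hF : 1 ∈ F) {f : PartialAut 𝓗} (hf : f ∈ F) {δ : ℝ} {d : ℕ} {σ : SoficMap 𝓗 d}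
    {z : Fin d → Y} (hz : z ∈ goodTuples μ π σ R F δ) {A : Set Y} (hA : A ∈ R.parts)
    (hdom : A ⊆ π.obj ⁻¹' (𝓗.s '' f.1) ∨ Disjoint A (π.obj ⁻¹' (𝓗.s '' f.1)))
    (hcell : ∀ y ∈ π.act f.1 A, ∀ y' ∈ π.act f.1 A, ρ y y' < η) :
    normCard d {i | i ∈ z ⁻¹' A ∧
      η ≤ extDist ρ (π.actPt f.1 (z i)) (((σ f).actPt i).map z)} ≤ 3 * δ := by
  have hAm : MeasurableSet[sigmaAlg (refinePartition π R F)] A :=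
    sigmaAlg_le_refinePartition hπ hF _ (measurableSet_sigmaAlg_of_mem hA)
  have h1 := (abs_lt.1 (goodTuples_abs_sub_lt hπ hm hR hz hAm)).2
  have h2 := (abs_lt.1 (goodTuples_abs_sub_lt hπ hm hR hz (measurableSet_act_sigmaAlg hf hA))).1
  have h3 : normCard d ((σ f).act (z ⁻¹' A) ∆ (z ⁻¹' (π.act f.1 A))) < δ :=
    (Finset.single_le_sum (f := fun A => normCard d ((σ f).act (z ⁻¹' A) ∆ (z ⁻¹' (π.act f.1 A))))
      (fun _ _ => normCard_nonneg d _) hA).trans_lt (hz.1 f hf)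
  have hδ : 0 < δ := (normCard_nonneg d _).trans_lt h3
  rcases hdom with hdom | hdom
  · have hμA : μ.real (π.act f.1 A) = μ.real A := by
      rw [measureReal_def, measure_act hμ hπ hm f (hR A hA), inter_eq_left.2 hdom, measureReal_def]
    have hsub : {i | i ∈ z ⁻¹' A ∧ η ≤ extDist ρ (π.actPt f.1 (z i)) (((σ f).actPt i).map z)}
        ⊆ z ⁻¹' A \ {i ∈ z ⁻¹' A | ∃ k ∈ z ⁻¹' (π.act f.1 A), (k, i) ∈ (σ f).1} := by
      rintro i ⟨hi, hbad⟩
      refine ⟨hi, fun ⟨_, k, hk, hki⟩ => ?_⟩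
      rw [(σ f).actPt_eq_some.2 hki] at hbad
      obtain ⟨y, hy⟩ : ∃ y, π.actPt f.1 (z i) = some y := by
        refine Option.ne_none_iff_exists'.1 fun h => ?_
        exact (GpdHom.actPt_eq_none hπ).1 h (hdom hi)
      rw [hy] at hbad
      refine absurd (hcell y ?_ (z k) hk) (not_lt.2 hbad)
      exact (GpdHom.mem_act_iff hπ f.injOn_s).2 ⟨z i, hi, hy⟩
    -- At most `μ(A) + δ` of the indices have `z i ∈ A`, and `σ f` moves at least `μ(f·A) - 2δ =
    -- μ(A) - 2δ` of them into `f·A`; this leaves at most `3δ`.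
    have h4 := normCard_diff_add_inter (d := d) (z ⁻¹' A)
      {i ∈ z ⁻¹' A | ∃ k ∈ z ⁻¹' (π.act f.1 A), (k, i) ∈ (σ f).1}
    rw [inter_eq_right.2 (sep_subset _ _), ← (σ f).normCard_act_inter] at h4
    have h5 := normCard_diff_add_inter (d := d) (z ⁻¹' (π.act f.1 A)) ((σ f).act (z ⁻¹' A))
    have h6 : normCard d (z ⁻¹' (π.act f.1 A) \ (σ f).act (z ⁻¹' A)) < δ :=
      (normCard_mono (fun i hi => Or.inr hi)).trans_lt h3
    rw [inter_comm] at h5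
    have := normCard_mono (d := d) hsub
    linarith
  -- Here `f` is undefined on `A`, so `σ f` must be undefined at nearly all indices over `A`; where
  -- it is undefined both entries are `*`, at distance `0`.
  · have hempty : π.act f.1 A = ∅ := by
      rw [eq_empty_iff_forall_notMem]
      intro y hy
      obtain ⟨y', hy', h⟩ := (GpdHom.mem_act_iff hπ f.injOn_s).1 hy
      refine hdom.le_bot ⟨hy', ?_⟩
      by_contra hn
      rw [(GpdHom.actPt_eq_none hπ).2 hn] at h
      cases h
    rw [hempty, preimage_empty, ← bot_eq_empty, symmDiff_bot, (σ f).normCard_act] at h3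
    have hsub : {i | i ∈ z ⁻¹' A ∧ η ≤ extDist ρ (π.actPt f.1 (z i)) (((σ f).actPt i).map z)}
        ⊆ {i ∈ z ⁻¹' A | ∃ k, (k, i) ∈ (σ f).1} := by
      rintro i ⟨hi, hbad⟩
      refine ⟨hi, ?_⟩
      by_contra! hn
      have e1 : (σ f).actPt i = none := by
        by_contra h
        obtain ⟨k, hk⟩ := Option.ne_none_iff_exists'.1 h
        exact hn k ((σ f).actPt_eq_some.1 hk)
      have e2 : π.actPt f.1 (z i) = none :=
        (GpdHom.actPt_eq_none hπ).2 fun h => hdom.le_bot ⟨hi, h⟩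
      rw [e1, e2] at hbad
      exact absurd hη (not_lt.2 hbad)
    have := normCard_mono (d := d) hsub
    linarith

variable [TopologicalSpace Y] [CompactSpace Y] [BorelSpace Y]

/-- Refine `Q` so that every atom lies in a small cell, lies entirely inside or outside the domain
of each `f ∈ F`, and is mapped by `f` into a small cell. Small cells control both `ρ` and the
functions in `K`, so errors occur only at indices where the tuple fails to follow an atom. Making
`C` a union of atoms controls the frequency of visits to `C`. -/
theorem exists_goodTuples_subset_orb (hμ : 𝓖.IsPMP μ) (hπ : π.IsClassBijective)
    (hm : Measurable π.arr) {ρ : PseudoMetric Y ℝ} (hρ : Continuous fun q : Y × Y => ρ q.1 q.2)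
    {Q : Finpartition (univ : Set Y)} (hQ : IsBorelPartition Q) {C : Set Y} (hC : MeasurableSet C)
    (F : Finset (PartialAut 𝓗)) (K : Finset C(Y, ℂ)) {δ : ℝ} (hδ : 0 < δ) {θ : ℝ} (hθ : 0 < θ) :
    ∃ R ≤ Q, IsBorelPartition R ∧ ∃ F' : Finset (PartialAut 𝓗), 1 ∈ F' ∧ ∃ δ' > 0,
      ∀ (d : ℕ) (σ : SoficMap 𝓗 d), ∀ z ∈ goodTuples μ π σ R F' δ',
        z ∈ orb μ π ρ F K δ σ ∧ |normCard d (z ⁻¹' C) - μ.real C| < θ := by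
  classical
  have := hμ.1
  set M := pmDiam ρ
  have hM : 0 ≤ M := pmDiam_nonneg ρ
  obtain ⟨t, N, hN, hcov, hsmall⟩ := exists_small_cells hρ K (η := δ / 4) (by positivity)
  -- Four kinds of sets to be resolved: small cells, their preimages under each `f`, the domains of
  -- the `f`, and `C`.
  let S : ((t ⊕ (F × t)) ⊕ F) ⊕ Unit → Set Y := Sum.elim (Sum.elim (Sum.elim (fun c => N c.1)
    fun q => π.preAct q.1.1.1 (N q.2.1)) fun f => π.obj ⁻¹' (𝓗.s '' f.1.1)) fun _ => C
  have hS : ∀ i, MeasurableSet (S i) := by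
    rintro (((c | q) | f) | u)
    · exact (hN _).measurableSet
    · exact measurableSet_preAct hπ hm _ (hN _).measurableSet
    · change MeasurableSet (π.obj ⁻¹' (𝓗.s '' f.1.1))
      rw [← hπ.s_image_preimage]
      exact 𝓖.measurableSet_image 𝓖.measurable_s (hm f.1.measurableSet)
        (hπ.injOn_s f.1.injOn_s)
    · exact hC
  obtain ⟨R, hRQ, hR, hRS⟩ := exists_refinement hQ hS
  set n : ℝ := (R.parts.card : ℝ)
  have hn : 0 ≤ n := Nat.cast_nonneg _
  set κ : ℝ := ∑ k ∈ K, ‖k‖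
  have hκ : 0 ≤ κ := Finset.sum_nonneg fun k _ => norm_nonneg k
  have hin : (1 : PartialAut 𝓗) ∈ insert 1 F := Finset.mem_insert_self _ _
  -- Each of the `n` atoms has at most `3δ'` bad indices and frequency error at most `δ'`; the three
  -- inequalities control `ρ₂`, the averages of `K`, and the visits to `C`.
  obtain ⟨δ', hδ', h1, h2, h3⟩ : ∃ δ' > 0, (δ / 4) ^ 2 + n * (3 * δ') * M ^ 2 < δ ^ 2 ∧
      κ * (n * δ') < δ / 4 ∧ δ' < θ := by
    have hev : ∀ᶠ t : ℝ in 𝓝 0, (δ / 4) ^ 2 + n * (3 * t) * M ^ 2 < δ ^ 2 ∧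
        κ * (n * t) < δ / 4 ∧ t < θ := by
      refine Eventually.and ?_ (Eventually.and ?_ (eventually_lt_nhds hθ))
      · refine ContinuousAt.eventually_lt (by fun_prop) continuousAt_const ?_
        nlinarith
      · exact ContinuousAt.eventually_lt (by fun_prop) continuousAt_const (by simp [hδ])
    obtain ⟨t, ht, hlt⟩ := (hev.filter_mono nhdsWithin_le_nhds |>.and
      (self_mem_nhdsWithin : Ioi (0 : ℝ) ∈ 𝓝[>] 0)).exists
    exact ⟨t, hlt, ht⟩
  refine ⟨R, hRQ, hR, insert 1 F, hin, δ', hδ', fun d σ z hz => ⟨⟨fun f hf => ?_, fun k hk => ?_⟩,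
    ?_⟩⟩
  · have hf' : f ∈ insert 1 F := Finset.mem_insert_of_mem hf
    refine dist₂_lt_of_normCard_le (η := δ / 4) (M := M) (b := n * (3 * δ'))
      (extDist_nonneg ρ) (extDist_le hρ) hδ ?_ h1
    have hcov' : {i | δ / 4 ≤ extDist ρ (π.actPt f.1 (z i)) (((σ f).actPt i).map z)}
        ⊆ ⋃ A ∈ R.parts, {i | i ∈ z ⁻¹' A ∧
          δ / 4 ≤ extDist ρ (π.actPt f.1 (z i)) (((σ f).actPt i).map z)} := by
      intro i hi
      obtain ⟨A, hA, h⟩ := exists_mem_parts R (z i)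
      exact mem_iUnion₂.2 ⟨A, hA, h, hi⟩
    refine (normCard_mono hcov').trans ((normCard_biUnion_le _ _).trans ?_)
    rw [← nsmul_eq_mul]
    refine Finset.sum_le_card_nsmul _ _ _ fun A hA => ?_
    refine goodTuples_normCard_bad_le hμ hπ hm (by positivity) hR hin hf' hz hA
      (hRS A hA (Sum.inl (Sum.inr ⟨f, hf⟩))) fun y hy y' hy' => ?_
    obtain ⟨a, ha, hay⟩ := (GpdHom.mem_act_iff hπ f.injOn_s).1 hy
    obtain ⟨a', ha', hay'⟩ := (GpdHom.mem_act_iff hπ f.injOn_s).1 hy'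
    obtain ⟨c, hc, hyc⟩ := hcov y
    have hac : a ∈ π.preAct f.1 (N c) := (GpdHom.mem_preAct hπ f.injOn_s).2 ⟨y, hyc, hay⟩
    have hAc : A ⊆ π.preAct f.1 (N c) :=
      (hRS A hA (Sum.inl (Sum.inl (Sum.inr (⟨f, hf⟩, ⟨c, hc⟩))))).resolve_right
        fun h => h.le_bot ⟨ha, hac⟩
    obtain ⟨y'', hy'', h⟩ := (GpdHom.mem_preAct hπ f.injOn_s).1 (hAc ha')
    rw [hay', Option.some_inj] at h
    exact (hsmall c y hyc y' (h ▸ hy'')).1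
  · have hosc : ∀ A ∈ R.parts, ∀ y ∈ A, ∀ y' ∈ A, ‖k y - k y'‖ ≤ δ / 4 := by
      intro A hA y hy y' hy'
      obtain ⟨c, hc, hyc⟩ := hcov y
      have hAc : A ⊆ N c := (hRS A hA (Sum.inl (Sum.inl (Sum.inl ⟨c, hc⟩)))).resolve_right
        fun h => h.le_bot ⟨hy, hyc⟩
      exact (hsmall c y hyc y' (hAc hy')).2 k hk
    have h4 : ∑ A ∈ R.parts, |normCard d (z ⁻¹' A) - μ.real A| ≤ n * δ' := by
      rw [← nsmul_eq_mul]
      refine Finset.sum_le_card_nsmul _ _ _ fun A hA => ?_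
      exact (goodTuples_abs_sub_lt hπ hm hR hz
        (sigmaAlg_le_refinePartition hπ hin _ (measurableSet_sigmaAlg_of_mem hA))).le
    have h5 : ‖k‖ ≤ κ := Finset.single_le_sum (f := fun k : C(Y, ℂ) => ‖k‖)
      (fun k _ => norm_nonneg k) hk
    have h6 := norm_average_sub_integral_le (μ := μ) hR k (by positivity) hosc z
    have h7 : ‖k‖ * ∑ A ∈ R.parts, |normCard d (z ⁻¹' A) - μ.real A| ≤ κ * (n * δ') := by
      gcongr
    linarith
  · refine (goodTuples_abs_sub_lt hπ hm hR hz ?_).trans h3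
    refine sigmaAlg_le_refinePartition hπ hin _ (measurableSet_sigmaAlg_iff.2 fun A hA => ?_)
    exact hRS A hA (Sum.inr ())

end lower

theorem exists_pos_forall_le {ι : Type*} (s : Finset ι) {f : ι → ℝ} (hf : ∀ i ∈ s, 0 < f i) :
    ∃ η : ℝ, 0 < η ∧ ∀ i ∈ s, η ≤ f i := by
  classical
  induction s using Finset.induction_on with
  | empty => exact ⟨1, one_pos, by simp⟩
  | insert i s _ ih =>
    obtain ⟨η, hη, h⟩ := ih fun j hj => hf j (Finset.mem_insert_of_mem hj)
    refine ⟨min η (f i), lt_min hη (hf i (Finset.mem_insert_self i s)), fun j hj => ?_⟩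
    rcases Finset.mem_insert.1 hj with rfl | hj
    · exact min_le_right _ _
    · exact (min_le_left _ _).trans (h j hj)

theorem exists_pos_of_tendsto_zero {f : ℝ → ℝ} (hf : Continuous f) (h0 : f 0 = 0) {c : ℝ}
    (hc : 0 < c) : ∃ t > 0, f t < c := by
  have hev : ∀ᶠ t in 𝓝 (0 : ℝ), f t < c :=
    hf.continuousAt.eventually_lt continuousAt_const (by rwa [h0])
  obtain ⟨t, ht, hlt⟩ := (hev.filter_mono nhdsWithin_le_nhds |>.and
    (self_mem_nhdsWithin : Ioi (0 : ℝ) ∈ 𝓝[>] 0)).exists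
  exact ⟨t, hlt, ht⟩

/-! ### Approximate orbits close to a common tuple -/

section orb

variable {Y G X H : Type*} [MeasurableSpace Y] [MeasurableSpace G] [StandardBorelSpace G]
  [MeasurableSpace X] [MeasurableSpace H] [StandardBorelSpace H] [TopologicalSpace Y]
  {𝓖 : MGpd Y G} {𝓗 : MGpd X H} {π : GpdHom 𝓖.toGpd 𝓗.toGpd} {μ : Measure Y}

theorem orb_mono {ρ : Y → Y → ℝ} {d : ℕ} {F F' : Finset (PartialAut 𝓗)} {K K' : Finset C(Y, ℂ)}
    {δ δ' : ℝ} {σ : SoficMap 𝓗 d} (hF : F ⊆ F') (hK : K ⊆ K') (hδ : δ' ≤ δ) :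
    orb μ π ρ F' K' δ' σ ⊆ orb μ π ρ F K δ σ :=
  fun _ hx => ⟨fun f hf => (hx.1 f (hF hf)).trans_le hδ, fun k hk => (hx.2 k (hK hk)).trans_le hδ⟩

variable [CompactSpace Y]

/-- Two approximate orbits that are close to a third tuple are translated almost equally. -/
theorem normCard_translate_le {ρ : PseudoMetric Y ℝ} (hρ : Continuous fun q : Y × Y => ρ q.1 q.2)
    {d : ℕ} {F : Finset (PartialAut 𝓗)} {K : Finset C(Y, ℂ)} {ε η : ℝ} (hη : 0 < η)
    {σ : SoficMap 𝓗 d} {z z' s : Fin d → Y} (hz : z ∈ orb μ π ρ F K ε σ)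
    (hz' : z' ∈ orb μ π ρ F K ε σ) (h : dist₂ ρ z s ≤ ε) (h' : dist₂ ρ z' s ≤ ε)
    {f : PartialAut 𝓗} (hf : f ∈ F) :
    normCard d {i | 4 * η ≤ extDist ρ (π.actPt f.1 (z i)) (π.actPt f.1 (z' i))}
      ≤ 4 * (ε ^ 2 / η ^ 2) := by
  -- Four exceptional sets: `z` or `z'` fails to follow `f` at `i`, or is far from `s` at `σ(f) i`.
  -- The last two are small because `σ(f)` is injective. Off all four the triangle inequality gives
  -- less than `η + 2η + η = 4η`.
  set B₁ := {i | η ≤ extDist ρ (π.actPt f.1 (z i)) (((σ f).actPt i).map z)}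
  set B₂ := {i | η ≤ extDist ρ (π.actPt f.1 (z' i)) (((σ f).actPt i).map z')}
  set B₃ := {i | ∃ k ∈ {k | η ≤ ρ (z k) (s k)}, (k, i) ∈ (σ f).1}
  set B₄ := {i | ∃ k ∈ {k | η ≤ ρ (z' k) (s k)}, (k, i) ∈ (σ f).1}
  have h1 : normCard d B₁ ≤ ε ^ 2 / η ^ 2 := normCard_le_of_dist₂_le hη (hz.1 f hf).le
  have h2 : normCard d B₂ ≤ ε ^ 2 / η ^ 2 := normCard_le_of_dist₂_le hη (hz'.1 f hf).le
  have h3 : normCard d B₃ ≤ ε ^ 2 / η ^ 2 :=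
    ((σ f).normCard_preimage_le _).trans (normCard_le_of_dist₂_le hη h)
  have h4 : normCard d B₄ ≤ ε ^ 2 / η ^ 2 :=
    ((σ f).normCard_preimage_le _).trans (normCard_le_of_dist₂_le hη h')
  have hsub : {i | 4 * η ≤ extDist ρ (π.actPt f.1 (z i)) (π.actPt f.1 (z' i))}
      ⊆ (B₁ ∪ B₂) ∪ (B₃ ∪ B₄) := by
    intro i hi
    by_contra hcon
    simp only [mem_union, not_or] at hcon
    obtain ⟨⟨hB₁, hB₂⟩, hB₃, hB₄⟩ := hcon
    have e1 : extDist ρ (π.actPt f.1 (z i)) (((σ f).actPt i).map z) < η := not_le.1 hB₁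
    have e2 : extDist ρ (π.actPt f.1 (z' i)) (((σ f).actPt i).map z') < η := not_le.1 hB₂
    rw [extDist_comm] at e2
    have e3 : extDist ρ (((σ f).actPt i).map z) (((σ f).actPt i).map z') < 2 * η := by
      rcases hk : (σ f).actPt i with - | k
      · change (0 : ℝ) < _
        positivity
      · have hki := (σ f).actPt_eq_some.1 hk
        have a1 : ρ (z k) (s k) < η := not_le.1 fun h => hB₃ ⟨k, h, hki⟩
        have a2 : ρ (z' k) (s k) < η := not_le.1 fun h => hB₄ ⟨k, h, hki⟩
        have a3 := ρ.triangle' (z k) (s k) (z' k)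
        rw [ρ.symm' (s k)] at a3
        change ρ.toFun (z k) (z' k) < _
        change ρ.toFun (z k) (s k) < η at a1
        change ρ.toFun (z' k) (s k) < η at a2
        linarith
    have t1 := extDist_triangle hρ (π.actPt f.1 (z i)) (((σ f).actPt i).map z)
      (π.actPt f.1 (z' i))
    have t2 := extDist_triangle hρ (((σ f).actPt i).map z) (((σ f).actPt i).map z')
      (π.actPt f.1 (z' i))
    have hi' : 4 * η ≤ extDist ρ (π.actPt f.1 (z i)) (π.actPt f.1 (z' i)) := hi
    linarith
  have := normCard_mono (d := d) hsub
  have u1 := normCard_union_le (d := d) (B₁ ∪ B₂) (B₃ ∪ B₄)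
  have u2 := normCard_union_le (d := d) B₁ B₂
  have u3 := normCard_union_le (d := d) B₃ B₄
  linarith

end orb

/-! ### Names of good tuples against separated orbits -/

section lower

variable {Y G X H : Type*}
  [TopologicalSpace Y] [CompactSpace Y] [TopologicalSpace.MetrizableSpace Y]
  [MeasurableSpace Y] [BorelSpace Y]
  [TopologicalSpace X] [MeasurableSpace X]
  [TopologicalSpace G] [MeasurableSpace G] [StandardBorelSpace G]
  [TopologicalSpace H] [MeasurableSpace H] [BorelSpace H] [StandardBorelSpace H]
  {𝓖 : MGpd Y G} {𝓗 : MGpd X H} {π : GpdHom 𝓖.toGpd 𝓗.toGpd} {μ : Measure Y}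

/-- Choose compact subsets exhausting most of each atom. Uniform separation of each one from the
union of the others uses finitely many translations and one positive threshold, and `C` is the union
of the compact sets. -/
theorem exists_compact_separation (h𝓖 : 𝓖.IsTopological) (he : 𝓖.IsEtale)
    (hμ : IsProbabilityMeasure μ)
    (hπ : Continuous π.arr) (hbij : π.IsClassBijective) {ρ : Y → Y → ℝ}
    (hρ : Continuous fun q : Y × Y => ρ q.1 q.2) (hgen : IsDynamicallyGenerating π ρ)
    {Q : Finpartition (univ : Set Y)} (hQ : IsBorelPartition Q) {θ : ℝ} (hθ : 0 < θ) :
    ∃ C : Set Y, MeasurableSet C ∧ 1 - θ ≤ μ.real C ∧ ∃ (F : Finset (PartialAut 𝓗)) (η : ℝ),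
      0 < η ∧ ∀ y ∈ C, ∀ z ∈ C,
        (∀ f ∈ F, extDist ρ (π.actPt f.1 y) (π.actPt f.1 z) < η) →
        ∀ A ∈ Q.parts, y ∈ A → z ∈ A := by
  classical
  -- The `+ 1` keeps the denominator positive without discussing the number of atoms.
  set n : ℝ := (Q.parts.card : ℝ) + 1
  have hn : 0 < n := by positivity
  have h1 : ∀ A ∈ Q.parts, ∃ K ⊆ A, IsCompact K ∧ μ (A \ K) < ENNReal.ofReal (θ / n) :=
    fun A hA => (hQ A hA).exists_isCompact_sdiff_lt (measure_ne_top _ _)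
      (by simp only [ne_eq, ENNReal.ofReal_eq_zero, not_le]; positivity)
  choose! K hKA hK hKμ using h1
  have hKm : ∀ A ∈ Q.parts, MeasurableSet (K A) := fun A hA => (hK A hA).isClosed.measurableSet
  set C := ⋃ A ∈ Q.parts, K A
  have hCm : MeasurableSet C := Finset.measurableSet_biUnion _ hKm
  have hC : 1 - θ ≤ μ.real C := by
    have hsub : Cᶜ ⊆ ⋃ A ∈ Q.parts, A \ K A := by
      intro y hy
      obtain ⟨A, hA, hyA⟩ := exists_mem_parts Q y
      exact mem_iUnion₂.2 ⟨A, hA, hyA, fun h => hy (mem_iUnion₂.2 ⟨A, hA, h⟩)⟩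
    have h2 : μ.real Cᶜ ≤ ∑ A ∈ Q.parts, μ.real (A \ K A) :=
      (measureReal_mono hsub (measure_ne_top _ _)).trans (measureReal_biUnion_finset_le _ _)
    have h3 : ∑ A ∈ Q.parts, μ.real (A \ K A) ≤ Q.parts.card • (θ / n) :=
      Finset.sum_le_card_nsmul _ _ _ fun A hA =>
        ENNReal.toReal_le_of_le_ofReal (by positivity) (hKμ A hA).le
    rw [probReal_compl_eq_one_sub hCm] at h2
    have h4 : Q.parts.card • (θ / n) ≤ θ := by
      rw [nsmul_eq_mul, mul_div_assoc', div_le_iff₀ hn]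
      nlinarith
    linarith
  have h5 : ∀ A ∈ Q.parts, ∃ (F : Finset (PartialAut 𝓗)) (η : ℝ),
      (∀ f ∈ F, f.1 ∈ 𝓗.topFullGroup) ∧ 0 < η ∧ ∀ y ∈ K A, ∀ z,
        (∀ f ∈ F, extDist ρ (π.actPt f.1 y) (π.actPt f.1 z) < η) →
          z ∈ (⋃ B ∈ Q.parts.erase A, K B)ᶜ := fun A hA => by
    refine hgen.exists_finset h𝓖 he hπ hbij hρ (hK A hA) ?_ ?_
    · rw [isOpen_compl_iff]
      exact isClosed_biUnion_finset fun B hB => (hK B (Finset.mem_of_mem_erase hB)).isClosed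
    · intro y hy h
      obtain ⟨B, hB, hyB⟩ := mem_iUnion₂.1 h
      rw [Finset.mem_erase] at hB
      exact hB.1 (eq_of_mem_parts Q hB.2 hA (hKA B hB.2 hyB) (hKA A hA hy))
  choose! F η _ hη hFη using h5
  obtain ⟨η₀, hη₀, hle⟩ := exists_pos_forall_le Q.parts hη
  refine ⟨C, hCm, hC, Q.parts.biUnion F, η₀, hη₀, fun y hy z hz hclose A hA hyA => ?_⟩
  obtain ⟨A', hA', hyA'⟩ := mem_iUnion₂.1 hy
  obtain ⟨B, hB, hzB⟩ := mem_iUnion₂.1 hz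
  obtain rfl := eq_of_mem_parts Q hA hA' hyA (hKA A' hA' hyA')
  have h6 := hFη A hA y hyA' z fun f hf =>
    (hclose f (Finset.mem_biUnion.2 ⟨A, hA, hf⟩)).trans_le (hle A hA)
  by_cases hBA : B = A
  · exact hBA ▸ hKA B hB hzB
  · exact absurd (mem_iUnion₂.2 ⟨B, Finset.mem_erase.2 ⟨hBA, hB⟩, hzB⟩) h6

/-- Tuples that are `ρ₂`-close to a common orbit are moved almost alike by the separating
translations `F₀`, hence lie in the same atoms of `Q` at most indices. It matters that `ε` depends
only on `Q` and `κ`, since in the entropy the supremum over `ε` stands outside the infima over `δ`,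
`F`, `K`. -/
theorem exists_goodHomCount_le [BorelSpace G] (h𝓖 : 𝓖.IsTopological) (he : 𝓖.IsEtale) (hμ : 𝓖.IsPMP μ)
    (hπ : Continuous π.arr) (hbij : π.IsClassBijective) {ρ : PseudoMetric Y ℝ}
    (hρ : Continuous fun q : Y × Y => ρ q.1 q.2) (hgen : IsDynamicallyGenerating π ρ)
    {Q : Finpartition (univ : Set Y)} (hQ : IsBorelPartition Q) {κ : ℝ} (hκ : 0 < κ) :
    ∃ ε > 0, ∀ (δ : ℝ), 0 < δ → ∀ (F : Finset (PartialAut 𝓗)) (K : Finset C(Y, ℂ)),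
      ∃ R ≤ Q, IsBorelPartition R ∧ ∃ F' : Finset (PartialAut 𝓗), 1 ∈ F' ∧ ∃ δ' > 0,
        ∀ (d : ℕ) (σ : SoficMap 𝓗 d), 0 < d → (goodHomCount μ π Q R F' δ' σ : ℝ≥0∞)
          ≤ ENNReal.ofReal (Real.exp (κ * d))
            * (sepNumber (dist₂ ρ) ε (orb μ π ρ F K δ σ) : ℝ≥0∞) := by
  classical
  have := hμ.1
  have hm : Measurable π.arr := hπ.measurable
  obtain ⟨θ, hθ, hball⟩ := exists_hamming_radius Q.parts hκ
  -- The measure of `C` and its visit frequency each lose `θ/8`, so a tuple leaves `C` at a fraction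
  -- at most `θ/4` of the indices; two tuples use `θ/2`.
  obtain ⟨C, hC, hCμ, F₀, η, hη, hsep⟩ := exists_compact_separation h𝓖 he hμ.1 hπ hbij hρ hgen hQ
    (θ := θ / 8) (by positivity)
  set n : ℝ := (F₀.card : ℝ)
  -- The other `θ/2` pays for indices where some translation separates the tuples; `η / 4` matches
  -- the `4 * η` of `normCard_translate_le`.
  obtain ⟨ε, hε, hεθ⟩ := exists_pos_of_tendsto_zero
    (f := fun ε => n * (4 * (ε ^ 2 / (η / 4) ^ 2))) (by fun_prop) (by simp)
    (c := θ / 2) (by positivity)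
  refine ⟨ε, hε, fun δ hδ F K => ?_⟩
  obtain ⟨R, hRQ, hR, F', hF', δ', hδ', hgood⟩ := exists_goodTuples_subset_orb hμ hbij hm hρ hQ hC
    (F ∪ F₀) K (δ := min δ ε) (lt_min hδ hε) (θ := θ / 8) (by positivity)
  refine ⟨R, hRQ, hR, F', hF', δ', hδ', fun d σ hd => ?_⟩
  rw [goodHomCount_eq hbij hRQ hF']
  choose pt hpt hmem using exists_mem_parts Q
  let name : (Fin d → Y) → Fin d → Q.parts := fun z i => ⟨pt (z i), hpt (z i)⟩
  have := nonempty_of_isProbabilityMeasure μ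
  choose! rep hrep using fun (A : Set Y) (hA : A ∈ Q.parts) => nonempty_of_mem_parts Q hA
  -- The restriction to `Σ(Q)` depends only on the word of atoms visited, so words over the finite
  -- alphabet `Q.parts` can be counted instead.
  have himg : pointHom Q '' goodTuples μ π σ R F' δ'
      = (fun n : Fin d → Q.parts => pointHom Q fun i => rep (n i).1) ''
        (name '' goodTuples μ π σ R F' δ') := by
    rw [image_image]
    refine image_congr fun z _ => pointHom_eq_iff.2 fun i A hA => ?_
    constructor
    · intro h
      rw [eq_of_mem_parts Q hA (hpt (z i)) h (hmem (z i))]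
      exact hrep _ (hpt (z i))
    · intro h
      rw [eq_of_mem_parts Q hA (hpt (z i)) h (hrep _ (hpt (z i)))]
      exact hmem (z i)
  have hle : (pointHom Q '' goodTuples μ π σ R F' δ').encard
      ≤ (name '' goodTuples μ π σ R F' δ').encard := by
    rw [himg]
    exact encard_image_le _ _
  refine (ENat.toENNReal_le.2 hle).trans ?_
  have hsubset : ∀ z ∈ goodTuples μ π σ R F' δ', z ∈ orb μ π ρ (F ∪ F₀) K (min δ ε) σ :=
    fun z hz => (hgood d σ z hz).1
  refine encard_image_names_le (hball d) (D := dist₂ ρ) ?_ ?_ (fun z hz =>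
    orb_mono Finset.subset_union_left subset_rfl (min_le_left δ ε) (hsubset z hz)) ?_
  · intro a b
    simp only [dist₂]
    congr 3
    ext i
    exact congrArg (· ^ 2) (ρ.symm' _ _)
  · intro a
    have : dist₂ ρ a a = 0 := by
      simp only [dist₂]
      rw [Finset.sum_eq_zero, mul_zero, Real.sqrt_zero]
      intro i _
      change ρ.toFun _ _ ^ 2 = 0
      rw [ρ.refl']
      simp
    rw [this]
    exact hε.le
  · intro s _ z hz z' hz' hzs hzs'
    have horb := fun {z} (hz : z ∈ goodTuples μ π σ R F' δ') =>
      orb_mono (μ := μ) (π := π) (ρ := ρ) (σ := σ) (F := F₀) Finset.subset_union_right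
        (subset_refl K) (min_le_right δ ε) (hsubset z hz)
    have hCz : ∀ z ∈ goodTuples μ π σ R F' δ', normCard d (z ⁻¹' C)ᶜ ≤ θ / 4 := fun z hz => by
      rw [normCard_compl hd]
      have := (abs_lt.1 (hgood d σ z hz).2).1
      linarith
    have hsub : {i | name z i ≠ name z' i} ⊆ ((z ⁻¹' C)ᶜ ∪ (z' ⁻¹' C)ᶜ) ∪
        ⋃ f ∈ F₀, {i | 4 * (η / 4) ≤ extDist ρ (π.actPt f.1 (z i)) (π.actPt f.1 (z' i))} := by
      intro i hi
      by_contra hcon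
      simp only [mem_union, mem_compl_iff, not_or, not_not, mem_iUnion, not_exists] at hcon
      obtain ⟨⟨hzC, hzC'⟩, hfar⟩ := hcon
      refine hi (Subtype.ext ?_)
      have := hsep (z i) hzC (z' i) hzC' (fun f hf => by
        have : extDist ρ (π.actPt f.1 (z i)) (π.actPt f.1 (z' i)) < 4 * (η / 4) :=
          not_le.1 (hfar f hf)
        linarith) _ (hpt (z i)) (hmem (z i))
      exact eq_of_mem_parts Q (hpt (z i)) (hpt (z' i)) this (hmem (z' i))
    have h1 : normCard d (⋃ f ∈ F₀, {i | 4 * (η / 4)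
        ≤ extDist ρ (π.actPt f.1 (z i)) (π.actPt f.1 (z' i))})
        ≤ n * (4 * (ε ^ 2 / (η / 4) ^ 2)) := by
      refine (normCard_biUnion_le _ _).trans ?_
      rw [← nsmul_eq_mul]
      exact Finset.sum_le_card_nsmul _ _ _ fun f hf =>
        normCard_translate_le hρ (by positivity) (horb hz) (horb hz') hzs hzs' hf
    have h2 := normCard_mono (d := d) hsub
    have h3 := normCard_union_le (d := d) ((z ⁻¹' C)ᶜ ∪ (z' ⁻¹' C)ᶜ)
      (⋃ f ∈ F₀, {i | 4 * (η / 4) ≤ extDist ρ (π.actPt f.1 (z i)) (π.actPt f.1 (z' i))})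
    have h4 := normCard_union_le (d := d) (z ⁻¹' C)ᶜ (z' ⁻¹' C)ᶜ
    have h5 := hCz z hz
    have h6 := hCz z' hz'
    linarith

end lower

/-! ### Weak approximation, open neighbourhoods of atoms and null boundaries -/

section weak

variable {Y : Type*} [TopologicalSpace Y] [CompactSpace Y] [TopologicalSpace.MetrizableSpace Y]
  [MeasurableSpace Y] [BorelSpace Y]

/-- Weak closeness to `μ` bounds the density of visits to an open set from below. -/
theorem exists_test_function (μ : Measure Y) [IsProbabilityMeasure μ] {V : Set Y} (hV : IsOpen V)
    {e : ℝ} (he : 0 < e) :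
    ∃ k : C(Y, ℂ), ∀ (d : ℕ) (x : Fin d → Y),
      ‖(1 / (d : ℂ)) * ∑ i, k (x i) - ∫ y, k y ∂μ‖ < e →
        μ.real V - 2 * e ≤ normCard d (x ⁻¹' V) := by
  classical
  -- One `e` is lost in passing to the compact set `Z`, the other in the average; a Urysohn function
  -- between `Z` and `V` serves as the test function.
  obtain ⟨Z, hZV, hZ, hZμ⟩ := hV.measurableSet.exists_isCompact_sdiff_lt (μ := μ)
    (measure_ne_top _ _) (ε := ENNReal.ofReal e) (by simpa using he)
  obtain ⟨g, hg0, hg1, hg⟩ := exists_continuous_zero_one_of_isClosed hV.isClosed_compl hZ.isClosed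
    (disjoint_compl_left_iff_subset.2 hZV)
  let k : C(Y, ℂ) := ⟨fun y => (g y : ℂ), Complex.continuous_ofReal.comp g.continuous⟩
  refine ⟨k, fun d x hx => ?_⟩
  have h1 : (1 / (d : ℂ)) * ∑ i, k (x i) - ∫ y, k y ∂μ
      = (((1 / (d : ℝ)) * ∑ i, g (x i) - ∫ y, g y ∂μ : ℝ) : ℂ) := by
    have : ∫ y, k y ∂μ = ((∫ y, g y ∂μ : ℝ) : ℂ) := integral_ofReal
    rw [this]
    push_cast
    rfl
  rw [h1, Complex.norm_real, Real.norm_eq_abs] at hx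
  have h2 := (abs_lt.1 hx).1
  have h3 : (1 / (d : ℝ)) * ∑ i, g (x i) ≤ normCard d (x ⁻¹' V) := by
    rw [show x ⁻¹' V = {i | x i ∈ V} from rfl, normCard_setOf_eq]
    gcongr with i _
    split_ifs with h
    · exact (hg _).2
    · exact (hg0 h).le
  have h4 : μ.real Z ≤ ∫ y, g y ∂μ := by
    rw [← integral_indicator_one hZ.isClosed.measurableSet]
    refine integral_mono ?_ ?_ fun y => ?_
    · exact (integrable_const (1 : ℝ)).indicator hZ.isClosed.measurableSet
    · exact g.continuous.integrable_of_hasCompactSupport (HasCompactSupport.of_compactSpace g)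
    · by_cases hy : y ∈ Z
      · rw [indicator_of_mem hy, hg1 hy]
      · rw [indicator_of_notMem hy]
        exact (hg y).1
  have h5 : μ.real V - e ≤ μ.real Z := by
    have h6 := measureReal_sdiff (μ := μ) hZV hZ.isClosed.measurableSet
    have h7 : μ.real (V \ Z) ≤ e := ENNReal.toReal_le_of_le_ofReal he.le hZμ.le
    linarith
  linarith

/-- Approximation of a finite partition by open sets, respecting a coarser partition with null
boundaries. -/
theorem exists_label (μ : Measure Y) [IsProbabilityMeasure μ] {P Q : Finpartition (univ : Set Y)}
    (hP : IsBorelPartition P) (hPQ : P ≤ Q) (hQ : ∀ q ∈ Q.parts, μ (frontier q) = 0) {e : ℝ}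
    (he : 0 < e) :
    ∃ (C : Set Y) (O U : Set Y → Set Y) (L : Y → Y), MeasurableSet C ∧ 1 - e ≤ μ.real C ∧
      (∀ A ∈ P.parts, IsOpen (O A) ∧ IsOpen (U A) ∧ closure (O A) ⊆ U A ∧ C ∩ A ⊆ O A ∧
        ∀ y ∈ U A, L y ∈ A) ∧ ∀ q ∈ Q.parts, ∀ y ∈ q, L y ∈ q := by
  classical
  have hne := nonempty_of_isProbabilityMeasure μ
  have h0 : ∀ A ∈ P.parts, ∃ q ∈ Q.parts, A ⊆ q := fun A hA => hPQ hA
  choose! q hq hAq using h0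
  set n : ℝ := (P.parts.card : ℝ) + 1
  have hn : 0 < n := by positivity
  -- Working inside the interior of the coarser atom `q A` loses no measure, because its frontier is
  -- null, and it leaves room for a neighbourhood that stays in `q A`.
  have h1 : ∀ A ∈ P.parts, ∃ K ⊆ A ∩ interior (q A), IsCompact K ∧
      μ ((A ∩ interior (q A)) \ K) < ENNReal.ofReal (e / n) := fun A hA =>
    ((hP A hA).inter isOpen_interior.measurableSet).exists_isCompact_sdiff_lt (measure_ne_top _ _)
      (by simp only [ne_eq, ENNReal.ofReal_eq_zero, not_le]; positivity)
  choose! K hKA hK hKμ using h1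
  set C := ⋃ A ∈ P.parts, K A
  have hCm : MeasurableSet C :=
    Finset.measurableSet_biUnion _ fun A hA => (hK A hA).isClosed.measurableSet
  have hC : 1 - e ≤ μ.real C := by
    have hsub : Cᶜ ⊆ (⋃ A ∈ P.parts, (A ∩ interior (q A)) \ K A) ∪ ⋃ q ∈ Q.parts, frontier q := by
      intro y hy
      obtain ⟨A, hA, hyA⟩ := exists_mem_parts P y
      by_cases hi : y ∈ interior (q A)
      · exact Or.inl (mem_iUnion₂.2 ⟨A, hA, ⟨hyA, hi⟩, fun h => hy (mem_iUnion₂.2 ⟨A, hA, h⟩)⟩)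
      · exact Or.inr (mem_iUnion₂.2 ⟨q A, hq A hA, subset_closure (hAq A hA hyA), hi⟩)
    have hz : μ.real (⋃ q ∈ Q.parts, frontier q) = 0 := by
      have h0 : μ (⋃ q ∈ Q.parts, frontier q) = 0 :=
        (measure_biUnion_null_iff Q.parts.countable_toSet).2 hQ
      rw [measureReal_def, h0]
      rfl
    have h2 : μ.real Cᶜ ≤ ∑ A ∈ P.parts, μ.real ((A ∩ interior (q A)) \ K A) := by
      refine (measureReal_mono hsub (measure_ne_top _ _)).trans ((measureReal_union_le _ _).trans ?_)
      rw [hz, add_zero]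
      exact measureReal_biUnion_finset_le _ _
    have h3 : ∑ A ∈ P.parts, μ.real ((A ∩ interior (q A)) \ K A) ≤ P.parts.card • (e / n) :=
      Finset.sum_le_card_nsmul _ _ _ fun A hA =>
        ENNReal.toReal_le_of_le_ofReal (by positivity) (hKμ A hA).le
    rw [probReal_compl_eq_one_sub hCm] at h2
    have h4 : P.parts.card • (e / n) ≤ e := by
      rw [nsmul_eq_mul, mul_div_assoc', div_le_iff₀ hn]
      nlinarith
    linarith
  obtain ⟨U₀, hU₀, hKU₀, hUd⟩ := exists_disjoint_open_nhds (K := fun A : P.parts => K A.1)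
    (fun A => (hK A.1 A.2).isClosed) fun A B hAB =>
      (P.disjoint A.2 B.2 fun h => hAB (Subtype.ext h)).mono
        ((hKA A.1 A.2).trans inter_subset_left) ((hKA B.1 B.2).trans inter_subset_left)
  let U : Set Y → Set Y := fun A => if h : A ∈ P.parts then U₀ ⟨A, h⟩ ∩ interior (q A) else ∅
  have hUeq : ∀ A (hA : A ∈ P.parts), U A = U₀ ⟨A, hA⟩ ∩ interior (q A) := fun A hA => dif_pos hA
  have hUo : ∀ A ∈ P.parts, IsOpen (U A) := fun A hA => by
    rw [hUeq A hA]
    exact (hU₀ _).inter isOpen_interior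
  have hUd' : ∀ A ∈ P.parts, ∀ B ∈ P.parts, ∀ y, y ∈ U A → y ∈ U B → A = B := by
    intro A hA B hB y hyA hyB
    rw [hUeq A hA] at hyA
    rw [hUeq B hB] at hyB
    by_contra hAB
    exact (hUd (i := ⟨A, hA⟩) (j := ⟨B, hB⟩) fun h => hAB (congrArg Subtype.val h)).le_bot
      ⟨hyA.1, hyB.1⟩
  have hO : ∀ A ∈ P.parts, ∃ O, IsOpen O ∧ K A ⊆ O ∧ closure O ⊆ U A := fun A hA => by
    refine normal_exists_closure_subset (hK A hA).isClosed (hUo A hA) fun y hy => ?_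
    rw [hUeq A hA]
    exact ⟨hKU₀ ⟨A, hA⟩ hy, (hKA A hA hy).2⟩
  choose! O hOo hKO hOU using hO
  choose! pt hpt using fun A (hA : A ∈ P.parts) => nonempty_of_mem_parts P hA
  -- `L` sends the neighbourhood of an atom to a point of that atom and fixes all other points;
  -- since `U A ⊆ q A`, it preserves the atoms of `Q` in both cases.
  let L : Y → Y := fun y => if h : ∃ A ∈ P.parts, y ∈ U A then pt h.choose else y
  have hLU : ∀ A ∈ P.parts, ∀ y ∈ U A, L y ∈ A := fun A hA y hy => by
    have h : ∃ A ∈ P.parts, y ∈ U A := ⟨A, hA, hy⟩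
    have hL : L y = pt h.choose := dif_pos h
    rw [hL, hUd' A hA _ h.choose_spec.1 y hy h.choose_spec.2]
    exact hpt _ h.choose_spec.1
  refine ⟨C, O, U, L, hCm, hC, fun A hA => ⟨hOo A hA, hUo A hA, hOU A hA, ?_, hLU A hA⟩, ?_⟩
  · rintro y ⟨hyC, hyA⟩
    obtain ⟨B, hB, hyB⟩ := mem_iUnion₂.1 hyC
    obtain rfl := eq_of_mem_parts P hA hB hyA (hKA B hB hyB).1
    exact hKO A hA hyB
  · intro q' hq' y hy
    by_cases h : ∃ A ∈ P.parts, y ∈ U A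
    · obtain ⟨A, hA, hyA⟩ := h
      have h1 := hLU A hA y hyA
      rw [hUeq A hA] at hyA
      rw [eq_of_mem_parts Q hq' (hq A hA) hy (interior_subset hyA.2)]
      exact hAq A hA h1
    · have hL : L y = y := dif_neg h
      rwa [hL]

/-- For each centre only countably many spheres of `ρ` have positive measure, so radii below `ε/2`
with null spheres exist. Finitely many such balls cover, and the partition they generate has
boundaries inside the spheres. -/
theorem exists_small_partition (μ : Measure Y) [IsProbabilityMeasure μ] {ρ : PseudoMetric Y ℝ}
    (hρ : Continuous fun q : Y × Y => ρ q.1 q.2) {ε : ℝ} (hε : 0 < ε) :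
    ∃ Q : Finpartition (univ : Set Y), IsBorelPartition Q ∧
      ∀ q ∈ Q.parts, μ (frontier q) = 0 ∧ ∀ y ∈ q, ∀ y' ∈ q, ρ y y' ≤ ε := by
  classical
  have hc : ∀ c, Continuous fun y => ρ c y := fun c => hρ.comp (Continuous.prodMk_right c)
  have h1 : ∀ c : Y, ∃ t ∈ Ioo 0 (ε / 2), μ {y | ρ c y = t} = 0 := by
    intro c
    by_contra! hcon
    have hcount := Measure.countable_meas_level_set_pos (μ := μ) (hc c).measurable
    refine absurd (Cardinal.Real.Ioo_countable_iff.1 (hcount.mono fun t ht => ?_))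
      (not_le.2 (half_pos hε))
    exact pos_iff_ne_zero.2 (hcon t ht)
  choose r hr hrμ using h1
  let D : Y → Set Y := fun c => {y | ρ c y < r c}
  have hD : ∀ c, IsOpen (D c) := fun c => isOpen_lt (hc c) continuous_const
  obtain ⟨t, ht⟩ := isCompact_univ.elim_finite_subcover D hD fun y _ => mem_iUnion.2 ⟨y, by
    change ρ.toFun y y < r y
    rw [ρ.refl']
    exact (hr y).1⟩
  let S : t → Set Y := fun c => D c
  refine ⟨familyPartition S, isBorelPartition_familyPartition fun c => (hD c).measurableSet,
    fun q hq => ⟨?_, fun y hy y' hy' => ?_⟩⟩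
  · obtain ⟨y₀, rfl⟩ := mem_familyPartition_parts.1 hq
    -- Off the spheres, membership in each of the finitely many balls is locally constant.
    have hnhd : ∀ y, (∀ c ∈ t, ρ c y ≠ r c) → ∀ᶠ z in 𝓝 y, ∀ c : t, z ∈ S c ↔ y ∈ S c := by
      intro y hy
      rw [eventually_all]
      intro c
      rcases lt_or_gt_of_ne (hy c c.2) with h | h
      · filter_upwards [(hD c).mem_nhds h] with z hz
        exact ⟨fun _ => h, fun _ => hz⟩
      · filter_upwards [(isOpen_lt continuous_const (hc c)).mem_nhds h] with z hz
        exact ⟨fun h' => absurd h' (not_lt.2 (le_of_lt hz)),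
          fun h' => absurd h' (not_lt.2 (le_of_lt h))⟩
    have hsub : frontier {z | ∀ c : t, z ∈ S c ↔ y₀ ∈ S c} ⊆ ⋃ c ∈ t, {y | ρ c y = r c} := by
      intro y hy
      by_contra hcon
      simp only [mem_iUnion, not_exists] at hcon
      have hev := hnhd y hcon
      rw [frontier_eq_closure_inter_closure, mem_inter_iff, mem_closure_iff_frequently,
        mem_closure_iff_frequently] at hy
      obtain ⟨z, hz, hzy⟩ := (hy.1.and_eventually hev).exists
      obtain ⟨z', hz', hzy'⟩ := (hy.2.and_eventually hev).exists
      exact hz' fun c => (hzy' c).trans ((hzy c).symm.trans (hz c))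
    refine measure_mono_null hsub ((measure_biUnion_null_iff t.countable_toSet).2 fun c _ => hrμ c)
  · obtain ⟨c, hct, hyc⟩ := mem_iUnion₂.1 (ht (mem_univ y))
    have hqc : q ⊆ S ⟨c, hct⟩ := (subset_or_disjoint_of_familyPartition hq _).resolve_right
      fun h => h.le_bot ⟨hy, hyc⟩
    have a1 : ρ.toFun c y < r c := hqc hy
    have a2 : ρ.toFun c y' < r c := hqc hy'
    have a3 := ρ.triangle' y c y'
    rw [ρ.symm' y c] at a3
    have a4 := (hr c).2
    change ρ.toFun y y' ≤ ε
    linarith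

end weak

/-! ### Following an open approximation of a partial automorphism -/

section follow

variable {Y G X H : Type*} [MeasurableSpace Y] [MeasurableSpace G] [StandardBorelSpace G]
  [MeasurableSpace X] [MeasurableSpace H] [StandardBorelSpace H]
  {𝓖 : MGpd Y G} {𝓗 : MGpd X H} {π : GpdHom 𝓖.toGpd 𝓗.toGpd} {μ : Measure Y} {ν : Measure X}

/-- The closure adds only the null frontiers of the finitely many pieces. The complement of the
closed domain can therefore serve as an open test set at no cost in measure. -/
theorem measure_closure_source [TopologicalSpace X] [TopologicalSpace H] {f : PartialAut 𝓗}
    (hf : f ∈ topPartialAut 𝓗 ν) : ν (closure (𝓗.s '' f.1)) = ν (𝓗.s '' f.1) := by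
  obtain ⟨n, fi, hfi, -, hs, -⟩ := hf
  refine le_antisymm ?_ (measure_mono subset_closure)
  have hsub : closure (𝓗.s '' f.1) ⊆ 𝓗.s '' f.1 ∪ ⋃ i, frontier (𝓗.s '' fi i) := by
    rw [hfi, image_iUnion, closure_iUnion_of_finite]
    refine iUnion_subset fun i => ?_
    rw [closure_eq_self_union_frontier]
    exact union_subset_union (subset_iUnion (fun i => 𝓗.s '' fi i) i)
      (subset_iUnion (fun i => frontier (𝓗.s '' fi i)) i)
  refine (measure_mono hsub).trans ((measure_union_le _ _).trans ?_)
  rw [measure_iUnion_null fun i => (hs i).2, add_zero]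

theorem measure_source_diff_le [IsFiniteMeasure ν] (f f' : PartialAut 𝓗) {e : ℝ} (he : 0 ≤ e)
    (h : 𝓗.sourceMass ν (f.1 ∆ f'.1) < ENNReal.ofReal e) :
    ν.real (𝓗.s '' (f.1 \ f'.1)) ≤ e ∧ ν.real (𝓗.s '' (f'.1 \ f.1)) ≤ e := by
  constructor
  · refine ENNReal.toReal_le_of_le_ofReal he (le_trans ?_ h.le)
    rw [← 𝓗.sourceMass_eq ν (f.measurableSet.diff f'.measurableSet)
      (f.injOn_s.mono sdiff_subset)]
    exact sourceMass_mono _ _ subset_union_left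
  · refine ENNReal.toReal_le_of_le_ofReal he (le_trans ?_ h.le)
    rw [← 𝓗.sourceMass_eq ν (f'.measurableSet.diff f.measurableSet)
      (f'.injOn_s.mono sdiff_subset)]
    exact sourceMass_mono _ _ subset_union_right

theorem measure_closure_source_le [TopologicalSpace X] [TopologicalSpace H] [IsFiniteMeasure ν]
    {f f' : PartialAut 𝓗} (hf' : f' ∈ topPartialAut 𝓗 ν) {e : ℝ} (he : 0 ≤ e)
    (h : 𝓗.sourceMass ν (f.1 ∆ f'.1) < ENNReal.ofReal e) :
    ν.real (closure (𝓗.s '' f'.1)) ≤ ν.real (𝓗.s '' f.1) + e := by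
  rw [measureReal_def, measure_closure_source hf', ← measureReal_def]
  have hsub : 𝓗.s '' f'.1 ⊆ 𝓗.s '' f.1 ∪ 𝓗.s '' (f'.1 \ f.1) := by
    rw [← image_union, union_sdiff_self]
    exact image_mono subset_union_right
  exact (measureReal_mono hsub (measure_ne_top _ _)).trans ((measureReal_union_le _ _).trans
    (add_le_add le_rfl (measure_source_diff_le f f' he h).2))

/-- Most points of `A` are moved by `f'` into `f · A`, inside a large set `C`. -/
theorem measure_act_le [IsProbabilityMeasure μ] [IsProbabilityMeasure ν] (hμ : 𝓖.IsPMP μ)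
    (hπ : π.IsClassBijective) (hm : Measurable π.arr) (hobj : Measurable π.obj)
    (hmap : μ.map π.obj = ν) (f f' : PartialAut 𝓗) {e : ℝ}
    (he : 0 ≤ e) (h : 𝓗.sourceMass ν (f.1 ∆ f'.1) < ENNReal.ofReal e) {C : Set Y}
    (hC : MeasurableSet C) (hCe : 1 - e ≤ μ.real C) {A V : Set Y} (hA : MeasurableSet A)
    (hV : ∀ y ∈ A ∩ C, ∀ w ∈ π.act f.1 A ∩ C, π.actPt f'.1 y = some w → y ∈ V) :
    μ.real (π.act f.1 A) ≤ μ.real V + 3 * e := by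
  have hs : MeasurableSet (𝓗.s '' (f.1 \ f'.1)) :=
    𝓗.measurableSet_image 𝓗.measurable_s (f.measurableSet.diff f'.measurableSet)
      (f.injOn_s.mono sdiff_subset)
  have h1 : μ.real Cᶜ ≤ e := by
    rw [probReal_compl_eq_one_sub hC]
    linarith
  have h2 : μ.real (π.obj ⁻¹' (𝓗.s '' (f.1 \ f'.1))) ≤ e := by
    rw [← map_measureReal_apply hobj hs, hmap]
    exact (measure_source_diff_le f f' he h).1
  have h3 : μ.real (π.preAct f.1 Cᶜ) ≤ e := by
    refine le_trans (ENNReal.toReal_mono (measure_ne_top _ _) ?_) h1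
    have hE : MeasurableSet (π.arr ⁻¹' f.1 ∩ 𝓖.r ⁻¹' Cᶜ) :=
      (hm f.measurableSet).inter (𝓖.measurable_r hC.compl)
    rw [GpdHom.preAct, 𝓖.measure_image_eq hμ hE ((hπ.injOn_s f.injOn_s).mono inter_subset_left)
      ((hπ.injOn_r f.injOn_r).mono inter_subset_left)]
    exact measure_mono (image_subset_iff.2 inter_subset_right)
  -- A point of `A` in the domain of `f` but outside `V` lies outside `C`, or `f` and `f'` use
  -- different arrows there, or `f` moves it out of `C`; each case has measure at most `e`.
  have hsub : A ∩ π.obj ⁻¹' (𝓗.s '' f.1)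
      ⊆ V ∪ (Cᶜ ∪ (π.obj ⁻¹' (𝓗.s '' (f.1 \ f'.1)) ∪ π.preAct f.1 Cᶜ)) := by
    rintro y ⟨hyA, hyf⟩
    by_contra hcon
    simp only [mem_union, not_or, mem_compl_iff, not_not] at hcon
    obtain ⟨hyV, hyC, hyd, hyp⟩ := hcon
    obtain ⟨w, hw⟩ := Option.ne_none_iff_exists'.1 fun hn => (GpdHom.actPt_eq_none hπ).1 hn hyf
    obtain ⟨g, hg, rfl, rfl⟩ := (GpdHom.actPt_eq_some hπ f.injOn_s).1 hw
    have hgf' : π.arr g ∈ f'.1 := by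
      by_contra hgf'
      exact hyd ⟨π.arr g, ⟨hg, hgf'⟩, π.s_arr g⟩
    have hwC : 𝓖.r g ∈ C := by
      by_contra hwC
      exact hyp ((GpdHom.mem_preAct hπ f.injOn_s).2 ⟨_, hwC, hw⟩)
    exact hyV (hV _ ⟨hyA, hyC⟩ _ ⟨⟨g, hg, hyA, rfl⟩, hwC⟩
      ((GpdHom.actPt_eq_some hπ f'.injOn_s).2 ⟨g, hgf', rfl, rfl⟩))
  rw [measureReal_def, measure_act hμ hπ hm f hA, ← measureReal_def]
  have h4 := measureReal_mono (μ := μ) hsub (measure_ne_top _ _)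
  have u1 := measureReal_union_le (μ := μ) V
    (Cᶜ ∪ (π.obj ⁻¹' (𝓗.s '' (f.1 \ f'.1)) ∪ π.preAct f.1 Cᶜ))
  have u2 := measureReal_union_le (μ := μ) Cᶜ
    (π.obj ⁻¹' (𝓗.s '' (f.1 \ f'.1)) ∪ π.preAct f.1 Cᶜ)
  have u3 := measureReal_union_le (μ := μ) (π.obj ⁻¹' (𝓗.s '' (f.1 \ f'.1))) (π.preAct f.1 Cᶜ)
  linarith

theorem actPt_mul (hπ : π.IsClassBijective) {h f : PartialAut 𝓗} {y z w : Y}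
    (hf : π.actPt f.1 y = some z) (hh : π.actPt h.1 z = some w) :
    π.actPt (h * f).1 y = some w := by
  obtain ⟨a, ha, rfl, rfl⟩ := (GpdHom.actPt_eq_some hπ f.injOn_s).1 hf
  obtain ⟨b, hb, hba, rfl⟩ := (GpdHom.actPt_eq_some hπ h.injOn_s).1 hh
  refine (GpdHom.actPt_eq_some hπ (h * f).injOn_s).2 ⟨𝓖.comp b a hba, ?_, 𝓖.s_comp _ _ _,
    𝓖.r_comp _ _ _⟩
  rw [π.arr_comp]
  exact ⟨_, hb, _, ha, _, rfl⟩

variable [TopologicalSpace Y]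

/-- Apart from few indices, `σ f` is defined at `i` exactly if `f` is defined at `x i`, and then
`x (σ f i)` and `f (x i)` are not distinguished by finitely many translations. -/
theorem exists_small_exceptional_set [TopologicalSpace X] [TopologicalSpace H]
    (hπ : π.IsClassBijective) {ρ : PseudoMetric Y ℝ} {F E F₀ : Finset (PartialAut 𝓗)}
    {K : Finset C(Y, ℂ)} {δ η η' : ℝ} (hη : 0 < η) (hηρ : η ≤ pmDiam ρ) {f : PartialAut 𝓗}
    (hf : f ∈ F) (hfE : f ∈ E) (hF₀ : ∀ h ∈ F₀, h.1 ∈ 𝓗.topFullGroup) (hF₀F : F₀ ⊆ F)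
    (hF₀E : F₀ ⊆ E) (hmul : ∀ h ∈ F₀, h * f ∈ F) {d : ℕ} {σ : SoficMap 𝓗 d}
    (hσ : IsMultiplicative E η' σ) {x : Fin d → Y} (hx : x ∈ orb μ π ρ F K δ σ) :
    ∃ B : Set (Fin d), normCard d B ≤ δ ^ 2 / η ^ 2 + F₀.card * (2 * (δ ^ 2 / η ^ 2) + η') ∧
      ∀ i ∉ B, (∀ k, (k, i) ∈ (σ f).1 → ∃ y, π.actPt f.1 (x i) = some y) ∧
        ∀ y, π.actPt f.1 (x i) = some y → ∃ k, (k, i) ∈ (σ f).1 ∧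
          ∀ h ∈ F₀, extDist ρ (π.actPt h.1 y) (π.actPt h.1 (x k)) < 2 * η := by
  let bad : PartialAut 𝓗 → Set (Fin d) := fun f =>
    {i | η ≤ extDist ρ (π.actPt f.1 (x i)) (((σ f).actPt i).map x)}
  have hbad : ∀ f ∈ F, normCard d (bad f) ≤ δ ^ 2 / η ^ 2 := fun f hf =>
    normCard_le_of_dist₂_le hη (hx.1 f hf).le
  -- Three ways for `h` to fail at `i`: `x` does not follow `hf` at `i`, multiplicativity of `σ`
  -- fails at `i`, or `x` does not follow `h` at `σ(f) i`.
  let T : PartialAut 𝓗 → Set (Fin d) := fun h => bad (h * f) ∪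
    ({i | ∃ k, (k, i) ∈ (σ (h * f)).1 ∆ (σ h * σ f).1} ∪ {i | ∃ k ∈ bad h, (k, i) ∈ (σ f).1})
  have hT : ∀ h ∈ F₀, normCard d (T h) ≤ 2 * (δ ^ 2 / η ^ 2) + η' := fun h hh => by
    have h1 := normCard_union_le (d := d) (bad (h * f))
      ({i | ∃ k, (k, i) ∈ (σ (h * f)).1 ∆ (σ h * σ f).1} ∪ {i | ∃ k ∈ bad h, (k, i) ∈ (σ f).1})
    have h2 := normCard_union_le (d := d) {i | ∃ k, (k, i) ∈ (σ (h * f)).1 ∆ (σ h * σ f).1}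
      {i | ∃ k ∈ bad h, (k, i) ∈ (σ f).1}
    have h3 := hbad _ (hmul h hh)
    have h4 := (PartialPerm.normCard_snd_le ((σ (h * f)).1 ∆ (σ h * σ f).1)).trans
      (hσ h (hF₀E hh) f hfE).le
    have h5 := ((σ f).normCard_preimage_le (bad h)).trans (hbad h (hF₀F hh))
    change normCard d (bad (h * f) ∪ _) ≤ _
    linarith
  -- As `*` is at distance `pmDiam ρ ≥ η` from every point, an index that is not bad has `g` and `σ
  -- g` both defined or both undefined. This is where positive diameter enters.
  have hdef : ∀ g i, i ∉ bad g → ((∀ k, (k, i) ∈ (σ g).1 → ∃ y, π.actPt g.1 (x i) = some y) ∧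
      ∀ y, π.actPt g.1 (x i) = some y → ∃ k, (k, i) ∈ (σ g).1 ∧ ρ y (x k) < η) := by
    intro g i hi
    have hi' : extDist ρ (π.actPt g.1 (x i)) (((σ g).actPt i).map x) < η := not_le.1 hi
    constructor
    · intro k hk
      refine Option.ne_none_iff_exists'.1 fun hn => ?_
      rw [hn, (σ g).actPt_eq_some.2 hk, Option.map_some, extDist_none_some] at hi'
      exact absurd hηρ (not_le.2 hi')
    · intro y hy
      rcases hk : (σ g).actPt i with - | k
      · rw [hy, hk, Option.map_none, extDist_some_none] at hi'
        exact absurd hηρ (not_le.2 hi')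
      · rw [hy, hk] at hi'
        exact ⟨k, (σ g).actPt_eq_some.1 hk, hi'⟩
  refine ⟨bad f ∪ ⋃ h ∈ F₀, T h, ?_, fun i hi => ?_⟩
  · refine (normCard_union_le _ _).trans (add_le_add (hbad f hf)
      ((normCard_biUnion_le _ _).trans ?_))
    rw [← nsmul_eq_mul]
    exact Finset.sum_le_card_nsmul _ _ _ hT
  · rw [mem_union, not_or] at hi
    obtain ⟨hi, hiT⟩ := hi
    refine ⟨(hdef f i hi).1, fun y hy => ?_⟩
    obtain ⟨k, hk, -⟩ := (hdef f i hi).2 y hy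
    refine ⟨k, hk, fun h hh => ?_⟩
    have hiT' : i ∉ T h := fun hT => hiT (mem_iUnion₂.2 ⟨h, hh, hT⟩)
    simp only [T, mem_union, not_or] at hiT'
    obtain ⟨t1, t2, t3⟩ := hiT'
    have htot : ∀ y, ∃ w, π.actPt h.1 y = some w := fun y => by
      refine Option.ne_none_iff_exists'.1 fun hn => ?_
      rw [GpdHom.actPt_eq_none hπ, (hF₀ h hh).2.1] at hn
      exact hn trivial
    obtain ⟨w, hw⟩ := htot y
    obtain ⟨l, hl, hwl⟩ := (hdef _ i t1).2 w (actPt_mul hπ hy hw)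
    have hl' : (l, i) ∈ (σ h * σ f).1 := by
      by_contra hn
      exact t2 ⟨l, Or.inl ⟨hl, hn⟩⟩
    obtain ⟨k', hlk, hk'⟩ := hl'
    obtain rfl : k' = k := congrArg Prod.fst ((σ f).2.2 hk' hk rfl)
    have hkbad : k' ∉ bad h := fun hb => t3 ⟨k', hb, hk⟩
    obtain ⟨v, hv⟩ := htot (x k')
    obtain ⟨l', hl', hvl⟩ := (hdef h k' hkbad).2 v hv
    obtain rfl : l' = l := congrArg Prod.fst ((σ h).2.2 hl' hlk rfl)
    -- With `k = σ(f) i` and `l = σ(h) k = σ(hf) i`, both `h · y` and `h · x k` are within `η` of `x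
    -- l`.
    rw [hw, hv]
    have a1 := ρ.triangle' w (x l') v
    rw [ρ.symm' (x l') v] at a1
    change ρ.toFun w v < _
    change ρ.toFun w (x l') < η at hwl
    change ρ.toFun v (x l') < η at hvl
    linarith

end follow

/-! ### Labels of approximate orbits are good tuples -/

section upper

/-- In `|A ∆ B| = |A| + |B| - 2|A ∩ B|` the sizes of the images `τ · z⁻¹(A)` add up to the size of
the domain of `τ`. An upper bound for that total thus replaces separate bounds for each atom. -/
theorem sum_normCard_act_symmDiff_le {Y : Type*} {d : ℕ} (τ : PartialPerm d)
    (R : Finpartition (univ : Set Y)) (z : Fin d → Y) (T : Set Y → Set Y) (a : Set Y → ℝ)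
    {c₁ c₂ c₃ : ℝ}
    (h₁ : ∀ A ∈ R.parts, a A - c₁ ≤ normCard d {i ∈ z ⁻¹' A | ∃ k ∈ z ⁻¹' (T A), (k, i) ∈ τ.1})
    (h₂ : ∀ A ∈ R.parts, normCard d (z ⁻¹' (T A)) ≤ a A + c₂)
    (h₃ : normCard d {i | ∃ k, (k, i) ∈ τ.1} ≤ ∑ A ∈ R.parts, a A + c₃) :
    ∑ A ∈ R.parts, normCard d (τ.act (z ⁻¹' A) ∆ (z ⁻¹' (T A)))
      ≤ c₃ + R.parts.card * (2 * c₁ + c₂) := by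
  have h4 : ∑ A ∈ R.parts, normCard d (τ.act (z ⁻¹' A)) = normCard d {i | ∃ k, (k, i) ∈ τ.1} := by
    rw [← sum_parts_normCard R z {i | ∃ k, (k, i) ∈ τ.1}]
    refine Finset.sum_congr rfl fun A _ => ?_
    rw [τ.normCard_act]
    rfl
  have h5 : ∑ A ∈ R.parts, normCard d (τ.act (z ⁻¹' A) ∆ (z ⁻¹' (T A)))
      ≤ ∑ A ∈ R.parts, (normCard d (τ.act (z ⁻¹' A)) - a A + (2 * c₁ + c₂)) := by
    refine Finset.sum_le_sum fun A hA => ?_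
    rw [normCard_symmDiff_eq, τ.normCard_act_inter]
    have := h₁ A hA
    have := h₂ A hA
    linarith
  rw [Finset.sum_add_distrib, Finset.sum_sub_distrib, h4, Finset.sum_const, nsmul_eq_mul] at h5
  linarith

/-- Frequencies and measures both sum to `1`, so lower bounds for all atoms force upper bounds: a
deviation `u ≥ -c` satisfies `|u| ≤ u + 2c`, and the deviations sum to zero. -/
theorem sum_abs_normCard_sub_le_of_le {Y : Type*} [MeasurableSpace Y] {μ : Measure Y}
    [IsProbabilityMeasure μ] {P : Finpartition (univ : Set Y)} (hP : IsBorelPartition P) {d : ℕ}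
    (hd : 0 < d) {z : Fin d → Y} {c : ℝ} (hc : 0 ≤ c)
    (h : ∀ A ∈ P.parts, μ.real A - c ≤ normCard d (z ⁻¹' A)) :
    ∑ A ∈ P.parts, |normCard d (z ⁻¹' A) - μ.real A| ≤ P.parts.card * (2 * c) := by
  have h1 : ∑ A ∈ P.parts, |normCard d (z ⁻¹' A) - μ.real A|
      ≤ ∑ A ∈ P.parts, (normCard d (z ⁻¹' A) - μ.real A + 2 * c) := by
    refine Finset.sum_le_sum fun A hA => abs_le.2 ⟨?_, ?_⟩
    · linarith [h A hA]
    · linarith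
  have h2 := sum_parts_normCard P z univ
  have h3 := sum_parts_measureReal (μ := μ) hP MeasurableSet.univ
  simp only [inter_univ] at h2 h3
  rw [Finset.sum_add_distrib, Finset.sum_sub_distrib, h2, h3, normCard_univ hd, Finset.sum_const,
    nsmul_eq_mul, probReal_univ] at h1
  linarith

variable {Y G X H : Type*} [MeasurableSpace Y] [MeasurableSpace G] [StandardBorelSpace G]
  [MeasurableSpace X] [MeasurableSpace H] [StandardBorelSpace H]
  {𝓖 : MGpd Y G} {𝓗 : MGpd X H} {π : GpdHom 𝓖.toGpd 𝓗.toGpd} {μ : Measure Y} {ν : Measure X}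

theorem sum_parts_measureReal_act [IsFiniteMeasure μ] (hμ : 𝓖.IsPMP μ)
    (hπ : π.IsClassBijective) (hm : Measurable π.arr) (hobj : Measurable π.obj)
    (hmap : μ.map π.obj = ν) {R : Finpartition (univ : Set Y)} (hR : IsBorelPartition R)
    (f : PartialAut 𝓗) :
    ∑ A ∈ R.parts, μ.real (π.act f.1 A) = ν.real (𝓗.s '' f.1) := by
  have hs : MeasurableSet (𝓗.s '' f.1) :=
    𝓗.measurableSet_image 𝓗.measurable_s f.measurableSet f.injOn_s
  rw [← hmap, map_measureReal_apply hobj hs, ← sum_parts_measureReal hR (hobj hs)]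
  refine Finset.sum_congr rfl fun A hA => ?_
  rw [measureReal_def, measure_act hμ hπ hm f (hR A hA), measureReal_def]

/-- The points that lie in the neighbourhood `U` of an atom contained in `A`, and are moved by `f'`
into the neighbourhood `O` of an atom contained in `B`. -/
def followSet (π : GpdHom 𝓖.toGpd 𝓗.toGpd) (P : Finpartition (univ : Set Y)) (O U : Set Y → Set Y)
    (f' : Set H) (A B : Set Y) : Set Y :=
  (⋃ D ∈ {D | D ∈ P.parts ∧ D ⊆ A}, U D) ∩ π.preAct f' (⋃ D ∈ {D | D ∈ P.parts ∧ D ⊆ B}, O D)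

theorem measure_act_le_followSet [IsProbabilityMeasure μ] [IsProbabilityMeasure ν]
    (hμ : 𝓖.IsPMP μ) (hπ : π.IsClassBijective) (hm : Measurable π.arr) (hobj : Measurable π.obj)
    (hmap : μ.map π.obj = ν) {f f' : PartialAut 𝓗} {e : ℝ}
    (he : 0 ≤ e) (h : 𝓗.sourceMass ν (f.1 ∆ f'.1) < ENNReal.ofReal e) {C : Set Y}
    (hC : MeasurableSet C) (hCe : 1 - e ≤ μ.real C) {P : Finpartition (univ : Set Y)}
    (hP : IsBorelPartition P) {O U : Set Y → Set Y} (hCO : ∀ A ∈ P.parts, C ∩ A ⊆ O A)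
    (hOU : ∀ A ∈ P.parts, O A ⊆ U A) {A : Set Y} (hA : MeasurableSet[sigmaAlg P] A)
    (hfA : MeasurableSet[sigmaAlg P] (π.act f.1 A)) :
    μ.real (π.act f.1 A) ≤ μ.real (followSet π P O U f'.1 A (π.act f.1 A)) + 3 * e := by
  refine measure_act_le hμ hπ hm hobj hmap f f' he h hC hCe (hP.measurableSet hA) ?_
  have key : ∀ B, MeasurableSet[sigmaAlg P] B → ∀ y ∈ B ∩ C, ∃ D ∈ P.parts, D ⊆ B ∧ y ∈ O D := by
    rintro B hB y ⟨hyB, hyC⟩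
    obtain ⟨D, hD, hyD⟩ := exists_mem_parts P y
    refine ⟨D, hD, (measurableSet_sigmaAlg_iff.1 hB D hD).resolve_right
      fun h => h.le_bot ⟨hyD, hyB⟩, hCO D hD ⟨hyC, hyD⟩⟩
  intro y hy w hw hyw
  obtain ⟨D, hD, hDA, hyD⟩ := key A hA y hy
  obtain ⟨D', hD', hDA', hwD⟩ := key _ hfA w hw
  exact ⟨mem_iUnion₂.2 ⟨D, ⟨hD, hDA⟩, hOU D hD hyD⟩, (GpdHom.mem_preAct hπ f'.injOn_s).2
    ⟨w, mem_iUnion₂.2 ⟨D', ⟨hD', hDA'⟩, hwD⟩, hyw⟩⟩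

/-- If `x` follows `f'` and visits the relevant open sets often enough, then its labels follow
`f`. -/
theorem sum_normCard_follow_le [IsProbabilityMeasure μ] (hπ : π.IsClassBijective)
    {R P : Finpartition (univ : Set Y)} (hP : IsBorelPartition P)
    {O U : Set Y → Set Y} {L : Y → Y} (hL : ∀ A ∈ P.parts, ∀ y ∈ U A, L y ∈ A)
    {f f' : PartialAut 𝓗} (hf : ∀ A ∈ R.parts, MeasurableSet[sigmaAlg P] (π.act f.1 A))
    {d : ℕ} (hd : 0 < d) {τ : PartialPerm d} {x : Fin d → Y} {B : Set (Fin d)} {e c : ℝ}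
    (hB : normCard d B ≤ e) (hdom : ∀ i ∉ B, ∀ k, (k, i) ∈ τ.1 → ∃ y, π.actPt f'.1 (x i) = some y)
    (hmove : ∀ i ∉ B, ∀ y, π.actPt f'.1 (x i) = some y → ∃ k, (k, i) ∈ τ.1 ∧
      ∀ A ∈ P.parts, y ∈ O A → x k ∈ U A)
    (hV : ∀ A ∈ R.parts, μ.real (π.act f.1 A) - 5 * e
      ≤ normCard d (x ⁻¹' followSet π P O U f'.1 A (π.act f.1 A)))
    (hW : 1 - ∑ A ∈ R.parts, μ.real (π.act f.1 A) - 3 * e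
      ≤ normCard d (x ⁻¹' {y | π.obj y ∉ 𝓗.s '' f'.1}))
    (hlab : ∑ A ∈ P.parts, |normCard d ((L ∘ x) ⁻¹' A) - μ.real A| ≤ c) :
    ∑ A ∈ R.parts, normCard d (τ.act ((L ∘ x) ⁻¹' A) ∆ ((L ∘ x) ⁻¹' (π.act f.1 A)))
      ≤ 4 * e + R.parts.card * (2 * (6 * e) + c) := by
  -- The constants are `c₁ = 6e` (five from `hV`, one from `B`), `c₂ = c` from the label
  -- frequencies, and `c₃ = 4e` (three from `hW`, one from `B`).
  refine sum_normCard_act_symmDiff_le τ R (L ∘ x) (fun A => π.act f.1 A)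
    (fun A => μ.real (π.act f.1 A)) (fun A hA => ?_) (fun A hA => ?_) ?_
  · have hsub : x ⁻¹' followSet π P O U f'.1 A (π.act f.1 A)
        ⊆ {i ∈ (L ∘ x) ⁻¹' A | ∃ k ∈ (L ∘ x) ⁻¹' (π.act f.1 A), (k, i) ∈ τ.1} ∪ B := by
      intro i hi
      by_cases hiB : i ∈ B
      · exact Or.inr hiB
      obtain ⟨hi1, hi2⟩ := hi
      obtain ⟨D, ⟨hD, hDA⟩, hiD⟩ := mem_iUnion₂.1 hi1
      obtain ⟨w, hw, hiw⟩ := (GpdHom.mem_preAct hπ f'.injOn_s).1 hi2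
      obtain ⟨D', ⟨hD', hDA'⟩, hwD⟩ := mem_iUnion₂.1 hw
      obtain ⟨k, hk, hkU⟩ := hmove i hiB w hiw
      exact Or.inl ⟨hDA (hL D hD _ hiD), k, hDA' (hL D' hD' _ (hkU D' hD' hwD)), hk⟩
    have h1 := (normCard_mono (d := d) hsub).trans (normCard_union_le _ _)
    have h2 := hV A hA
    linarith
  · have h1 := (abs_le.1 ((sum_abs_normCard_sub_le (μ := μ) hP (L ∘ x) (hf A hA)).trans hlab)).2
    linarith
  · have hsub : {i | ∃ k, (k, i) ∈ τ.1} ⊆ (x ⁻¹' {y | π.obj y ∉ 𝓗.s '' f'.1})ᶜ ∪ B := by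
      rintro i ⟨k, hk⟩
      by_cases hiB : i ∈ B
      · exact Or.inr hiB
      refine Or.inl fun hi => ?_
      obtain ⟨y, hy⟩ := hdom i hiB k hk
      rw [(GpdHom.actPt_eq_none hπ).2 hi] at hy
      exact absurd hy (by simp)
    have h1 := (normCard_mono (d := d) hsub).trans (normCard_union_le _ _)
    rw [normCard_compl hd] at h1
    linarith

variable [TopologicalSpace Y] [CompactSpace Y] [TopologicalSpace.MetrizableSpace Y] [BorelSpace Y]
  [TopologicalSpace X] [CompactSpace X] [TopologicalSpace.MetrizableSpace X] [BorelSpace X]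
  [TopologicalSpace G] [BorelSpace G] [TopologicalSpace H] [T2Space H] [BorelSpace H]

/-- The labels of an approximate orbit form a good tuple. -/
theorem exists_orb_label_mem_goodTuples (h𝓖 : 𝓖.IsTopological) (h𝓗 : 𝓗.IsTopological)
    (he𝓖 : 𝓖.IsEtale) (he𝓗 : 𝓗.IsEtale) (hμ : 𝓖.IsPMP μ) (hν : 𝓗.IsPMP ν)
    (hreg : 𝓗.IsRegularMeasure ν) (hπ : Continuous π.arr) (hbij : π.IsClassBijective)
    (hmap : μ.map π.obj = ν) {ρ : PseudoMetric Y ℝ} (hρ : Continuous fun q : Y × Y => ρ q.1 q.2)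
    (hgen : IsDynamicallyGenerating π ρ) (hρpos : 0 < pmDiam ρ)
    {Q R : Finpartition (univ : Set Y)} (hQ : ∀ q ∈ Q.parts, μ (frontier q) = 0) (hRQ : R ≤ Q)
    (hR : IsBorelPartition R) {F : Finset (PartialAut 𝓗)} (hF : 1 ∈ F) {δ : ℝ} (hδ : 0 < δ) :
    ∃ L : Y → Y, (∀ q ∈ Q.parts, ∀ y ∈ q, L y ∈ q) ∧
      ∃ (E F' : Finset (PartialAut 𝓗)) (K : Finset C(Y, ℂ)) (t : ℝ),
        (F' : Set (PartialAut 𝓗)) ⊆ topPartialAut 𝓗 ν ∧ 0 < t ∧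
        ∀ d, 0 < d → ∀ σ : SoficMap 𝓗 d, IsMultiplicative E t σ → IsContinuousMap ν E t σ →
          ∀ x ∈ orb μ π ρ F' K t σ, L ∘ x ∈ goodTuples μ π σ R F δ := by
  classical
  have := hμ.1
  have := hν.1
  have hm := hπ.measurable
  have hobjc := continuous_obj h𝓖 h𝓗 hπ
  have hobj := hobjc.measurable
  set P := refinePartition π R F
  have hP : IsBorelPartition P := isBorelPartition_refinePartition hbij hm hR F
  set n : ℝ := (P.parts.card : ℝ)
  set N : ℝ := (R.parts.card : ℝ)
  have hn : 0 ≤ n := Nat.cast_nonneg _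
  have hN : 0 ≤ N := Nat.cast_nonneg _
  -- The total is `4e + N(12e + 6ne)` from following `f'`, plus `2Ne` for replacing `σ(f)` by
  -- `σ(f')`; the extra `6n` covers the label frequencies.
  obtain ⟨e, he, heδ⟩ : ∃ e > 0, (4 + 6 * n * N + 14 * N + 6 * n) * e < δ :=
    exists_pos_of_tendsto_zero (by fun_prop) (by simp) hδ
  have hPR : sigmaAlg R ≤ sigmaAlg P := sigmaAlg_le_refinePartition hbij hF
  have hPQ : P ≤ Q := by
    intro A hA
    obtain ⟨y, hy⟩ := nonempty_of_mem_parts P hA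
    obtain ⟨q, hq, hyq⟩ := exists_mem_parts Q y
    refine ⟨q, hq, (measurableSet_sigmaAlg_iff.1 (hPR _ (sigmaAlg_mono hRQ _
      (measurableSet_sigmaAlg_of_mem hq))) A hA).resolve_right fun h => h.le_bot ⟨hy, hyq⟩⟩
  obtain ⟨C, O, U, L, hC, hCe, hOU, hLQ⟩ := exists_label μ hP hPQ hQ he
  choose ap hap_top hap_open hap using fun f : PartialAut 𝓗 =>
    exists_open_topPartialAut_sourceMass_lt h𝓗 he𝓗 hν hreg f
      (ε := ENNReal.ofReal e) (by simpa using he)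
  have hsep : ∀ A ∈ P.parts, ∃ (F₁ : Finset (PartialAut 𝓗)) (η : ℝ),
      (∀ f ∈ F₁, f.1 ∈ 𝓗.topFullGroup) ∧ 0 < η ∧ ∀ y ∈ closure (O A), ∀ z,
        (∀ f ∈ F₁, extDist ρ (π.actPt f.1 y) (π.actPt f.1 z) < η) → z ∈ U A := fun A hA =>
    hgen.exists_finset h𝓖 he𝓖 hπ hbij hρ isClosed_closure.isCompact (hOU A hA).2.1 (hOU A hA).2.2.1
  choose! F₁ η₁ hF₁ hη₁ hsep using hsep
  obtain ⟨η₀, hη₀, hη₀₁⟩ := exists_pos_forall_le P.parts hη₁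
  set F₀ := P.parts.biUnion F₁
  have hF₀ : ∀ h ∈ F₀, h.1 ∈ 𝓗.topFullGroup := fun h hh => by
    obtain ⟨A, hA, hhA⟩ := Finset.mem_biUnion.1 hh
    exact hF₁ A hA h hhA
  -- Approximate following separates by less than `2η ≤ η₀`, the common separation threshold; `η ≤
  -- pmDiam ρ` is needed to detect `*`.
  set η := min (η₀ / 2) (pmDiam ρ)
  have hη : 0 < η := lt_min (half_pos hη₀) hρpos
  have hη2 : 2 * η ≤ η₀ := by
    have : η ≤ η₀ / 2 := min_le_left _ _
    linarith
  obtain ⟨t, ht, hte⟩ : ∃ t > 0,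
      t + (t ^ 2 / η ^ 2 + F₀.card * (2 * (t ^ 2 / η ^ 2) + t)) < e :=
    exists_pos_of_tendsto_zero (by fun_prop) (by simp) he
  have hsq : 0 ≤ t ^ 2 / η ^ 2 := by positivity
  have hF₀t : 0 ≤ (F₀.card : ℝ) * (2 * (t ^ 2 / η ^ 2) + t) := by positivity
  have hte' : t < e := by linarith
  choose! k hk using fun (V : Set Y) (hV : IsOpen V) => exists_test_function μ hV he
  -- The closure makes `W f` open; visits to it bound from above how often `f'`, hence `σ(f')`, is
  -- defined.
  let W : PartialAut 𝓗 → Set Y := fun f => (π.obj ⁻¹' closure (𝓗.s '' (ap f).1))ᶜ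
  let V : PartialAut 𝓗 → Set Y → Set Y := fun f A =>
    followSet π P O U (ap f).1 A (π.act f.1 A)
  have hWo : ∀ f, IsOpen (W f) := fun f => (isClosed_closure.preimage hobjc).isOpen_compl
  have hVo : ∀ f A, IsOpen (V f A) := fun f A =>
    (isOpen_biUnion fun D hD => (hOU D hD.1).2.1).inter
      (isOpen_preAct h𝓖 he𝓖 hπ (hap_open f) (isOpen_biUnion fun D hD => (hOU D hD.1).1))
  let K : Finset C(Y, ℂ) := P.parts.image (fun A => k (U A)) ∪
    (F.image (fun f => k (W f)) ∪ (F ×ˢ R.parts).image fun q => k (V q.1 q.2))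
  -- Only elements of `⟦𝓗⟧_top` are allowed here: the open approximations, the separating
  -- bisections, and their products.
  let F' : Finset (PartialAut 𝓗) := F.image ap ∪ (F₀ ∪ (F₀ ×ˢ F).image fun q => q.1 * ap q.2)
  refine ⟨L, hLQ, F ∪ (F₀ ∪ F.image ap), F', K, t, ?_, ht, fun d hd σ hmul hcont x hx => ?_⟩
  · intro g hg
    rcases Finset.mem_union.1 hg with hg | hg
    · obtain ⟨f, -, rfl⟩ := Finset.mem_image.1 hg
      exact hap_top f
    · rcases Finset.mem_union.1 hg with hg | hg
      · exact mem_topPartialAut_of_mem_topFullGroup (hF₀ g hg)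
      · obtain ⟨⟨h, f⟩, hq, rfl⟩ := Finset.mem_image.1 hg
        exact mul_mem_topPartialAut h𝓗 hν (hF₀ h (Finset.mem_product.1 hq).1) (hap_top f)
  have htest : ∀ S, IsOpen S → k S ∈ K → μ.real S - 2 * e ≤ normCard d (x ⁻¹' S) :=
    fun S hS hkS => hk S hS d x ((hx.2 _ hkS).trans hte')
  have hCc : μ.real Cᶜ ≤ e := by
    rw [probReal_compl_eq_one_sub hC]
    linarith
  -- Two `e` come from the test function for `U A`, the third from the part of `A` outside `C`.
  have hlow : ∀ A ∈ P.parts, μ.real A - 3 * e ≤ normCard d ((L ∘ x) ⁻¹' A) := fun A hA => by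
    have h1 := htest (U A) (hOU A hA).2.1
      (Finset.mem_union_left _ (Finset.mem_image_of_mem (fun A => k (U A)) hA))
    have h2 : normCard d (x ⁻¹' U A) ≤ normCard d ((L ∘ x) ⁻¹' A) :=
      normCard_mono fun i hi => (hOU A hA).2.2.2.2 _ hi
    have h3 : μ.real A ≤ μ.real (U A) + μ.real Cᶜ := by
      refine (measureReal_mono (fun y hy => ?_) (measure_ne_top _ _)).trans
        (measureReal_union_le _ _)
      by_cases hyC : y ∈ C
      · exact Or.inl ((hOU A hA).2.2.1 (subset_closure ((hOU A hA).2.2.2.1 ⟨hyC, hy⟩)))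
      · exact Or.inr hyC
    linarith
  have hlab := sum_abs_normCard_sub_le_of_le hP hd (by positivity) hlow
  refine ⟨fun f hf => ?_, hlab.trans_lt (by nlinarith [mul_nonneg hn hN])⟩
  have hfE : f ∈ F ∪ (F₀ ∪ F.image ap) := Finset.mem_union_left _ hf
  have hapE : ap f ∈ F ∪ (F₀ ∪ F.image ap) :=
    Finset.mem_union_right _ (Finset.mem_union_right _ (Finset.mem_image_of_mem ap hf))
  have hF₀F : F₀ ⊆ F' := fun h hh => Finset.mem_union_right _ (Finset.mem_union_left _ hh)
  obtain ⟨B, hB, hBi⟩ := exists_small_exceptional_set hbij hη (min_le_right _ _)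
    (Finset.mem_union_left _ (Finset.mem_image_of_mem ap hf)) hapE hF₀ hF₀F
    (fun h hh => Finset.mem_union_right _ (Finset.mem_union_left _ hh))
    (fun h hh => Finset.mem_union_right _ (Finset.mem_union_right _
      (Finset.mem_image.2 ⟨(h, f), Finset.mem_product.2 ⟨hh, hf⟩, rfl⟩))) hmul hx
  have hact : ∀ A ∈ R.parts, MeasurableSet[sigmaAlg P] (π.act f.1 A) :=
    fun A hA => measurableSet_act_sigmaAlg hf hA
  have hfollow := sum_normCard_follow_le (μ := μ) (R := R) hbij hP
    (fun A hA => (hOU A hA).2.2.2.2) (f := f) (f' := ap f) (O := O) hact hd (τ := σ (ap f))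
    (x := x) (B := B) (e := e) (by linarith) (fun i hi => (hBi i hi).1) (fun i hi y hy => ?_)
    (fun A hA => ?_) ?_ hlab
  -- The only use of asymptotic continuity: it transfers the estimate from `σ(ap f)` to `σ(f)`.
  · have hclose : normCard d ((σ f).1 ∆ (σ (ap f)).1) ≤ 2 * e := by
      have h1 := hcont f hfE (ap f) hapE
      have h2 : massDiff 𝓗 ν f (ap f) ≤ e := ENNReal.toReal_le_of_le_ofReal he.le (hap f).le
      linarith
    have h1 : ∑ A ∈ R.parts, normCard d ((σ f).act ((L ∘ x) ⁻¹' A) ∆ ((L ∘ x) ⁻¹' π.act f.1 A))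
        ≤ ∑ A ∈ R.parts, (normCard d ((σ (ap f)).act ((L ∘ x) ⁻¹' A) ∆
          ((L ∘ x) ⁻¹' π.act f.1 A)) + 2 * e) :=
      Finset.sum_le_sum fun A _ => (PartialPerm.normCard_act_symmDiff_le _ (σ (ap f)) _ _).trans
        (add_le_add le_rfl hclose)
    rw [Finset.sum_add_distrib, Finset.sum_const, nsmul_eq_mul] at h1
    refine h1.trans_lt ((add_le_add hfollow le_rfl).trans_lt (lt_of_le_of_lt ?_ heδ))
    have := mul_nonneg hn he.le
    change 4 * e + N * (2 * (6 * e) + n * (2 * (3 * e))) + N * (2 * e) ≤ _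
    linarith
  · obtain ⟨j, hj, hclose⟩ := (hBi i hi).2 y hy
    refine ⟨j, hj, fun A hA hyA => hsep A hA y (subset_closure hyA) _ fun h hh => ?_⟩
    exact (hclose h (Finset.mem_biUnion.2 ⟨A, hA, hh⟩)).trans_le (hη2.trans (hη₀₁ A hA))
  · have h1 := htest (V f A) (hVo f A) (Finset.mem_union_right _ (Finset.mem_union_right _
      (Finset.mem_image.2 ⟨(f, A), Finset.mem_product.2 ⟨hf, hA⟩, rfl⟩)))
    have h2 := measure_act_le_followSet hμ hbij hm hobj hmap he.le (hap f) hC hCe hP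
      (fun A hA => (hOU A hA).2.2.2.1) (fun A hA => subset_closure.trans (hOU A hA).2.2.1)
      (hPR _ (measurableSet_sigmaAlg_of_mem hA)) (hact A hA)
    change μ.real (followSet π P O U (ap f).1 A (π.act f.1 A)) - 2 * e
      ≤ normCard d (x ⁻¹' followSet π P O U (ap f).1 A (π.act f.1 A)) at h1
    linarith
  · have h1 := htest (W f) (hWo f) (Finset.mem_union_right _ (Finset.mem_union_left _
      (Finset.mem_image_of_mem (fun f => k (W f)) hf)))
    have h2 : normCard d (x ⁻¹' W f) ≤ normCard d (x ⁻¹' {y | π.obj y ∉ 𝓗.s '' (ap f).1}) :=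
      normCard_mono fun i hi h => hi (subset_closure h)
    have h3 : μ.real (W f) = 1 - ν.real (closure (𝓗.s '' (ap f).1)) := by
      rw [← hmap, map_measureReal_apply hobj isClosed_closure.measurableSet,
        ← probReal_compl_eq_one_sub (hobj isClosed_closure.measurableSet)]
    have h4 := measure_closure_source_le (hap_top f) he.le (hap f)
    rw [sum_parts_measureReal_act hμ hbij hm hobj hmap hR f]
    linarith

end upper

/-- Since `L` preserves the atoms of `Q`, the tuples `x` and `L ∘ x` have the same `Q`-name. Two
tuples with equal names are within `ε` in every coordinate and so cannot be separated. -/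
theorem sepNumber_distSup_le_encard {Y : Type*} {Q : Finpartition (univ : Set Y)}
    {ρ : PseudoMetric Y ℝ} {ε : ℝ} (hQ : ∀ q ∈ Q.parts, ∀ y ∈ q, ∀ y' ∈ q, ρ y y' ≤ ε)
    {L : Y → Y} (hL : ∀ q ∈ Q.parts, ∀ y ∈ q, L y ∈ q) {d : ℕ} (hd : 0 < d) {A B : Set (Fin d → Y)}
    (hAB : ∀ x ∈ A, L ∘ x ∈ B) :
    sepNumber (distSup ρ) ε A ≤ (pointHom Q '' B).encard := by
  refine iSup₂_le fun S ⟨hSA, hS⟩ => ?_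
  refine encard_le_encard_of_injOn (f := fun x => pointHom Q (L ∘ x))
    (fun x hx => ⟨_, hAB x (hSA hx), rfl⟩) fun x hx x' hx' h => ?_
  by_contra hne
  have : Nonempty (Fin d) := ⟨⟨0, hd⟩⟩
  refine absurd (hS x hx x' hx' hne) (not_lt.2 (ciSup_le fun i => ?_))
  obtain ⟨q, hq, hxq⟩ := exists_mem_parts Q (x i)
  obtain ⟨q', hq', hxq'⟩ := exists_mem_parts Q (x' i)
  have h1 : L (x' i) ∈ q := (pointHom_eq_iff.1 h i q hq).1 (hL q hq _ hxq)
  obtain rfl := eq_of_mem_parts Q hq hq' h1 (hL q' hq' _ hxq')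
  exact hQ q hq _ hxq _ hxq'

theorem parts_eq_singleton_univ {Y : Type*} [Subsingleton Y] [Nonempty Y]
    (P : Finpartition (univ : Set Y)) :
    P.parts = {univ} := by
  obtain ⟨A, hA, -⟩ := exists_mem_parts P (Classical.arbitrary Y)
  exact Finset.eq_singleton_iff_nonempty_unique_mem.2 ⟨⟨A, hA⟩, fun B hB =>
    Subsingleton.eq_univ_of_nonempty (nonempty_of_mem_parts P hB)⟩

/-! ### The degenerate case of a one-point object space -/

section subsingleton

variable {Y G X H : Type*} [MeasurableSpace Y] [MeasurableSpace G] [StandardBorelSpace G]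
  [MeasurableSpace X] [MeasurableSpace H] [StandardBorelSpace H]
  {𝓖 : MGpd Y G} {𝓗 : MGpd X H} {π : GpdHom 𝓖.toGpd 𝓗.toGpd} {μ : Measure Y} {ν : Measure X}

/-- Dynamical generation requires positive extended distances, all of which are bounded by the
diameter. -/
theorem subsingleton_of_pmDiam_eq_zero [TopologicalSpace Y] [CompactSpace Y] [TopologicalSpace X]
    [TopologicalSpace H] {ρ : PseudoMetric Y ℝ}
    (hρ : Continuous fun q : Y × Y => ρ q.1 q.2) (hgen : IsDynamicallyGenerating π ρ)
    (h : pmDiam ρ = 0) : Subsingleton Y := by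
  refine ⟨fun x y => ?_⟩
  by_contra hne
  obtain ⟨f, -, hf⟩ := hgen x y hne
  exact absurd hf (not_lt.2 (h ▸ extDist_le hρ _ _))

theorem sepNumber_le_one {Z : Type*} [Subsingleton Z] (D : Z → Z → ℝ) (ε : ℝ) (A : Set Z) :
    sepNumber D ε A ≤ 1 :=
  iSup₂_le fun _ _ => encard_le_one_iff.2 fun _ _ _ _ => Subsingleton.elim _ _

/-- The inverse of a partial automorphism. -/
def PartialAut.inverse (f : PartialAut 𝓗) : PartialAut 𝓗 :=
  ⟨𝓗.inv ⁻¹' f.1, (𝓗.isPartialAut_iff _).2 ⟨𝓗.measurable_inv f.measurableSet,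
    fun a ha b hb h => by
      rw [← 𝓗.inv_inv a, ← 𝓗.inv_inv b, f.injOn_r ha hb (by rw [𝓗.r_inv, 𝓗.r_inv, h])],
    fun a ha b hb h => by
      rw [← 𝓗.inv_inv a, ← 𝓗.inv_inv b, f.injOn_s ha hb (by rw [𝓗.s_inv, 𝓗.s_inv, h])]⟩⟩

/-- With one object, injectivity of the source leaves at most one arrow in `f`, and this arrow has
an inverse. -/
theorem PartialAut.mul_inverse_of_subsingleton [Subsingleton X] {f : PartialAut 𝓗}
    (hf : f.1.Nonempty) : f * f.inverse = 1 := by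
  refine Subtype.ext (Set.ext fun g => ⟨?_, ?_⟩)
  · rintro ⟨a, ha, b, hb, hab, rfl⟩
    obtain rfl : a = 𝓗.inv b := f.injOn_s ha hb (Subsingleton.elim _ _)
    exact ⟨𝓗.s b, (𝓗.inv_comp b).symm⟩
  · rintro ⟨x, rfl⟩
    obtain ⟨a, ha⟩ := hf
    refine ⟨a, ha, 𝓗.inv a, ?_, (𝓗.r_inv a).symm, ?_⟩
    · change 𝓗.inv (𝓗.inv a) ∈ f.1
      rwa [𝓗.inv_inv]
    · rw [𝓗.comp_inv, Subsingleton.elim (𝓗.r a) x]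

theorem trace_one [IsProbabilityMeasure ν] : trace 𝓗 ν 1 = 1 := by
  have : {x | 𝓗.unit x ∈ (1 : PartialAut 𝓗).1} = univ := eq_univ_of_forall fun x => ⟨x, rfl⟩
  rw [trace, this, measure_univ, ENNReal.toReal_one]

/-- An almost idempotent partial permutation with few fixed points is small. -/
theorem PartialPerm.normCard_act_univ_le {d : ℕ} (τ : PartialPerm d) :
    normCard d (τ.act univ) ≤ τ.trace + normCard d (τ.1 ∆ (τ * τ).1) := by
  refine le_trans (normCard_mono (B := {i | (i, i) ∈ τ.1} ∪ {i | ∃ j, (i, j) ∈ τ.1 ∆ (τ * τ).1})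
    ?_) ((normCard_union_le _ _).trans (add_le_add le_rfl (normCard_fst_le _)))
  rintro i ⟨j, -, hij⟩
  by_cases h : (i, j) ∈ (τ * τ).1
  · obtain ⟨k, hik, hkj⟩ := h
    obtain rfl : k = i := congrArg Prod.fst (τ.2.2 hkj hij rfl)
    exact Or.inl hik
  · exact Or.inr ⟨j, Or.inl ⟨hij, h⟩⟩

/-- A fixed point of `τ * θ` lies in the range of `τ`. -/
theorem PartialPerm.trace_le_normCard_act_univ {d : ℕ} (ι τ θ : PartialPerm d) :
    ι.trace ≤ normCard d (τ.act univ) + normCard d (ι.1 ∆ (τ * θ).1) := by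
  refine le_trans (normCard_mono (B := τ.act univ ∪ {i | ∃ j, (i, j) ∈ ι.1 ∆ (τ * θ).1})
    ?_) ((normCard_union_le _ _).trans (add_le_add le_rfl (normCard_fst_le _)))
  intro i hi
  by_cases h : (i, i) ∈ (τ * θ).1
  · obtain ⟨k, hik, -⟩ := h
    exact Or.inl ⟨k, trivial, hik⟩
  · exact Or.inr ⟨i, Or.inl ⟨hi, h⟩⟩

open Classical in
-- An empty `f` is idempotent with trace `0`, so `σ(f)` has almost empty range. A nonempty `f`
-- satisfies `f * f⁻¹ = 1`, and `σ(1)` has trace near `1`, so `σ(f)` has almost full range. Either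
-- way the only equivariance condition holds.
theorem mem_goodTuples_of_subsingleton [Subsingleton Y] [Nonempty Y] [IsProbabilityMeasure μ]
    [IsProbabilityMeasure ν] (hπ : π.IsClassBijective) {R : Finpartition (univ : Set Y)}
    {F : Finset (PartialAut 𝓗)} {δ : ℝ} (hδ : 0 < δ) {d : ℕ} (hd : 0 < d) {σ : SoficMap 𝓗 d}
    (htr : IsTracePreserving ν (insert 1 (F ∪ F.image PartialAut.inverse)) (δ / 2) σ)
    (hmul : IsMultiplicative (insert 1 (F ∪ F.image PartialAut.inverse)) (δ / 2) σ)
    (z : Fin d → Y) : z ∈ goodTuples μ π σ R F δ := by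
  have hX : Subsingleton X := by
    have hsurj : Function.Surjective π.obj := fun x => by
      obtain ⟨g, hg⟩ := hπ.surjective (𝓗.unit x)
      exact ⟨𝓖.s g, by rw [← π.s_arr, hg, 𝓗.s_unit]⟩
    exact hsurj.subsingleton
  constructor
  · intro f hf
    rw [parts_eq_singleton_univ R, Finset.sum_singleton, preimage_univ]
    have hfT : f ∈ insert 1 (F ∪ F.image PartialAut.inverse) :=
      Finset.mem_insert_of_mem (Finset.mem_union_left _ hf)
    rcases f.1.eq_empty_or_nonempty with h0 | h0
    · have hff : f * f = f := by
        refine Subtype.ext (Set.ext fun g => ⟨?_, fun hg => (h0 ▸ hg : g ∈ (∅ : Set H)).elim⟩)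
        rintro ⟨a, ha, -⟩
        exact (h0 ▸ ha : a ∈ (∅ : Set H)).elim
      have hact : π.act f.1 univ = ∅ := by
        rw [h0]
        exact eq_empty_of_forall_notMem fun y ⟨_, hg, _⟩ => hg
      have h1 := (abs_lt.1 (htr f hfT)).2
      have h2 := hmul f hfT f hfT
      have h3 : trace 𝓗 ν f = 0 := by simp [trace, h0]
      rw [hff] at h2
      rw [hact, preimage_empty, ← bot_eq_empty, symmDiff_bot]
      have := (σ f).normCard_act_univ_le
      linarith
    · have hact : π.act f.1 univ = univ := by
        refine Subsingleton.eq_univ_of_nonempty ?_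
        obtain ⟨a, ha⟩ := h0
        obtain ⟨g, rfl⟩ := hπ.surjective a
        exact ⟨_, g, ha, trivial, rfl⟩
      have h1 := (abs_lt.1 (htr 1 (Finset.mem_insert_self _ _))).1
      have h2 := hmul f hfT f.inverse (Finset.mem_insert_of_mem (Finset.mem_union_right _
        (Finset.mem_image_of_mem _ hf)))
      rw [PartialAut.mul_inverse_of_subsingleton h0] at h2
      rw [trace_one] at h1
      rw [hact, preimage_univ, ← top_eq_univ, symmDiff_top, top_eq_univ, hnot_eq_compl,
        normCard_compl hd]
      have := (σ 1).trace_le_normCard_act_univ (σ f) (σ f.inverse)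
      linarith
  · rw [parts_eq_singleton_univ, Finset.sum_singleton, preimage_univ, normCard_univ hd,
      probReal_univ, sub_self, abs_zero]
    exact hδ

theorem measurableSet_isTracePreserving {d : ℕ} (F : Finset (PartialAut 𝓗)) (δ : ℝ) :
    MeasurableSet {σ : SoficMap 𝓗 d | IsTracePreserving ν F δ σ} := by
  have : {σ : SoficMap 𝓗 d | IsTracePreserving ν F δ σ}
      = ⋂ a ∈ F, (fun σ : SoficMap 𝓗 d => σ a) ⁻¹'
        {τ : PartialPerm d | |τ.trace - trace 𝓗 ν a| < δ} := by
    ext σ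
    simp [IsTracePreserving]
  rw [this]
  exact Finset.measurableSet_biInter _ fun a _ => measurable_pi_apply a trivial

variable {J : Type*} [Preorder J] [IsDirectedOrder J] [Nonempty J] {d : J → ℕ}
  {P : ∀ j, Measure (SoficMap 𝓗 (d j))}

theorem partitionEntropy_nonneg_of_subsingleton [Subsingleton Y] [IsProbabilityMeasure μ]
    [IsProbabilityMeasure ν] (hπ : π.IsClassBijective) (hP : IsSoficApprox 𝓗 ν d P) (β : Bias J)
    {p : ℝ≥0∞} (hp : 1 ≤ p) : 0 ≤ partitionEntropy μ π d P β p := by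
  classical
  have := nonempty_of_isProbabilityMeasure μ
  have hBorel : ∀ R : Finpartition (univ : Set Y), IsBorelPartition R := fun R A hA => by
    rw [parts_eq_singleton_univ, Finset.mem_singleton] at hA
    exact hA ▸ MeasurableSet.univ
  let Q : Finpartition (univ : Set Y) := Finpartition.indiscrete (univ_nonempty.ne_empty)
  refine le_iSup₂_of_le Q (hBorel Q) (le_iInf₂ fun R hR => le_iInf₂ fun F hF =>
    le_iInf₂ fun δ hδ => ?_)
  have htr := hP.tracePreserving (insert 1 (F ∪ F.image PartialAut.inverse)) _ (half_pos hδ)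
  obtain ⟨j₀, hj₀⟩ := hP.multiplicative (insert 1 (F ∪ F.image PartialAut.inverse)) _ (half_pos hδ)
  refine growthRate_nonneg hP.tendsto_d β hp (fun j => measurableSet_isTracePreserving _ _)
    (htr.eventually_const_le (by
      rw [ENNReal.ofReal_lt_one]
      exact Real.exp_lt_one_iff.2 (by norm_num))) ?_
  filter_upwards [eventually_ge_atTop j₀, hP.tendsto_d.eventually_gt_atTop 0] with j hj hd
  filter_upwards [hj₀ j hj] with σ hσ hσ'
  rw [goodHomCount_eq hπ hR.1 hF]
  have h1 : 1 ≤ (pointHom Q '' goodTuples μ π σ R F δ).encard :=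
    one_le_encard_iff_nonempty.2 (Set.Nonempty.image _ ⟨fun _ => Classical.arbitrary Y,
      mem_goodTuples_of_subsingleton hπ hδ hd hσ' hσ _⟩)
  exact_mod_cast h1

end subsingleton

/-! ### Comparison of the entropies -/

section entropy

variable {Y G X H : Type*} [TopologicalSpace Y] [MeasurableSpace Y]
  [TopologicalSpace X] [MeasurableSpace X]
  [MeasurableSpace G] [StandardBorelSpace G]
  [TopologicalSpace H] [MeasurableSpace H] [StandardBorelSpace H]
  {𝓖 : MGpd Y G} {𝓗 : MGpd X H} {μ : Measure Y} {ν : Measure X}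
  {π : GpdHom 𝓖.toGpd 𝓗.toGpd} {J : Type*} [Preorder J] [IsDirectedOrder J] [Nonempty J]
  {d : J → ℕ} {P : ∀ j, Measure (SoficMap 𝓗 (d j))}

theorem pseudometricEntropy₂_le_pseudometricEntropySup (β : Bias J) (p : ℝ≥0∞)
    (ρ : PseudoMetric Y ℝ) :
    pseudometricEntropy₂ ν μ π d P β p ρ ≤ pseudometricEntropySup ν μ π d P β p ρ := by
  refine iSup₂_mono fun ε _ => iInf₂_mono fun δ _ => iInf₂_mono fun F _ => iInf_mono fun K =>
    growthRate_mono β p (Eventually.of_forall fun j => Eventually.of_forall fun σ => ?_)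
  exact_mod_cast sepNumber_mono (dist₂_le_distSup (pseudoMetric_nonneg ρ)) subset_rfl

theorem pseudometricEntropySup_nonpos_of_subsingleton [Subsingleton Y]
    (hP : ∀ j, IsProbabilityMeasure (P j)) (β : Bias J) (p : ℝ≥0∞) (ρ : Y → Y → ℝ) :
    pseudometricEntropySup ν μ π d P β p ρ ≤ 0 := by
  refine iSup₂_le fun ε _ => iInf₂_le_of_le 1 one_pos (iInf₂_le_of_le ∅ (by simp)
    (iInf_le_of_le ∅ (growthRate_nonpos hP β p fun j σ => ?_)))
  exact_mod_cast sepNumber_le_one _ _ _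

variable [CompactSpace Y] [TopologicalSpace.MetrizableSpace Y] [BorelSpace Y]
  [TopologicalSpace G] [BorelSpace G] [BorelSpace H]

theorem partitionEntropy_le_pseudometricEntropy₂
    (h𝓖 : 𝓖.IsTopological) (he : 𝓖.IsEtale) (hμ : 𝓖.IsPMP μ) (hπ : Continuous π.arr)
    (hbij : π.IsClassBijective) (hd : Tendsto d atTop atTop) (β : Bias J) (p : ℝ≥0∞)
    {ρ : PseudoMetric Y ℝ} (hρ : Continuous fun q : Y × Y => ρ q.1 q.2)
    (hgen : IsDynamicallyGenerating π ρ) :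
    partitionEntropy μ π d P β p ≤ pseudometricEntropy₂ ν μ π d P β p ρ := by
  refine iSup₂_le fun Q hQ => ereal_le_of_forall_pos_le_add fun κ hκ => ?_
  obtain ⟨ε, hε, h⟩ := exists_goodHomCount_le h𝓖 he hμ hπ hbij hρ hgen hQ hκ
  have h1 : ∀ δ, 0 < δ → ∀ F K,
      ⨅ (R : Finpartition (univ : Set Y)) (_ : R ≤ Q ∧ IsBorelPartition R),
        ⨅ (F : Finset (PartialAut 𝓗)) (_ : (1 : PartialAut 𝓗) ∈ F), ⨅ (δ : ℝ) (_ : 0 < δ),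
          growthRate d P β p (fun _ σ => (goodHomCount μ π Q R F δ σ : ℝ≥0∞))
        ≤ κ + growthRate d P β p fun _ σ =>
          (sepNumber (dist₂ ρ) ε (orb μ π ρ F K δ σ) : ℝ≥0∞) := by
    intro δ hδ F K
    obtain ⟨R, hRQ, hR, F', hF', δ', hδ', hle⟩ := h δ hδ F K
    refine iInf₂_le_of_le R ⟨hRQ, hR⟩ (iInf₂_le_of_le F' hF' (iInf₂_le_of_le δ' hδ'
      (growthRate_le_add hd β p ?_)))
    filter_upwards [hd.eventually_gt_atTop 0] with j hj
    exact Eventually.of_forall fun σ => hle (d j) σ hj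
  -- The real number `κ` is moved to the left so that the supremum over `ε` and the infima stand
  -- alone on the right.
  rw [add_comm]
  refine (EReal.sub_le_iff_le_add (by simp) (by simp)).1 (le_iSup₂_of_le ε hε
    (le_iInf₂ fun δ hδ => le_iInf₂ fun F _ => le_iInf fun K => ?_))
  exact EReal.sub_le_of_le_add' (h1 δ hδ F K)

variable [CompactSpace X] [TopologicalSpace.MetrizableSpace X] [BorelSpace X]
  [T2Space H]

theorem pseudometricEntropySup_le_partitionEntropy (h𝓖 : 𝓖.IsTopological) (h𝓗 : 𝓗.IsTopological)
    (he𝓖 : 𝓖.IsEtale) (he𝓗 : 𝓗.IsEtale) (hμ : 𝓖.IsPMP μ) (hν : 𝓗.IsPMP ν)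
    (hreg : 𝓗.IsRegularMeasure ν) (hπ : Continuous π.arr) (hbij : π.IsClassBijective)
    (hmap : μ.map π.obj = ν) (hP : IsSoficApprox 𝓗 ν d P)
    (hPc : IsAsymptoticallyContinuous 𝓗 ν d P) (β : Bias J) {p : ℝ≥0∞} (hp : 1 ≤ p)
    {ρ : PseudoMetric Y ℝ} (hρ : Continuous fun q : Y × Y => ρ q.1 q.2)
    (hgen : IsDynamicallyGenerating π ρ) :
    pseudometricEntropySup ν μ π d P β p ρ ≤ partitionEntropy μ π d P β p := by
  have := hμ.1
  have := hν.1
  -- Diameter zero is treated separately, because then `ρ` cannot see whether a partial automorphism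
  -- is defined.
  rcases (pmDiam_nonneg ρ).eq_or_lt with h0 | hpos
  · have := subsingleton_of_pmDiam_eq_zero hρ hgen h0.symm
    exact (pseudometricEntropySup_nonpos_of_subsingleton hP.prob β p ρ).trans
      (partitionEntropy_nonneg_of_subsingleton hbij hP β hp)
  refine iSup₂_le fun ε hε => ?_
  obtain ⟨Q, hQ, hQε⟩ := exists_small_partition μ hρ hε
  refine le_iSup₂_of_le Q hQ (le_iInf₂ fun R hR => le_iInf₂ fun F hF => le_iInf₂ fun δ hδ => ?_)
  obtain ⟨L, hL, E, F', K, t, hF', ht, hgood⟩ := exists_orb_label_mem_goodTuples h𝓖 h𝓗 he𝓖 he𝓗 hμ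
    hν hreg hπ hbij hmap hρ hgen hpos (fun q hq => (hQε q hq).1) hR.1 hR.2 hF hδ
  refine iInf₂_le_of_le t ht (iInf₂_le_of_le F' hF' (iInf_le_of_le K (growthRate_mono β p ?_)))
  obtain ⟨j₁, hj₁⟩ := hP.multiplicative E t ht
  obtain ⟨j₂, hj₂⟩ := hPc E t ht
  filter_upwards [eventually_ge_atTop j₁, eventually_ge_atTop j₂,
    hP.tendsto_d.eventually_gt_atTop 0] with j h1 h2 hd
  filter_upwards [hj₁ j h1, hj₂ j h2] with σ hσ hσ'
  rw [goodHomCount_eq hbij hR.1 hF]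
  exact_mod_cast sepNumber_distSup_le_encard (fun q hq => (hQε q hq).2) hL hd
    (hgood (d j) hd σ hσ hσ')

end entropy

end SoficGroupoid

theorem theorem9p5
    {Y G X H : Type*}
    [TopologicalSpace Y] [CompactSpace Y] [TopologicalSpace.MetrizableSpace Y]
    [MeasurableSpace Y] [BorelSpace Y]
    [TopologicalSpace X] [CompactSpace X] [TopologicalSpace.MetrizableSpace X]
    [MeasurableSpace X] [BorelSpace X]
    [TopologicalSpace G] [MeasurableSpace G] [BorelSpace G] [StandardBorelSpace G]
    [TopologicalSpace H] [T2Space H] [MeasurableSpace H] [BorelSpace H] [StandardBorelSpace H]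
    (𝓖 : MGpd Y G) (𝓗 : MGpd X H) (μ : Measure Y) (ν : Measure X)
    (h𝓖_top : 𝓖.IsTopological) (h𝓗_top : 𝓗.IsTopological)
    (h𝓖_pmp : 𝓖.IsPMP μ) (h𝓗_pmp : 𝓗.IsPMP ν)
    (π : GpdHom 𝓖.toGpd 𝓗.toGpd) (hπ_cont : Continuous π.arr)
    (hπ_bij : π.IsClassBijective) (hπ_map : μ.map π.obj = ν)
    {J : Type*} [Preorder J] [IsDirectedOrder J] [Nonempty J]
    (d : J → ℕ) (P : ∀ j, Measure (SoficMap 𝓗 (d j))) (hP : IsSoficApprox 𝓗 ν d P)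
    (β : Bias J) (p : ℝ≥0∞) (hp : 1 ≤ p)
    (ρ : PseudoMetric Y ℝ) (hρ_cont : Continuous fun q : Y × Y => ρ q.1 q.2)
    (hρ_gen : IsDynamicallyGenerating π ρ)
    (h𝓖_etale : 𝓖.IsEtale) (h𝓗_etale : 𝓗.IsEtale)
    (hν_reg : 𝓗.IsRegularMeasure ν)
    (hP_cont : IsAsymptoticallyContinuous 𝓗 ν d P) :
    pseudometricEntropy₂ ν μ π d P β p ρ = partitionEntropy μ π d P β p ∧
      pseudometricEntropySup ν μ π d P β p ρ = partitionEntropy μ π d P β p := by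
  have h1 := partitionEntropy_le_pseudometricEntropy₂ (ν := ν) (P := P) h𝓖_top h𝓖_etale h𝓖_pmp
    hπ_cont hπ_bij hP.tendsto_d β p hρ_cont hρ_gen
  have h2 := pseudometricEntropy₂_le_pseudometricEntropySup (ν := ν) (μ := μ) (π := π) (P := P)
    β p ρ
  have h3 := pseudometricEntropySup_le_partitionEntropy h𝓖_top h𝓗_top h𝓖_etale h𝓗_etale h𝓖_pmp
    h𝓗_pmp hν_reg hπ_cont hπ_bij hπ_map hP hP_cont β hp hρ_cont hρ_gen
  exact ⟨le_antisymm (h2.trans h3) h1, le_antisymm h3 (h1.trans h2)⟩
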